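/- Let $n,s\ge 1$, $m\ge 0$, $t\ge 2s$, and let $X$ be a smooth manifold of dimension $N=n+m$. For $r\ge 1$ let $\mathrm{Imm}\,T^r_nX$ be the manifold of regular $(r,n)$-velocities $j^r_0\gamma$ ($\gamma$ a smooth immersion of a neighbourhood of $0\in\mathbb R^n$ into $X$), with the right action $j^r_0\gamma\cdot j^r_0\alpha=j^r_0(\gamma\circ\alpha)$ of the group $L^r_n$ of invertible $r$-jets of $\mathbb R^n$ at $0$ with $\alpha(0)=0$. A chart $(x^A)=(x^i,x^\sigma)$ of $X$ ($i=1,\dots,n$; $\sigma=1,\dots,m$) gives the coordinates $x^A_{j_1,\dots,j_k}=\partial^k(x^A\circ\gamma)/\partial t^{j_1}\cdots\partial t^{j_k}|_0$, $k\le r$. Put $\partial^{j_1,\dots,j_k}_A=\frac{r_1!\cdots r_n!}{k!}\,\partial/\partial x^A_{j_1,\dots,j_k}$, where $r_i$ is the number of occurrences of $i$ in $j_1,\dots,j_k$, and $d_i=\sum_{|J|\le r-1}x^A_{iJ}\partial^J_A$. Repeated indices are summed; a sum over index sets $I$, $J$ runs over all sequences of indices of the given lengths; $d_J=d_{j_1}\cdots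 d_{j_k}$; $IJ$ is juxtaposition. Let $W^r$ be the part of the chart where $\det(\mathbf x):=\det(x^i_j)\ne0$. On $W^r$ let $\mathbf z=(z^i_I)_{1\le|I|\le r}$ be the inverse in $L^r_n$ of $\mathbf x=(x^i_I)_{1\le|I|\le r}$; equivalently, $(z^i_j)=(x^i_j)^{-1}$ and $z^i_{j_1,\dots,j_k}=z^p_{j_1}d_pz^i_{j_2,\dots,j_k}$. Let $y^\sigma=x^\sigma$, $y^\sigma_{i_1,\dots,i_k}=z^j_{i_1}d_jy^\sigma_{i_2,\dots,i_k}$. These are symmetric in the lower indices, and $(x^i,y^\sigma_I)_{|I|\le r}$ are coordinates on $\rho^r_n(W^r)$, where $\rho=\rho^r_n:\mathrm{Imm}\,T^r_nX\to P^r_nX=\mathrm{Imm}\,T^r_nX/L^r_n$ is the projection. In these coordinates put $\Delta^{j_1,\dots,j_k}_\sigma=\frac{r_1!\cdots r_n!}{k!}\,\partial/\partial y^\sigma_{j_1,\dots,j_k}$ and $D_i=\partial/\partial x^i+\sum_{|J|\le r-1}y^\sigma_{iJ}\Delta^J_\sigma$. A homogeneous differential equation on $\mathrm{Imm}\,T^s_nX$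 is a field $\mathcal T$ which in every chart is $\mathcal T=\mathcal T_A\,dx^A$ with smooth functions $\mathcal T_A$, and which satisfies $(\phi_a)^*\mathcal T=\det(a)\,\mathcal T$ for all $a\in L^s_n$ (where $\phi_a(v)=v\cdot a$ and $\det(a)=\det(a^i_j)$) and $(j^s\gamma)^*\mathcal T=0$ for all immersions $\gamma$. Then in every chart there are smooth functions $T_\sigma$ on $\rho(W^s)$, the components of the associated non-homogeneous equation, with $$\mathcal T_\sigma=\det(\mathbf x)\,T_\sigma\circ\rho,\qquad \mathcal T_i=-\det(\mathbf x)\,y^\sigma_i\,T_\sigma\circ\rho\qquad\text{on }W^s.$$ For $|J|\le s$ define the Helmholtz–Sonin expressions $$\mathcal H^J_{AB}(\mathcal T)=\partial^J_B\mathcal T_A-(-1)^{|J|}\mathcal E^J_A(\mathcal T_B),\qquad \mathcal E^I_A(f)=\sum_{|J|\le s-|I|}(-1)^{|J|}\tbinom{|I|+|J|}{|I|}d_J\partial^{IJ}_Af,$$ $$H^J_{\sigma\nu}(T)=\Delta^J_\nu T_\sigma-(-1)^{|J|}E^J_\sigma(T_\nu),\qquad E^I_\sigma(f)=\sum_{|J|\le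 s-|I|}(-1)^{|J|}\tbinom{|I|+|J|}{|I|}D_J\Delta^{IJ}_\sigma f,$$ as functions on $W^t$ and on $\rho(W^t)$ respectively. For $k\ge1$ write $$Z^{j_1,\dots,j_k}_I=\sum_{(I_1,\dots,I_k)}\mathcal S^+_{j_1,\dots,j_k}\,z^{j_1}_{I_1}\cdots z^{j_k}_{I_k},$$ the sum being over the partitions of the index set $I$ into $k$ nonempty subsets (up to permutation of the subsets), and $\mathcal S^+$ being the symmetrization projector. **Theorem.** In every chart one has on $W^t$, for all $\sigma,\nu\in\{1,\dots,m\}$, $p,q,j_1,\dots,j_k\in\{1,\dots,n\}$ and $k=1,\dots,s$: $$\mathcal H_{\sigma\nu}(\mathcal T)=\det(\mathbf x)\,H_{\sigma\nu}(T)\circ\rho,$$ $$\mathcal H^{j_1,\dots,j_k}_{\sigma\nu}(\mathcal T)=\det(\mathbf x)\sum_{k\le|I|\le s}Z^{j_1,\dots,j_k}_I\,H^I_{\sigma\nu}(T)\circ\rho,$$ $$\mathcal H_{\sigma p}(\mathcal T)=-\det(\mathbf x)\sum_{|I_0|\le s}y^\nu_{pI_0}\,H^{I_0}_{\sigma\nu}(T)\circ\rho,$$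 $$\mathcal H^{j_1,\dots,j_k}_{\sigma p}(\mathcal T)=-\det(\mathbf x)\sum_{|I_0|\le s}\ \sum_{|I|=k}^{s-|I_0|}\tbinom{|I|+|I_0|}{|I|}Z^{j_1,\dots,j_k}_I\,y^\nu_{pI_0}\,H^{II_0}_{\sigma\nu}(T)\circ\rho,$$ $$\mathcal H_{p\nu}(\mathcal T)=-\det(\mathbf x)\,y^\sigma_p\,H_{\sigma\nu}(T)\circ\rho,$$ $$\mathcal H^{j_1,\dots,j_k}_{p\nu}(\mathcal T)=-\det(\mathbf x)\,y^\sigma_p\sum_{k\le|I|\le s}Z^{j_1,\dots,j_k}_I\,H^I_{\sigma\nu}(T)\circ\rho,$$ $$\mathcal H_{pq}(\mathcal T)=\det(\mathbf x)\,y^\sigma_p\sum_{|I_0|\le s}y^\nu_{qI_0}\,H^{I_0}_{\sigma\nu}(T)\circ\rho,$$ $$\mathcal H^{j_1,\dots,j_k}_{pq}(\mathcal T)=\det(\mathbf x)\,y^\sigma_p\sum_{|I_0|\le s}\ \sum_{|I|=k}^{s-|I_0|}\tbinom{|I|+|I_0|}{|I|}Z^{j_1,\dots,j_k}_I\,y^\nu_{qI_0}\,H^{II_0}_{\sigma\nu}(T)\circ\rho.$$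 -/

import Mathlib

open scoped Manifold ContDiff Topology

noncomputable section

namespace Velocity

/-! ## Multi-indices, symmetrization -/

/-- Multi-indices `J` in the indices `1, …, n` with `|J| ≤ r`; a multiset is the same thing as a
sequence `j₁ ≤ j₂ ≤ ⋯ ≤ j_k`. -/
abbrev MIdx (n r : ℕ) : Type := {J : Multiset (Fin n) // J.card ≤ r}

instance instFiniteMIdx (n r : ℕ) : Finite (MIdx n r) := by
  refine Finite.of_injective
    (fun (J : MIdx n r) (i : Fin n) =>
      (⟨J.1.count i, Nat.lt_succ_of_le ((Multiset.count_le_card i J.1).trans J.2)⟩ : Fin (r + 1))) ?_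
  intro J K h
  apply Subtype.ext
  ext i
  simpa using congrArg Fin.val (congrFun h i)

instance instFintypeMIdx (n r : ℕ) : Fintype (MIdx n r) := Fintype.ofFinite _

/-- The factor `r₁! ⋯ r_n! / k!`, where `k = |J|` and `r_i` is the number of occurrences of the
index `i` in `J`. -/
def weight {n : ℕ} (J : Multiset (Fin n)) : ℝ :=
  (∏ i, ((J.count i).factorial : ℝ)) / (J.card.factorial : ℝ)

/-- The symmetrization projector `𝒮⁺_{j₁,…,j_k}`. -/
def symmetrize {n k : ℕ} (f : (Fin k → Fin n) → ℝ) (j : Fin k → Fin n) : ℝ :=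
  (∑ π : Equiv.Perm (Fin k), f (fun a => j (π a))) / (k.factorial : ℝ)

/-! ## Coordinates on the velocity manifold

For coordinates `x^A`, `A ∈ ι`, the coordinates on the manifold of `(r,n)`-velocities are `x^A_J`
with `|J| ≤ r`. -/

/-- The space of the coordinates `(x^A_J)`, `A ∈ ι`, `|J| ≤ r`. -/
abbrev Jet (ι : Type) (n r : ℕ) : Type := ι → MIdx n r → ℝ

/-- The coordinate `x^A_J` (and `0` if `|J| > r`). -/
def Jet.get {ι : Type} {n r : ℕ} (x : Jet ι n r) (A : ι) (J : Multiset (Fin n)) : ℝ :=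
  if h : J.card ≤ r then x A ⟨J, h⟩ else 0

/-- The projection from order `t` to order `s ≤ t`. -/
def Jet.trunc {ι : Type} {n t : ℕ} (s : ℕ) (x : Jet ι n t) : Jet ι n s :=
  fun A J => x.get A J.1

/-- The partial derivative `∂f/∂x^A_J` (and `0` if `|J| > r`). -/
def pder {ι : Type} [Fintype ι] [DecidableEq ι] {n r : ℕ} (A : ι) (J : Multiset (Fin n))
    (f : Jet ι n r → ℝ) (x : Jet ι n r) : ℝ :=
  if h : J.card ≤ r then fderiv ℝ f x (Pi.single A (Pi.single ⟨J, h⟩ 1)) else 0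

/-- The operator `∂^{j₁,…,j_k}_A = (r₁! ⋯ r_n! / k!) ∂/∂x^A_{j₁,…,j_k}`. -/
def del {ι : Type} [Fintype ι] [DecidableEq ι] {n r : ℕ} (A : ι) (J : List (Fin n))
    (f : Jet ι n r → ℝ) (x : Jet ι n r) : ℝ :=
  weight (J : Multiset (Fin n)) * pder A (J : Multiset (Fin n)) f x

/-- The formal derivative `d_i = ∑_{k < r} x^A_{i,j₁,…,j_k} ∂^{j₁,…,j_k}_A`. A multi-index `J`
belongs to `k! / (r₁! ⋯ r_n!)` sequences `j₁, …, j_k`, so that the sum over the sequences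
is `∑_{|J| < r} x^A_{iJ} ∂/∂x^A_J`, the sum being over the multi-indices. -/
def formalD {ι : Type} [Fintype ι] [DecidableEq ι] {n r : ℕ} (i : Fin n)
    (f : Jet ι n r → ℝ) (x : Jet ι n r) : ℝ :=
  ∑ A, ∑ J : MIdx n r, if J.1.card < r then x.get A (i ::ₘ J.1) * pder A J.1 f x else 0

/-- `d_{j₁} ⋯ d_{j_k}`. -/
def formalDs {ι : Type} [Fintype ι] [DecidableEq ι] {n r : ℕ} (J : List (Fin n))
    (f : Jet ι n r → ℝ) : Jet ι n r → ℝ :=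
  J.foldr formalD f

/-- The Lie–Euler operators
`𝓔^I_A(f) = ∑_{|J| ≤ s - |I|} (-1)^{|J|} (|I|+|J| choose |I|) d_J ∂^{IJ}_A f`, acting on functions
`f` of order `s`, with values in the functions of order `t`; here and below a sum over an index
set `J` of given length is a sum over all sequences `j₁, …, j_l`. -/
def lieEuler {ι : Type} [Fintype ι] [DecidableEq ι] {n : ℕ} (s t : ℕ) (A : ι) (I : List (Fin n))
    (f : Jet ι n s → ℝ) (x : Jet ι n t) : ℝ :=
  ∑ l ∈ Finset.range (s + 1), ∑ J : Fin l → Fin n,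
    if I.length + l ≤ s then
      (-1) ^ l * ((I.length + l).choose I.length : ℝ) *
        formalDs (List.ofFn J) (del A (I ++ List.ofFn J) (fun x' => f (x'.trunc s))) x
    else 0

/-- The Helmholtz–Sonin expressions `𝓗^J_{AB} = ∂^J_B 𝓣_A - (-1)^{|J|} 𝓔^J_A(𝓣_B)` of the functions
`𝓣_A` of order `s`, as functions of order `t`. -/
def helmholtz {ι : Type} [Fintype ι] [DecidableEq ι] {n : ℕ} (s t : ℕ)
    (T : ι → Jet ι n s → ℝ) (A B : ι) (J : List (Fin n)) (x : Jet ι n t) : ℝ :=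
  del B J (fun x' => T A (x'.trunc s)) x - (-1) ^ J.length * lieEuler s t A J (T B) x

/-! ## The invariants `y^σ_I` and the functions `z^i_I`

The coordinates of the manifold are split as `x^i`, `i = 1, …, n` (`Sum.inl i`) and `x^σ`,
`σ = 1, …, m` (`Sum.inr σ`). -/

/-- The matrix `(x^i_j)`; its determinant is `det(𝐱)`. -/
def xMat {n m r : ℕ} (x : Jet (Fin n ⊕ Fin m) n r) : Matrix (Fin n) (Fin n) ℝ :=
  fun i j => x.get (Sum.inl i) {j}

/-- The functions `z^i_I`, `|I| ≥ 1`: `(z^i_j)` is the inverse of the matrix `(x^i_j)` and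
`z^i_{j₁,…,j_k} = z^p_{j₁} d_p z^i_{j₂,…,j_k}`. (There is no `z^i_∅`.) -/
def zCoord {n m r : ℕ} (i : Fin n) : List (Fin n) → Jet (Fin n ⊕ Fin m) n r → ℝ
  | [] => fun _ => 0
  | [j] => fun x => (xMat x)⁻¹ i j
  | j :: k :: J => fun x => ∑ p, (xMat x)⁻¹ p j * formalD p (zCoord i (k :: J)) x

/-- The functions `y^σ = x^σ`, `y^σ_{i₁,…,i_k} = z^j_{i₁} d_j y^σ_{i₂,…,i_k}`. -/
def yCoord {n m r : ℕ} (σ : Fin m) : List (Fin n) → Jet (Fin n ⊕ Fin m) n r → ℝ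
  | [] => fun x => x.get (Sum.inr σ) 0
  | i :: I => fun x => ∑ j, (xMat x)⁻¹ j i * formalD j (yCoord σ I) x

/-- For `j = (j₁,…,j_k)` and `I = (i₁,…,i_l)` the sum
`∑_{(I₁,…,I_k)} 𝒮⁺_{j₁,…,j_k} z^{j₁}_{I₁} ⋯ z^{j_k}_{I_k}` over the partitions of the set of the
indices of `I` into `k` nonempty subsets, not distinguishing partitions which differ by a
permutation of the subsets. -/
def zSum {n m r k l : ℕ} (j : Fin k → Fin n) (I : Fin l → Fin n)
    (x : Jet (Fin n ⊕ Fin m) n r) : ℝ :=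
  ∑ c : OrderedFinpartition l,
    if h : c.length = k then
      symmetrize (fun j' : Fin k → Fin n =>
        ∏ a : Fin c.length, zCoord (j' (Fin.cast h a)) (List.ofFn (I ∘ c.emb a)) x) j
    else 0

/-! ## Coordinates on the Grassmann manifold -/

/-- The space of the coordinates `(x^i, y^σ_I)`, `|I| ≤ r`. -/
abbrev Gr (n m r : ℕ) : Type := (Fin n → ℝ) × Jet (Fin m) n r

/-- The projection from order `t` to order `s ≤ t`. -/
def Gr.trunc {n m t : ℕ} (s : ℕ) (g : Gr n m t) : Gr n m s := (g.1, g.2.trunc s)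

/-- The canonical projection `ρ^r_n` from the regular velocities to the Grassmann manifold in
coordinates. -/
def rho {n m r : ℕ} (x : Jet (Fin n ⊕ Fin m) n r) : Gr n m r :=
  (fun i => x.get (Sum.inl i) 0, fun σ I => yCoord σ (I.1.sort (· ≤ ·)) x)

/-- The partial derivative `∂f/∂y^σ_J` (and `0` if `|J| > r`). -/
def pderY {n m r : ℕ} (σ : Fin m) (J : Multiset (Fin n)) (f : Gr n m r → ℝ) (g : Gr n m r) : ℝ :=
  if h : J.card ≤ r then fderiv ℝ f g (0, Pi.single σ (Pi.single ⟨J, h⟩ 1)) else 0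

/-- The operator `Δ^{j₁,…,j_k}_σ = (r₁! ⋯ r_n! / k!) ∂/∂y^σ_{j₁,…,j_k}`. -/
def grDel {n m r : ℕ} (σ : Fin m) (J : List (Fin n)) (f : Gr n m r → ℝ) (g : Gr n m r) : ℝ :=
  weight (J : Multiset (Fin n)) * pderY σ (J : Multiset (Fin n)) f g

/-- The total derivative `D_i = ∂/∂x^i + ∑_{k < r} y^σ_{i,j₁,…,j_k} Δ^{j₁,…,j_k}_σ`, the sum being
written as a sum over multi-indices, as in `formalD`. -/
def grD {n m r : ℕ} (i : Fin n) (f : Gr n m r → ℝ) (g : Gr n m r) : ℝ :=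
  fderiv ℝ f g (Pi.single i 1, 0) +
    ∑ σ, ∑ J : MIdx n r, if J.1.card < r then g.2.get σ (i ::ₘ J.1) * pderY σ J.1 f g else 0

/-- `D_{j₁} ⋯ D_{j_k}`. -/
def grDs {n m r : ℕ} (J : List (Fin n)) (f : Gr n m r → ℝ) : Gr n m r → ℝ :=
  J.foldr grD f

/-- The Lie–Euler operators
`E^I_σ(f) = ∑_{|J| ≤ s - |I|} (-1)^{|J|} (|I|+|J| choose |I|) D_J Δ^{IJ}_σ f`. -/
def grLieEuler {n m : ℕ} (s t : ℕ) (σ : Fin m) (I : List (Fin n))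
    (f : Gr n m s → ℝ) (g : Gr n m t) : ℝ :=
  ∑ l ∈ Finset.range (s + 1), ∑ J : Fin l → Fin n,
    if I.length + l ≤ s then
      (-1) ^ l * ((I.length + l).choose I.length : ℝ) *
        grDs (List.ofFn J) (grDel σ (I ++ List.ofFn J) (fun g' => f (g'.trunc s))) g
    else 0

/-- The Helmholtz–Sonin expressions `H^I_{σν}(T) = Δ^I_ν T_σ - (-1)^{|I|} E^I_σ(T_ν)`. -/
def grHelmholtz {n m : ℕ} (s t : ℕ) (T : Fin m → Gr n m s → ℝ) (σ ν : Fin m)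
    (I : List (Fin n)) (g : Gr n m t) : ℝ :=
  grDel ν I (fun g' => T σ (g'.trunc s)) g - (-1) ^ I.length * grLieEuler s t σ I (T ν) g

/-! ## Regular velocities of a manifold and differential equations -/

/-- The model space of a manifold of dimension `N = n + m`. -/
abbrev Model (n m : ℕ) : Type := Fin n ⊕ Fin m → ℝ

section Manifold

variable (n m r : ℕ) (X : Type*) [TopologicalSpace X] [ChartedSpace (Model n m) X]

/-- Smooth immersions into `X` of a neighbourhood of `0 ∈ ℝⁿ`. -/
structure ImmGerm where
  toFun : (Fin n → ℝ) → X
  immersion : ∃ U : Set (Fin n → ℝ), IsOpen U ∧ 0 ∈ U ∧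
    ContMDiffOn 𝓘(ℝ, Fin n → ℝ) 𝓘(ℝ, Model n m) ∞ toFun U ∧
    ∀ t ∈ U, Function.Injective (mfderiv 𝓘(ℝ, Fin n → ℝ) 𝓘(ℝ, Model n m) toFun t)

variable {n m X}

/-- `∂^k (x^A ∘ γ) / ∂t^{j₁} ⋯ ∂t^{j_k}` at `0`, in the chart `e = (x^A)` and for
`J = {j₁ ≤ ⋯ ≤ j_k}`. -/
def ImmGerm.coord (e : OpenPartialHomeomorph X (Model n m)) (γ : ImmGerm n m X)
    (A : Fin n ⊕ Fin m) (J : Multiset (Fin n)) : ℝ :=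
  iteratedFDeriv ℝ (J.sort (· ≤ ·)).length (fun t => e (γ.toFun t) A) 0
    (fun a => Pi.single ((J.sort (· ≤ ·)).get a) 1)

variable (n m X)

/-- Two immersions have the same `r`-jet at `0` if they have the same value at `0` and, in the
charts at this point, the same partial derivatives at `0` up to order `r`. (By the chain rule, it
is the same to ask this for one chart or for all charts.) -/
def SameJet {n m : ℕ} (r : ℕ) {X : Type*} [TopologicalSpace X] [ChartedSpace (Model n m) X]
    (γ δ : ImmGerm n m X) : Prop :=
  γ.toFun 0 = δ.toFun 0 ∧
    ∀ e ∈ IsManifold.maximalAtlas 𝓘(ℝ, Model n m) ∞ X, γ.toFun 0 ∈ e.source →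
      ∀ (A : Fin n ⊕ Fin m) (J : Multiset (Fin n)), J.card ≤ r → γ.coord e A J = δ.coord e A J

theorem SameJet.equivalence : Equivalence (SameJet r : ImmGerm n m X → ImmGerm n m X → Prop) := by
  refine ⟨fun _ => ⟨rfl, fun _ _ _ _ _ _ => rfl⟩, ?_, ?_⟩
  · intro γ δ h
    exact ⟨h.1.symm, fun e he hs A J hJ => (h.2 e he (h.1 ▸ hs) A J hJ).symm⟩
  · intro γ δ ε h h'
    exact ⟨h.1.trans h'.1, fun e he hs A J hJ =>
      (h.2 e he hs A J hJ).trans (h'.2 e he (h.1 ▸ hs) A J hJ)⟩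

/-- The equivalence relation of having the same `r`-jet at `0`. -/
def jetSetoid : Setoid (ImmGerm n m X) := ⟨SameJet r, SameJet.equivalence n m r X⟩

/-- The set `Imm T^r_n X` of the regular `(r,n)`-velocities. -/
def RegVel : Type _ := Quotient (jetSetoid n m r X)

variable {n m r X}

/-- The `r`-jet `j^r_0 γ`. -/
def ImmGerm.jet (r : ℕ) (γ : ImmGerm n m X) : RegVel n m r X := Quotient.mk (jetSetoid n m r X) γ

/-- The projection `j^r_0 γ ↦ γ(0)`. -/
def RegVel.target (v : RegVel n m r X) : X :=
  Quotient.lift (s := jetSetoid n m r X) (fun γ => γ.toFun 0)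
    (fun γ δ (h : SameJet r γ δ) => h.1) v

/-- The coordinates `(x^A_J)` of `v` in the chart associated with a chart `e = (x^A)` at the target
of `v` (they do not depend on the representative). -/
def RegVel.coords (e : OpenPartialHomeomorph X (Model n m)) (v : RegVel n m r X) :
    Jet (Fin n ⊕ Fin m) n r :=
  fun A J => (Quotient.out (s := jetSetoid n m r X) v).coord e A J.1

/-- The image in the space of coordinates of the chart on `Imm T^r_n X` associated with `e`:
`(x^A)` is in the image of `e` and the matrix `(x^A_j)` has rank `n`. -/
def immSet (r : ℕ) (e : OpenPartialHomeomorph X (Model n m)) : Set (Jet (Fin n ⊕ Fin m) n r) :=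
  {x | (fun A => x.get A 0) ∈ e.target ∧
    LinearIndependent ℝ (fun (j : Fin n) (A : Fin n ⊕ Fin m) => x.get A {j})}

/-- The image in the space of coordinates of the chart domain `W^r`, where `det(x^i_j) ≠ 0`. -/
def wSet (r : ℕ) (e : OpenPartialHomeomorph X (Model n m)) : Set (Jet (Fin n ⊕ Fin m) n r) :=
  {x | (fun A => x.get A 0) ∈ e.target ∧ (xMat x).det ≠ 0}

/-- The image in the space of coordinates of the chart domain `ρ^r_n(W^r)`. -/
def grSet (r : ℕ) (e : OpenPartialHomeomorph X (Model n m)) : Set (Gr n m r) :=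
  {g | (Sum.elim g.1 (fun σ => g.2.get σ 0) : Model n m) ∈ e.target}

variable (n m r X)

/-- Fields of forms `𝓣 = 𝓣_A dx^A` on `Imm T^r_n X`: `𝓣` assigns to a regular velocity a covector
of `X` at its target. -/
abbrev HorForm : Type _ :=
  (v : RegVel n m r X) → TangentSpace 𝓘(ℝ, Model n m) v.target →L[ℝ] ℝ

variable {n m r X}

/-- The component `𝓣_A = 𝓣(∂/∂x^A)` at a velocity, in the chart `e = (x^A)`. -/
def HorForm.comp (T : HorForm n m r X) (e : OpenPartialHomeomorph X (Model n m))
    (A : Fin n ⊕ Fin m) (v : RegVel n m r X) : ℝ :=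
  T v (mfderiv 𝓘(ℝ, Model n m) 𝓘(ℝ, Model n m) e.symm (e v.target)
    (Pi.single A 1 : Model n m))

/-- The component `𝓣_A` as a function of the coordinates `(x^A_J)`
(with the value `0` outside of the image of the chart). -/
def HorForm.expr (T : HorForm n m r X) (e : OpenPartialHomeomorph X (Model n m))
    (A : Fin n ⊕ Fin m) : Jet (Fin n ⊕ Fin m) n r → ℝ :=
  Function.extend (fun v : {v : RegVel n m r X // v.target ∈ e.source} => v.1.coords e)
    (fun v => T.comp e A v.1) 0

variable (n m r X)

/-- A differential equation on `Imm T^r_n X`: locally `𝓣 = 𝓣_A dx^A` with smooth functions `𝓣_A`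
on the associated charts. -/
structure DiffEq where
  form : HorForm n m r X
  smooth : ∀ e ∈ IsManifold.maximalAtlas 𝓘(ℝ, Model n m) ∞ X, ∀ A,
    ContDiffOn ℝ ∞ (form.expr e A) (immSet r e)

/-- Representatives of the elements of the differential group `L^r_n`: maps of a neighbourhood of
`0 ∈ ℝⁿ` to `ℝⁿ`, smooth and with `α(0) = 0` and invertible differential at `0`. -/
structure DiffGerm (n : ℕ) where
  toFun : (Fin n → ℝ) → (Fin n → ℝ)
  smooth : ∃ U : Set (Fin n → ℝ), IsOpen U ∧ 0 ∈ U ∧ ContDiffOn ℝ ∞ toFun U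
  map_zero : toFun 0 = 0
  det_ne_zero : (fderiv ℝ toFun 0).det ≠ 0

variable {n m r X}

/-- Homogeneous differential equations: `(φ_a)^* 𝓣 = det(a) 𝓣` for all `a = j^r_0 α` in the
differential group, where `φ_a(j^r_0 γ) = j^r_0(γ ∘ α)`, and `(j^r γ)^* 𝓣 = 0` for all
immersions `γ`. (As `φ_a` covers the identity of `X`, the components of `(φ_a)^* 𝓣` are the
`𝓣_A ∘ φ_a`. The components of `(j^r γ)^* 𝓣` are the `𝓣_A ∂γ^A/∂t^j`.) -/
structure DiffEq.IsHomogeneous (T : DiffEq n m r X) : Prop where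
  equivariant : ∀ (γ δ : ImmGerm n m X) (α : DiffGerm n),
    δ.toFun =ᶠ[𝓝 0] γ.toFun ∘ α.toFun →
    ∀ ξ : Model n m,
      T.form (δ.jet r) ξ = (fderiv ℝ α.toFun 0).det * T.form (γ.jet r) ξ
  contraction : ∀ (γ : ImmGerm n m X) (j : Fin n),
    T.form (γ.jet r) (mfderiv 𝓘(ℝ, Fin n → ℝ) 𝓘(ℝ, Model n m) γ.toFun 0
      (Pi.single j 1 : Fin n → ℝ)) = 0

/-- The smooth functions `T_σ` on `ρ(W^r)` are the components of the associated non-homogeneous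
differential equation in the chart `e`: `𝓣_σ = det(𝐱) T_σ ∘ ρ` and
`𝓣_i = - det(𝐱) y^σ_i T_σ ∘ ρ` on `W^r`. -/
structure DiffEq.IsAssociated (T : DiffEq n m r X) (e : OpenPartialHomeomorph X (Model n m))
    (T' : Fin m → Gr n m r → ℝ) : Prop where
  smooth : ∀ σ, ContDiffOn ℝ ∞ (T' σ) (grSet r e)
  fibre : ∀ σ, ∀ x ∈ wSet r e,
    T.form.expr e (Sum.inr σ) x = (xMat x).det * T' σ (rho x)
  base : ∀ i, ∀ x ∈ wSet r e,
    T.form.expr e (Sum.inl i) x = -((xMat x).det * ∑ σ, yCoord σ [i] x * T' σ (rho x))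

end Manifold

end Velocity

end

noncomputable section

namespace Velocity

set_option linter.unusedSectionVars false

/-! Let `L_A(w) = ∑ ∂^I_B 𝓣_A d_I w^B` be the linearization of `𝓣_A`, and `ℓ_σ` that of `T_σ`. The
Helmholtz–Sonin expressions are the coefficients of the difference of such an operator and its
formal adjoint, so all eight formulas come from one comparison of `L - L*` with `ℓ - ℓ*`.

Put `e_i = z^j_i d_j`. Along the projection `ρ` the total derivative `D_i` becomes `e_i`
(`eGerm_pull_grD`), and what a variation `w` induces on the quotient is governed by its
characteristic `Q^σ = w^σ - y^σ_i w^i` (the prolongation formula `vari_yCoord`). Together with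
Jacobi's formula for the variation of `det(𝐱)` and Piola's identity `d_j(det(𝐱) z^j_i) = 0`, this
gives `L_σ(w) = d_j(det(𝐱) T_σ z^j_i w^i) + det(𝐱) ℓ_σ(Q(w))`, and `L_i` follows from `𝓣_i = -y^σ_i
𝓣_σ` (`IsHomogeneousAt.isVariation`). Hence, modulo total derivatives, `L_A(v) w^A - v^A L_A(w)`
depends on `v` and `w` only through their characteristics, and equals `det(𝐱)` times the same
expression for `ℓ` (`variation_skew`). Integrating by parts on both sides, `d_i` being skew for `∫
·` and `e_i` for `∫ det(𝐱) ·`, one obtains `(L - L*)_σ(v) = det(𝐱) (ℓ - ℓ*)_σ(Q(v))` and `(L -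
L*)_i(v) = -det(𝐱) y^σ_i (ℓ - ℓ*)_σ(Q(v))` (`helmholtz_operator`).

The integration is algebraic. Functions of jets are restricted to the polynomial map with the given
jet `x`; they become germs on `ℝⁿ`, and formal derivatives become partial derivatives. While `v`
consists of germs, `w` consists of additive functionals on germs, on which the derivations act by
duality. The value of a functional on `1` plays the role of the integral, and taking for `w` the
evaluation at `0` reads off the value of an operator at `x`.

The coefficients are extracted with a weighted monomial as the only nonzero component `v^B`. By the
formula of Faà di Bruno its derivatives along the `e_i` are the `Z^{j_1,…,j_k}_I`. If `B` is a fibre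
index the characteristic is this monomial; if `B = p` it is the monomial times `-y^ν_p`, and the
Leibniz rule yields the binomial coefficients and the `y^ν_{pI₀}`.

The components `T_σ` exist because a velocity in `W^s` can be reparametrized so that its first `n`
components become `τ^i + const`; its other coordinates are then the `y^σ_I`. Equivariance produces
the factor `det(𝐱)`, and the contraction property produces `𝓣_i`. -/

/-- Invariance under permutations of the indices. -/
def IsSymm {ι β : Type*} (a : List ι → β) : Prop := ∀ J K : List ι, J.Perm K → a J = a K

theorem IsSymm.cons {ι β : Type*} {a : List ι → β} (h : IsSymm a) (i : ι) :
    IsSymm (fun J => a (i :: J)) := fun _ _ hJ => h _ _ (hJ.cons i)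

theorem IsSymm.concat {ι β : Type*} {a : List ι → β} (h : IsSymm a) (i : ι) :
    IsSymm (fun J => a (J ++ [i])) := fun _ _ hJ => h _ _ (hJ.append_right _)

/-! ## Sums over sequences of indices -/

section Sequences

variable {ι : Type*} [Fintype ι] {N : Type*} [AddCommMonoid N]

/-- The sum of `F` over all sequences of length `l`. -/
def seqSum (l : ℕ) (F : List ι → N) : N := ∑ J : Fin l → ι, F (List.ofFn J)

theorem seqSum_zero (F : List ι → N) : seqSum 0 F = F [] := by simp [seqSum]

theorem seqSum_succ (l : ℕ) (F : List ι → N) :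
    seqSum (l + 1) F = ∑ i, seqSum l (fun J => F (i :: J)) := by
  unfold seqSum
  rw [← (Fin.consEquiv (fun _ : Fin (l + 1) => ι)).sum_comp, Fintype.sum_prod_type]
  simp [List.ofFn_succ, Fin.consEquiv]

theorem seqSum_succ_last (l : ℕ) (F : List ι → N) :
    seqSum (l + 1) F = ∑ i, seqSum l (fun J => F (J ++ [i])) := by
  induction l generalizing F with
  | zero => simp [seqSum_succ, seqSum_zero]
  | succ l ih =>
    rw [seqSum_succ]
    have h1 : ∀ i, seqSum (l + 1) (fun J => F (i :: J)) =
        ∑ k, seqSum l (fun J => F (i :: (J ++ [k]))) := fun i => ih _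
    rw [Finset.sum_congr rfl fun i _ => h1 i, Finset.sum_comm]
    refine Finset.sum_congr rfl fun i _ => ?_
    rw [seqSum_succ]
    rfl

theorem seqSum_congr {l : ℕ} {F G : List ι → N} (h : ∀ J : List ι, J.length = l → F J = G J) :
    seqSum l F = seqSum l G :=
  Finset.sum_congr rfl fun J _ => h _ (by simp)

theorem seqSum_add (l : ℕ) (F G : List ι → N) :
    seqSum l (fun J => F J + G J) = seqSum l F + seqSum l G := Finset.sum_add_distrib

theorem seqSum_sum {κ : Type*} (s : Finset κ) (l : ℕ) (F : κ → List ι → N) :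
    seqSum l (fun J => ∑ k ∈ s, F k J) = ∑ k ∈ s, seqSum l (F k) := Finset.sum_comm

theorem seqSum_zero_fun (l : ℕ) : seqSum l (fun _ : List ι => (0 : N)) = 0 := by simp [seqSum]

theorem seqSum_nsmul (l k : ℕ) (F : List ι → N) :
    seqSum l (fun J => k • F J) = k • seqSum l F := by simp [seqSum, Finset.smul_sum]

theorem map_seqSum {N' H : Type*} [AddCommMonoid N'] [FunLike H N N'] [AddMonoidHomClass H N N']
    (f : H) (l : ℕ) (F : List ι → N) : f (seqSum l F) = seqSum l (fun J => f (F J)) := by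
  simp [seqSum, map_sum]

theorem smul_seqSum {R : Type*} [Semiring R] [Module R N] (a : R) (l : ℕ) (F : List ι → N) :
    a • seqSum l F = seqSum l (fun J => a • F J) := by simp [seqSum, Finset.smul_sum]

theorem seqSum_smul {R : Type*} [Semiring R] [Module R N] (l : ℕ) (F : List ι → R) (m : N) :
    seqSum l F • m = seqSum l (fun J => F J • m) := by simp [seqSum, Finset.sum_smul]

/-- The sum over sequences of a function of the underlying multi-index, weighted by
`r₁! ⋯ r_n! / k!`. -/
theorem seqSum_weight_indicator {n : ℕ} (K : Multiset (Fin n)) :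
    seqSum K.card (fun J : List (Fin n) => if (J : Multiset (Fin n)) = K then weight K else 0)
      = 1 := by
  -- Without denominators: the number of orderings of `K` times `∏ r_i!` is `l!`. The orderings that
  -- begin with `i` contribute `(l - 1)! r_i`, and the `r_i` add up to `l`.
  suffices h : ∀ (l : ℕ) (K : Multiset (Fin n)), K.card = l →
      seqSum l (fun J : List (Fin n) => if (J : Multiset (Fin n)) = K then (1 : ℝ) else 0) *
        (∏ i, ((K.count i).factorial : ℝ)) = (l.factorial : ℝ) by
    have h1 := h _ K rfl
    have h2 : seqSum K.card (fun J : List (Fin n) =>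
        if (J : Multiset (Fin n)) = K then weight K else 0) =
        seqSum K.card (fun J : List (Fin n) =>
          if (J : Multiset (Fin n)) = K then (1 : ℝ) else 0) * weight K := by
      rw [mul_comm, ← smul_eq_mul, smul_seqSum]
      exact seqSum_congr fun J _ => by split_ifs <;> simp
    rw [h2, weight, ← mul_div_assoc, h1, div_self]
    exact_mod_cast Nat.factorial_ne_zero _
  intro l
  induction l with
  | zero =>
    intro K hK
    rw [Multiset.card_eq_zero] at hK
    subst hK
    simp [seqSum_zero]
  | succ l ih =>
    intro K hK
    rw [seqSum_succ, Finset.sum_mul]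
    have key : ∀ i : Fin n, seqSum l (fun J : List (Fin n) =>
        if ((i :: J : List (Fin n)) : Multiset (Fin n)) = K then (1 : ℝ) else 0) *
          (∏ i, ((K.count i).factorial : ℝ)) = (l.factorial : ℝ) * K.count i := by
      intro i
      by_cases hi : i ∈ K
      · have h1 : K = i ::ₘ K.erase i := (Multiset.cons_erase hi).symm
        have hc : (K.erase i).card = l := by
          rw [Multiset.card_erase_of_mem hi, hK]; rfl
        have h2 : (fun J : List (Fin n) =>
            if ((i :: J : List (Fin n)) : Multiset (Fin n)) = K then (1 : ℝ) else 0) =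
            (fun J : List (Fin n) => if (J : Multiset (Fin n)) = K.erase i then (1 : ℝ) else 0) := by
          funext J
          congr 1
          rw [← Multiset.cons_coe]
          conv_lhs => rw [h1]
          rw [Multiset.cons_inj_right]
        rw [h2, ← ih _ hc, mul_assoc]
        congr 1
        rw [← Finset.prod_erase_mul _ _ (Finset.mem_univ i),
          ← Finset.prod_erase_mul (a := i) Finset.univ _ (Finset.mem_univ i), mul_assoc]
        congr 1
        · apply Finset.prod_congr rfl
          intro k hk
          rw [Multiset.count_erase_of_ne (Finset.ne_of_mem_erase hk)]
        · rw [Multiset.count_erase_self]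
          have : K.count i ≠ 0 := by rwa [Ne, Multiset.count_eq_zero, not_not]
          obtain ⟨c, hc⟩ := Nat.exists_eq_succ_of_ne_zero this
          rw [hc, Nat.factorial_succ]
          push_cast
          simp [mul_comm]
      · have h2 : ∀ J : List (Fin n), ((i :: J : List (Fin n)) : Multiset (Fin n)) ≠ K := by
          rintro J rfl
          exact hi (by simp)
        simp [h2, seqSum_zero_fun, Multiset.count_eq_zero.2 hi]
    simp_rw [key]
    rw [← Finset.mul_sum, ← Nat.cast_sum, Multiset.sum_count_eq_card (fun a _ => Finset.mem_univ a),
      hK, Nat.factorial_succ]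
    push_cast
    ring

end Sequences

/-- The Leibniz rule produces sums over the splittings of a total order, the Lie–Euler operators
truncated double sums. This passes between the two. -/
theorem sum_range_antidiagonal {M : Type*} [AddCommMonoid M] (s : ℕ) (g : ℕ → ℕ → M) :
    ∑ l ∈ Finset.range (s + 1), ∑ pq ∈ Finset.HasAntidiagonal.antidiagonal l, g pq.1 pq.2 =
    ∑ p ∈ Finset.range (s + 1), ∑ q ∈ Finset.range (s + 1), if p + q ≤ s then g p q else 0 := by
  rw [← Finset.sum_product' (s := Finset.range (s + 1)) (t := Finset.range (s + 1))
    (f := fun p q => if p + q ≤ s then g p q else 0), ← Finset.sum_filter,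
    ← Finset.sum_fiberwise_of_maps_to (g := fun pq : ℕ × ℕ => pq.1 + pq.2)
      (t := Finset.range (s + 1))]
  · refine Finset.sum_congr rfl fun l hl => Finset.sum_congr ?_ fun _ _ => rfl
    ext ⟨p, q⟩
    simp only [Finset.mem_range] at hl
    simp only [Finset.HasAntidiagonal.mem_antidiagonal, Finset.mem_filter, Finset.mem_product,
      Finset.mem_range]
    omega
  · intro pq hpq
    simp only [Finset.mem_filter, Finset.mem_range] at hpq ⊢
    omega

/-! ## Derivations -/

section Derivations

variable {ι : Type*} {R N : Type*} [CommRing R] [AddCommGroup N] [Module R N]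

/-- The operators `D_i` satisfy the Leibniz rule with respect to the operators `d_i`. -/
def IsConn (d : ι → R →+ R) (D : ι → N →+ N) : Prop :=
  ∀ i (a : R) (m : N), D i (a • m) = a • D i m + d i a • m

/-- The operators `D_i` commute. -/
def Commuting (D : ι → N →+ N) : Prop := ∀ i j m, D i (D j m) = D j (D i m)

/-- `D_{j₁} ⋯ D_{j_k}`. -/
def iter (D : ι → N →+ N) (J : List ι) (m : N) : N := J.foldr (fun i m => D i m) m

variable {d : ι → R →+ R} {D : ι → N →+ N}

@[simp] theorem iter_nil (m : N) : iter D [] m = m := rfl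

@[simp] theorem iter_cons (i : ι) (J : List ι) (m : N) : iter D (i :: J) m = D i (iter D J m) := rfl

theorem iter_append (I J : List ι) (m : N) : iter D (I ++ J) m = iter D I (iter D J m) :=
  List.foldr_append

@[simp] theorem iter_add (J : List ι) (m m' : N) : iter D J (m + m') = iter D J m + iter D J m' := by
  induction J with
  | nil => rfl
  | cons i J ih => simp [ih]

@[simp] theorem iter_zero (J : List ι) : iter D J 0 = 0 := by
  induction J with
  | nil => rfl
  | cons i J ih => simp [ih]

theorem iter_neg (J : List ι) (m : N) : iter D J (-m) = -iter D J m := by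
  induction J with
  | nil => rfl
  | cons i J ih => simp [ih]

theorem iter_sub (J : List ι) (m m' : N) : iter D J (m - m') = iter D J m - iter D J m' := by
  rw [sub_eq_add_neg, iter_add, iter_neg, sub_eq_add_neg]

theorem iter_sum {κ : Type*} (s : Finset κ) (J : List ι) (m : κ → N) :
    iter D J (∑ k ∈ s, m k) = ∑ k ∈ s, iter D J (m k) := by
  induction J with
  | nil => rfl
  | cons i J ih => simp [ih]

theorem Commuting.iter_perm (h : Commuting D) (m : N) {J K : List ι} (hJK : J.Perm K) :
    iter D J m = iter D K m := by
  induction hJK with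
  | nil => rfl
  | cons i _ ih => rw [iter_cons, ih, iter_cons]
  | swap i j J => simp only [iter_cons]; exact h _ _ _
  | trans _ _ h1 h2 => exact h1.trans h2

theorem IsConn.mul (h : IsConn d d) (i : ι) (a b : R) : d i (a * b) = a * d i b + d i a * b := h i a b

theorem IsConn.map_one (h : IsConn d d) (i : ι) : d i 1 = 0 := by
  have := h.mul i 1 1
  simpa using this

variable [Fintype ι]

/-- Leibniz rule for whole sums over sequences. Because `a` is symmetric, a distribution of the
derivatives over the two factors matters only through the number that falls on each, whence the
binomial coefficient; the induction is Pascal's rule. -/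
theorem seqSum_iter_smul (hD : IsConn d D) (a : List ι → R) (ha : IsSymm a) (l : ℕ) (m : N) :
    seqSum l (fun J => iter D J (a J • m)) = ∑ pq ∈ Finset.HasAntidiagonal.antidiagonal l,
      l.choose pq.1 • seqSum pq.1 (fun I => seqSum pq.2 (fun K =>
        iter d K (a (I ++ K)) • iter D I m)) := by
  induction l generalizing a with
  | zero => simp [seqSum_zero]
  | succ l ih =>
    rw [Finset.sum_antidiagonal_choose_succ_nsmul (fun p q => seqSum p (fun I => seqSum q (fun K =>
        iter d K (a (I ++ K)) • iter D I m))), seqSum_succ]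
    simp only [iter_cons, ← map_seqSum]
    simp_rw [ih _ (ha.cons _)]
    simp only [map_sum, map_nsmul, map_seqSum, hD _ _ _, seqSum_add, smul_add,
      Finset.sum_add_distrib]
    rw [add_comm]
    congr 1
    · rw [Finset.sum_comm]
      refine Finset.sum_congr rfl fun pq _ => ?_
      rw [← Finset.smul_sum]
      simp_rw [seqSum_succ pq.2, seqSum_sum]
      congr 1
      refine Finset.sum_congr rfl fun i _ => seqSum_congr fun I _ => seqSum_congr fun K _ => ?_
      rw [iter_cons, ha (i :: (I ++ K)) (I ++ i :: K) List.perm_middle.symm]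
    · rw [Finset.sum_comm]
      refine Finset.sum_congr rfl fun pq hpq => ?_
      rw [← Finset.smul_sum, seqSum_succ pq.1]
      rw [Finset.HasAntidiagonal.mem_antidiagonal] at hpq
      rw [← hpq, Nat.choose_symm_add]
      rfl

/-- The same rule with the coefficients outside the derivatives. The induction splits off the last
index, which is the derivative applied first. -/
theorem seqSum_smul_iter (hD : IsConn d D) (h : List ι → R) (hh : IsSymm h) (l : ℕ) (a : R) (m : N) :
    seqSum l (fun J => h J • iter D J (a • m)) = ∑ pq ∈ Finset.HasAntidiagonal.antidiagonal l,
      l.choose pq.1 • seqSum pq.1 (fun I => seqSum pq.2 (fun K =>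
        h (I ++ K) • iter d K a • iter D I m)) := by
  induction l generalizing a m h with
  | zero => simp [seqSum_zero]
  | succ l ih =>
    rw [Finset.sum_antidiagonal_choose_succ_nsmul (fun p q => seqSum p (fun I => seqSum q (fun K =>
        h (I ++ K) • iter d K a • iter D I m))), seqSum_succ_last]
    simp only [iter_append, iter_cons, iter_nil, hD _ _ _, smul_add, iter_add, seqSum_add]
    simp_rw [ih _ (hh.concat _)]
    rw [Finset.sum_add_distrib, add_comm]
    congr 1
    · rw [Finset.sum_comm]
      refine Finset.sum_congr rfl fun pq _ => ?_
      rw [← Finset.smul_sum]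
      simp_rw [seqSum_succ_last pq.2, seqSum_sum]
      simp only [iter_append, iter_cons, iter_nil, List.append_assoc]
    · rw [Finset.sum_comm]
      refine Finset.sum_congr rfl fun pq hpq => ?_
      rw [← Finset.smul_sum, seqSum_succ_last pq.1]
      rw [Finset.HasAntidiagonal.mem_antidiagonal] at hpq
      rw [← hpq, Nat.choose_symm_add]
      congr 1
      refine Finset.sum_congr rfl fun i _ => seqSum_congr fun I _ => seqSum_congr fun K _ => ?_
      simp only [iter_append, iter_cons, iter_nil]
      rw [hh (I ++ K ++ [i]) (I ++ [i] ++ K)]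
      rw [List.append_assoc, List.append_assoc]
      exact List.Perm.append_left _ List.perm_append_comm

/-- The coefficients of the formal adjoint of `∑_{|J| ≤ s} a_J d_J`. -/
def eulerCoeff (s : ℕ) (d : ι → R →+ R) (a : List ι → R) (I : List ι) : R :=
  ∑ l ∈ Finset.range (s + 1), seqSum l (fun K => if I.length + l ≤ s then
    (-1) ^ l * ((I.length + l).choose I.length : R) * iter d K (a (I ++ K)) else 0)

/-- Expand by the Leibniz rule and collect the terms with `d_I v`. The sign of `J = IK` splits as
`(-1)^{|I|} (-1)^{|K|}`; the second factor belongs to `eulerCoeff`, the first remains visible. -/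
theorem sum_adjoint_eq (hd : IsConn d d) (s : ℕ) (a : List ι → R) (ha : IsSymm a) (v : R) :
    ∑ l ∈ Finset.range (s + 1), (-1) ^ l * seqSum l (fun J => iter d J (a J * v)) =
    ∑ l ∈ Finset.range (s + 1), seqSum l (fun I => (-1) ^ l * eulerCoeff s d a I * iter d I v) := by
  have h1 : ∀ l, seqSum l (fun J => iter d J (a J * v)) = _ :=
    fun l => seqSum_iter_smul hd a ha l v
  simp_rw [h1]
  have h2 : ∀ l, seqSum l (fun I => (-1 : R) ^ l * eulerCoeff s d a I * iter d I v) =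
      ∑ q ∈ Finset.range (s + 1), if l + q ≤ s then (-1) ^ (l + q) * ((l + q).choose l •
        seqSum l (fun I => seqSum q (fun K => iter d K (a (I ++ K)) * iter d I v))) else 0 := by
    intro l
    simp only [eulerCoeff, Finset.mul_sum, Finset.sum_mul, seqSum_sum]
    refine Finset.sum_congr rfl fun q _ => ?_
    split_ifs with hq
    · rw [← seqSum_nsmul, ← smul_eq_mul, smul_seqSum]
      refine seqSum_congr fun I hI => ?_
      rw [hI]
      simp only [if_pos hq, seqSum, Finset.mul_sum, Finset.sum_mul, nsmul_eq_mul, smul_eq_mul]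
      refine Finset.sum_congr rfl fun K _ => ?_
      ring
    · rw [← seqSum_zero_fun (ι := ι) l]
      refine seqSum_congr fun I hI => ?_
      simp [hI, hq, seqSum_zero_fun]
  simp_rw [h2]
  rw [← sum_range_antidiagonal s (fun l q => (-1 : R) ^ (l + q) * ((l + q).choose l •
    seqSum l (fun I => seqSum q (fun K => iter d K (a (I ++ K)) * iter d I v))))]
  refine Finset.sum_congr rfl fun l _ => ?_
  rw [Finset.mul_sum]
  refine Finset.sum_congr rfl fun pq hpq => ?_
  rw [Finset.HasAntidiagonal.mem_antidiagonal] at hpq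
  rw [hpq]
  rfl

omit [Fintype ι] in
-- Integration by parts: `Λ` vanishes on derivatives, so each `D_i` passes to the coefficient with a
-- sign. The derivatives arrive there in reversed order, which is why they have to commute.
theorem adjoint_iter {B : Type*} [AddCommGroup B] (hD : IsConn d D) (hc : Commuting d)
    (Λ : N →+ B) (hΛ : ∀ i m, Λ (D i m) = 0) (J : List ι) (a : R) (m : N) :
    Λ (a • iter D J m) = Λ (((-1) ^ J.length * iter d J a) • m) := by
  induction J generalizing a with
  | nil => simp
  | cons i J ih =>
    have h1 := hΛ i (a • iter D J m)
    rw [hD, map_add, ih (d i a)] at h1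
    rw [iter_cons, eq_neg_of_add_eq_zero_left h1, ← map_neg, ← neg_smul,
      hc.iter_perm a (List.perm_append_singleton i J).symm, iter_append]
    simp [pow_succ]

/-- The formal adjoint of the operator `∑_{|J| ≤ s} a_J D_J`. -/
theorem adjoint_sum {B : Type*} [AddCommGroup B] (hd : IsConn d d) (hD : IsConn d D)
    (hc : Commuting d) (Λ : N →+ B) (hΛ : ∀ i m, Λ (D i m) = 0) (s : ℕ) (a : List ι → R)
    (ha : IsSymm a) (v : R) (m : N) :
    Λ (v • ∑ l ∈ Finset.range (s + 1), seqSum l (fun J => a J • iter D J m)) =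
      Λ ((∑ l ∈ Finset.range (s + 1),
        seqSum l (fun I => (-1) ^ l * eulerCoeff s d a I * iter d I v)) • m) := by
  rw [← sum_adjoint_eq hd s a ha v, Finset.smul_sum, map_sum, Finset.sum_smul, map_sum]
  refine Finset.sum_congr rfl fun l _ => ?_
  rw [smul_seqSum, map_seqSum, ← smul_eq_mul, smul_seqSum, seqSum_smul, map_seqSum]
  refine seqSum_congr fun J hJ => ?_
  rw [smul_smul, adjoint_iter hD hc Λ hΛ, hJ, mul_comm v, smul_eq_mul]

omit [Fintype ι] in
theorem IsConn.map_prod (h : IsConn d d) {κ : Type*} [DecidableEq κ] (i : ι) (s : Finset κ)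
    (g : κ → R) :
    d i (∏ a ∈ s, g a) = ∑ k ∈ s, ∏ a ∈ s, Function.update g k (d i (g k)) a := by
  induction s using Finset.induction_on with
  | empty => simp [h.map_one]
  | insert b s hb ih =>
    rw [Finset.prod_insert hb, h.mul, ih, Finset.sum_insert hb, Finset.prod_insert hb,
      Function.update_self, add_comm]
    congr 1
    · congr 1
      refine Finset.prod_congr rfl fun a ha => ?_
      rw [Function.update_of_ne (ne_of_mem_of_not_mem ha hb)]
    · rw [Finset.mul_sum]
      refine Finset.sum_congr rfl fun k hk => ?_
      rw [Finset.prod_insert hb, Function.update_of_ne (ne_of_mem_of_not_mem hk hb).symm]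

theorem ofFn_extendMiddle_of_ne {α : Type*} {l : ℕ} (c : OrderedFinpartition l) (k a : Fin c.length)
    (h : a ≠ k) (I : Fin (l + 1) → α) :
    List.ofFn (I ∘ (c.extendMiddle k).emb a) = List.ofFn ((I ∘ Fin.succ) ∘ c.emb a) := by
  have hs : (c.extendMiddle k).partSize a = c.partSize a := Function.update_of_ne h _ _
  have he : (c.extendMiddle k).emb a = Fin.succ ∘ c.emb a ∘ Fin.cast hs := dif_neg h
  rw [List.ofFn_congr hs, he]
  rfl

theorem ofFn_extendMiddle_self {α : Type*} {l : ℕ} (c : OrderedFinpartition l) (k : Fin c.length)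
    (I : Fin (l + 1) → α) :
    List.ofFn (I ∘ (c.extendMiddle k).emb k) = I 0 :: List.ofFn ((I ∘ Fin.succ) ∘ c.emb k) := by
  have hs : (c.extendMiddle k).partSize k = c.partSize k + 1 := Function.update_self _ _ _
  have he : (c.extendMiddle k).emb k =
      Fin.cases (motive := fun _ => Fin (l + 1)) 0 (Fin.succ ∘ c.emb k) ∘ Fin.cast hs := dif_pos rfl
  rw [List.ofFn_congr hs, List.ofFn_succ, he]
  rfl

/-- The formula of Faà di Bruno, the sum being over the partitions of the set of indices. -/
theorem iter_eq_sum_partitions {d e : ι → R →+ R} (hd : IsConn d d) (X : ι → R)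
    (h : ∀ i f, d i f = ∑ j, d i (X j) * e j f) {l : ℕ} (I : Fin l → ι) (f : R) :
    iter d (List.ofFn I) f = ∑ c : OrderedFinpartition l, ∑ j : Fin c.length → ι,
      (∏ a, iter d (List.ofFn (I ∘ c.emb a)) (X (j a))) * iter e (List.ofFn j) f := by
  induction l with
  | zero =>
    have h0 : ∀ c : OrderedFinpartition 0, c = OrderedFinpartition.atomic 0 :=
      fun c => Subsingleton.elim _ _
    rw [Fintype.sum_eq_single (OrderedFinpartition.atomic 0) (fun c hc => absurd (h0 c) hc)]
    change _ = ∑ j : Fin 0 → ι, (∏ a : Fin 0, iter d (List.ofFn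
      (I ∘ (OrderedFinpartition.atomic 0).emb a)) (X (j a))) * iter e (List.ofFn j) f
    simp
  | succ l ih =>
    rw [List.ofFn_succ, iter_cons, ih (fun a => I a.succ)]
    -- A partition of `l + 1` indices comes from one of the last `l` indices: either the new index
    -- forms a block of its own (the derivative falls on `e_j f`), or it joins the block `k` (the
    -- derivative falls on the `k`-th factor of the product).
    rw [← (OrderedFinpartition.extendEquiv l).sum_comp, Fintype.sum_sigma, map_sum]
    refine Finset.sum_congr rfl fun c _ => ?_
    rw [Fintype.sum_option, map_sum]
    simp_rw [hd.mul]
    rw [Finset.sum_add_distrib]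
    congr 1
    · change _ = ∑ j : Fin (c.length + 1) → ι, (∏ a : Fin (c.length + 1), iter d (List.ofFn
        (I ∘ c.extendLeft.emb a)) (X (j a))) * iter e (List.ofFn j) f
      rw [← (Fin.consEquiv (fun _ : Fin (c.length + 1) => ι)).sum_comp, Fintype.sum_prod_type,
        Finset.sum_comm]
      refine Finset.sum_congr rfl fun j _ => ?_
      rw [h (I 0), Finset.mul_sum]
      refine Finset.sum_congr rfl fun k _ => ?_
      rw [Fin.prod_univ_succ, List.ofFn_succ, iter_cons]
      simp only [Fin.consEquiv, Equiv.coe_fn_mk, Fin.cons_zero, Fin.cons_succ]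
      have h0 : List.ofFn (I ∘ c.extendLeft.emb (0 : Fin (c.length + 1))) = [I 0] := rfl
      rw [h0, iter_cons, iter_nil]
      have h1 : ∀ a : Fin c.length, List.ofFn (I ∘ c.extendLeft.emb a.succ) =
        List.ofFn ((fun a => I a.succ) ∘ c.emb a) := fun a => rfl
      simp only [h1]
      ring
    · change _ = ∑ k : Fin c.length, ∑ j : Fin c.length → ι, (∏ a : Fin c.length,
        iter d (List.ofFn (I ∘ (c.extendMiddle k).emb a)) (X (j a))) * iter e (List.ofFn j) f
      rw [Finset.sum_comm (s := Finset.univ (α := Fin c.length))]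
      refine Finset.sum_congr rfl fun j _ => ?_
      rw [hd.map_prod, Finset.sum_mul]
      refine Finset.sum_congr rfl fun k _ => ?_
      congr 1
      refine Finset.prod_congr rfl fun a _ => ?_
      by_cases hak : a = k
      · subst hak
        rw [Function.update_self, ofFn_extendMiddle_self, iter_cons]
        rfl
      · rw [Function.update_of_ne hak, ofFn_extendMiddle_of_ne c k a hak]
        rfl

end Derivations

/-! ## Change of the derivations by a matrix -/

section Twist

variable {ι : Type*} [Fintype ι] {R N : Type*} [CommRing R] [AddCommGroup N] [Module R N]

/-- The operators `∑_j z^j_i D_j`. -/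
def twist (z : ι → ι → R) (D : ι → N →+ N) (i : ι) : N →+ N where
  toFun m := ∑ j, z j i • D j m
  map_zero' := by simp
  map_add' m m' := by simp [Finset.sum_add_distrib]

theorem twist_apply (z : ι → ι → R) (D : ι → N →+ N) (i : ι) (m : N) :
    twist z D i m = ∑ j, z j i • D j m := rfl

variable {d : ι → R →+ R} {D : ι → N →+ N} {z : ι → ι → R}

theorem IsConn.twist (hD : IsConn d D) : IsConn (twist z d) (twist z D) := by
  intro i a m
  simp only [twist_apply, hD _ _ _, smul_add, Finset.sum_add_distrib, Finset.smul_sum,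
    Finset.sum_smul, smul_smul, smul_eq_mul, mul_comm]

variable [DecidableEq ι]

/-- `z` is the inverse of the matrix `(d_j X^i)`. -/
structure IsInverseJacobian (d : ι → R →+ R) (z : ι → ι → R) (X : ι → R) : Prop where
  left : ∀ i k, ∑ j, z j i * d j (X k) = if i = k then 1 else 0
  right : ∀ l j, ∑ k, z l k * d j (X k) = if l = j then 1 else 0

variable {X : ι → R}

theorem IsInverseJacobian.eq_sum_twist (h : IsInverseJacobian d z X) (j : ι) (m : N) :
    D j m = ∑ k, d j (X k) • Velocity.twist z D k m := by
  simp only [twist_apply, Finset.smul_sum, smul_smul]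
  rw [Finset.sum_comm]
  simp_rw [← Finset.sum_smul, mul_comm, h.right]
  simp

/-- Differentiate `z^l_k d_l X^p = δ` along `z^j_i d_j`. The derivative of `z`, contracted with the
matrix `d_l X^p`, becomes `-z^l_k z^j_i d_j d_l X^p`, which is symmetric in `i, k`; the matrix is
then cancelled. -/
theorem IsInverseJacobian.twist_comm (h : IsInverseJacobian d z X) (hd : IsConn d d)
    (hc : Commuting d) (i k q : ι) :
    Velocity.twist z d i (z q k) = Velocity.twist z d k (z q i) := by
  have key : ∀ p, ∑ l, (Velocity.twist z d i (z l k) - Velocity.twist z d k (z l i)) * d l (X p)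
      = 0 := by
    intro p
    have e1 : ∀ i k, Velocity.twist z d i (∑ l, z l k * d l (X p)) = 0 := by
      intro i k
      rw [h.left]
      split_ifs
      · exact (hd.twist (z := z)).map_one i
      · exact map_zero _
    have e2 : ∀ i k, ∑ l, Velocity.twist z d i (z l k) * d l (X p) =
        -∑ l, ∑ j, z l k * z j i * d j (d l (X p)) := by
      intro i k
      have := e1 i k
      simp only [map_sum, (hd.twist (z := z)).mul, Finset.sum_add_distrib] at this
      rw [eq_neg_of_add_eq_zero_right this]
      simp only [twist_apply, smul_eq_mul, Finset.mul_sum, mul_assoc]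
    simp only [sub_mul, Finset.sum_sub_distrib, e2]
    rw [sub_eq_zero, neg_inj, Finset.sum_comm]
    refine Finset.sum_congr rfl fun j _ => Finset.sum_congr rfl fun l _ => ?_
    rw [hc j l, mul_comm (z l k)]
  have : ∑ p, z q p * ∑ l, (Velocity.twist z d i (z l k) - Velocity.twist z d k (z l i)) *
      d l (X p) = 0 := by simp [key]
  simp only [Finset.mul_sum] at this
  rw [Finset.sum_comm] at this
  have e3 : ∀ l, ∑ p, z q p * ((Velocity.twist z d i (z l k) - Velocity.twist z d k (z l i)) *
      d l (X p)) = (Velocity.twist z d i (z l k) - Velocity.twist z d k (z l i)) *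
        if q = l then 1 else 0 := by
    intro l
    rw [← h.right, Finset.mul_sum]
    exact Finset.sum_congr rfl fun p _ => by ring
  simp only [e3] at this
  simpa [sub_eq_zero] using this

/-- The second-order part of the composition is symmetric since the `D_i` commute, the first-order
part by `twist_comm`. -/
theorem IsInverseJacobian.commuting (h : IsInverseJacobian d z X) (hd : IsConn d d)
    (hc : Commuting d) (hD : IsConn d D) (hDc : Commuting D) :
    Commuting (Velocity.twist z D) := by
  intro i k m
  have e : ∀ i k, Velocity.twist z D i (Velocity.twist z D k m) =
      ∑ l, ∑ j, (z l k * z j i) • D j (D l m) + ∑ l, Velocity.twist z d i (z l k) • D l m := by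
    intro i k
    rw [twist_apply z D k, map_sum]
    simp_rw [(hD.twist (z := z)) _ _ _]
    rw [Finset.sum_add_distrib]
    simp only [twist_apply, Finset.smul_sum, smul_smul]
  rw [e, e]
  simp_rw [h.twist_comm hd hc i k]
  congr 1
  rw [Finset.sum_comm]
  refine Finset.sum_congr rfl fun j _ => Finset.sum_congr rfl fun l _ => ?_
  rw [hDc, mul_comm]

/-- The identity of Piola. -/
theorem IsInverseJacobian.piola (h : IsInverseJacobian d z X) (hd : IsConn d d)
    (hc : Commuting d) (J : R)
    (hJ : ∀ j, d j J = J * ∑ i, ∑ k, z k i * d j (d k (X i))) (i : ι) :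
    ∑ j, d j (J * z j i) = 0 := by
  -- The derivative of `J` along `z^j_i d_j` is given by Jacobi's formula `hJ`. The divergence of
  -- `z` is computed in `e2` from the symmetry `twist_comm` and the derivative of `z · dX = 1`;
  -- multiplied by `J`, it is the opposite quantity.
  have e1 : ∑ j, z j i * d j J = J * ∑ k, ∑ l, z l k * Velocity.twist z d i (d l (X k)) := by
    simp only [hJ, twist_apply, smul_eq_mul, Finset.mul_sum]
    rw [Finset.sum_comm]
    refine Finset.sum_congr rfl fun k _ => ?_
    rw [Finset.sum_comm]
    exact Finset.sum_congr rfl fun l _ => Finset.sum_congr rfl fun j _ => by ring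
  have e2 : ∑ j, d j (z j i) = -∑ k, ∑ l, z l k * Velocity.twist z d i (d l (X k)) := by
    have e3 : ∑ j, d j (z j i) = ∑ k, ∑ j, Velocity.twist z d i (z j k) * d j (X k) := by
      rw [Finset.sum_comm]
      refine Finset.sum_congr rfl fun j _ => ?_
      rw [h.eq_sum_twist (D := d)]
      refine Finset.sum_congr rfl fun k _ => ?_
      rw [h.twist_comm hd hc, smul_eq_mul, mul_comm]
    have e4 : ∀ k, Velocity.twist z d i (∑ l, z l k * d l (X k)) = 0 := by
      intro k
      rw [h.left, if_pos rfl]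
      exact (hd.twist (z := z)).map_one i
    rw [e3, ← Finset.sum_neg_distrib]
    refine Finset.sum_congr rfl fun k _ => ?_
    have := e4 k
    simp only [map_sum, (hd.twist (z := z)).mul, Finset.sum_add_distrib] at this
    exact eq_neg_of_add_eq_zero_right this
  simp only [hd.mul, Finset.sum_add_distrib]
  rw [← Finset.mul_sum, e2]
  simp only [mul_comm (d _ J)]
  rw [e1]
  ring

end Twist

/-! ## Differential operators and their formal adjoints -/

section Operators

variable {ι κ : Type*} [Fintype ι] [Fintype κ] {R N : Type*} [CommRing R] [AddCommGroup N]
  [Module R N]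

/-- `∑_B ∑_{|I| ≤ s} a^I_B D_I w^B`. -/
def opSum (s : ℕ) (D : ι → N →+ N) (a : κ → List ι → R) (w : κ → N) : N :=
  ∑ B, ∑ l ∈ Finset.range (s + 1), seqSum l (fun I => a B I • iter D I (w B))

/-- The coefficients of the difference of an operator and its formal adjoint. -/
def helmholtzCoeff (s : ℕ) (d : ι → R →+ R) (b : κ → κ → List ι → R) (A B : κ) (I : List ι) : R :=
  b A B I - (-1) ^ I.length * eulerCoeff s d (b B A) I

variable {d : ι → R →+ R} {D : ι → N →+ N}

/-- Moving all derivatives from `w` to `v` in the second pairing turns the operator into its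
adjoint, so the two pairings differ by the operator with the Helmholtz coefficients. The lemma
serves both equations: with `d` and `Λ`, and with the twisted derivations and `Λ(J ·)`. -/
theorem opSum_adjoint {B : Type*} [AddCommGroup B] (hd : IsConn d d) (hD : IsConn d D)
    (hc : Commuting d) (Λ : N →+ B) (hΛ : ∀ i m, Λ (D i m) = 0) (s : ℕ) (b : κ → κ → List ι → R)
    (hb : ∀ A B, IsSymm (b A B)) (v : κ → R) (w : κ → N) :
    Λ (∑ A, opSum s d (b A) v • w A) - Λ (∑ A, v A • opSum s D (b A) w) =
      Λ (∑ A, opSum s d (helmholtzCoeff s d b A) v • w A) := by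
  have h1 : Λ (∑ A, v A • opSum s D (b A) w) = Λ (∑ A, (∑ B, ∑ l ∈ Finset.range (s + 1),
      seqSum l (fun I => (-1) ^ l * eulerCoeff s d (b B A) I * iter d I (v B))) • w A) := by
    simp only [opSum, Finset.smul_sum, map_sum, Finset.sum_smul]
    rw [Finset.sum_comm]
    refine Finset.sum_congr rfl fun A _ => Finset.sum_congr rfl fun B _ => ?_
    have := adjoint_sum hd hD hc Λ hΛ s (b B A) (hb B A) (v B) (w A)
    simpa only [Finset.smul_sum, map_sum, Finset.sum_smul] using this
  rw [h1, ← map_sub, ← Finset.sum_sub_distrib]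
  congr 1
  refine Finset.sum_congr rfl fun A _ => ?_
  rw [← sub_smul]
  congr 1
  simp only [opSum]
  rw [← Finset.sum_sub_distrib]
  refine Finset.sum_congr rfl fun B _ => ?_
  rw [← Finset.sum_sub_distrib]
  refine Finset.sum_congr rfl fun l _ => ?_
  rw [sub_eq_iff_eq_add, ← seqSum_add]
  refine seqSum_congr fun I hI => ?_
  simp only [helmholtzCoeff, hI, smul_eq_mul]
  ring

end Operators

/-! ## The variation of a homogeneous equation -/

section Variation

variable {ι μ : Type*} [Fintype ι] [Fintype μ] {R N : Type*} [CommRing R] [AddCommGroup N]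
  [Module R N]

/-- The characteristic `Q^σ = w^σ - y^σ_i w^i` of `w`. -/
def charac (y : μ → ι → R) (w : ι ⊕ μ → N) (σ : μ) : N :=
  w (Sum.inr σ) - ∑ i, y σ i • w (Sum.inl i)

/-- The linearizations `L_A` of a homogeneous equation and `ℓ_σ` of the associated non-homogeneous
equation, in the direction of `w` and of its characteristic. -/
structure IsVariation (d : ι → R →+ R) (D : ι → N →+ N) (z : ι → ι → R) (y : μ → ι → R) (J : R)
    (T : μ → R) (w : ι ⊕ μ → N) (L : ι ⊕ μ → N) (ℓ : μ → N) : Prop where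
  fibre : ∀ σ, L (Sum.inr σ) =
    ∑ j, D j (∑ i, (J * T σ * z j i) • w (Sum.inl i)) + J • ℓ σ
  base : ∀ i, L (Sum.inl i) = -∑ σ, (y σ i • L (Sum.inr σ) +
    (J * T σ) • (twist z D i (charac y w σ) + ∑ k, twist z d i (y σ k) • w (Sum.inl k)))

variable {d : ι → R →+ R} {D : ι → N →+ N} {z : ι → ι → R} {y : μ → ι → R} {J : R} {T : μ → R}

/-- Since `L_i` contains `-y^σ_i L_σ`, the pairing contains `L_σ` only multiplied by the
characteristic of `v`. The remaining terms of `L_i` involve derivatives of the characteristic of `w`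
and derivatives of `y^σ_k`. The next lemma is the mirror image, with the operator acting on `v`. -/
theorem sum_smul_variation {w : ι ⊕ μ → N} {L : ι ⊕ μ → N} {ℓ : μ → N}
    (h : IsVariation d D z y J T w L ℓ) (v : ι ⊕ μ → R) :
    ∑ A, v A • L A = ∑ σ, (charac y v σ • (∑ j, D j (∑ i, (J * T σ * z j i) • w (Sum.inl i)) +
      J • ℓ σ) - ∑ j, (∑ i, J * T σ * z j i * v (Sum.inl i)) • D j (charac y w σ) -
        ∑ i, ∑ k, (J * T σ * twist z d i (y σ k) * v (Sum.inl i)) • w (Sum.inl k)) := by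
  rw [Fintype.sum_sum_type]
  simp only [h.base, smul_neg, Finset.smul_sum, Finset.sum_neg_distrib]
  rw [Finset.sum_comm, neg_add_eq_sub, ← Finset.sum_sub_distrib]
  refine Finset.sum_congr rfl fun σ _ => ?_
  rw [← h.fibre]
  have e1 : charac y v σ • L (Sum.inr σ) = v (Sum.inr σ) • L (Sum.inr σ) -
      ∑ i, v (Sum.inl i) • y σ i • L (Sum.inr σ) := by
    simp only [charac, sub_smul, Finset.sum_smul, smul_smul, smul_eq_mul, mul_comm]
  have e2 : ∑ j, (∑ i, J * T σ * z j i * v (Sum.inl i)) • D j (charac y w σ) =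
      ∑ i, v (Sum.inl i) • (J * T σ) • twist z D i (charac y w σ) := by
    simp only [Finset.sum_smul, twist_apply, Finset.smul_sum, smul_smul]
    rw [Finset.sum_comm]
    refine Finset.sum_congr rfl fun i _ => Finset.sum_congr rfl fun j _ => ?_
    congr 1
    ring
  have e3 : ∑ i, ∑ k, (J * T σ * twist z d i (y σ k) * v (Sum.inl i)) • w (Sum.inl k) =
      ∑ i, v (Sum.inl i) • (J * T σ) • ∑ k, twist z d i (y σ k) • w (Sum.inl k) := by
    simp only [Finset.smul_sum, smul_smul]
    refine Finset.sum_congr rfl fun i _ => Finset.sum_congr rfl fun j _ => ?_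
    congr 1
    ring
  rw [e1, e2, e3]
  simp only [smul_add, Finset.sum_add_distrib]
  abel

theorem sum_variation_smul {v : ι ⊕ μ → R} {L : ι ⊕ μ → R} {ℓ : μ → R}
    (h : IsVariation d d z y J T v L ℓ) (w : ι ⊕ μ → N) :
    ∑ A, L A • w A = ∑ σ, ((∑ j, d j (∑ i, J * T σ * z j i * v (Sum.inl i)) + J * ℓ σ) •
      charac y w σ - ∑ j, d j (charac y v σ) • ∑ i, (J * T σ * z j i) • w (Sum.inl i) -
        ∑ i, ∑ k, (J * T σ * twist z d i (y σ k) * v (Sum.inl k)) • w (Sum.inl i)) := by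
  rw [Fintype.sum_sum_type]
  simp only [h.base, neg_smul, Finset.sum_smul, Finset.sum_neg_distrib]
  rw [Finset.sum_comm, neg_add_eq_sub, ← Finset.sum_sub_distrib]
  refine Finset.sum_congr rfl fun σ _ => ?_
  have h0 := h.fibre σ
  simp only [smul_eq_mul] at h0
  rw [← h0]
  have e1 : L (Sum.inr σ) • charac y w σ = L (Sum.inr σ) • w (Sum.inr σ) -
      ∑ i, (y σ i * L (Sum.inr σ)) • w (Sum.inl i) := by
    simp only [charac, smul_sub, Finset.smul_sum, smul_smul, mul_comm]
  have e2 : ∑ j, d j (charac y v σ) • ∑ i, (J * T σ * z j i) • w (Sum.inl i) =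
      ∑ i, (J * T σ * twist z d i (charac y v σ)) • w (Sum.inl i) := by
    simp only [Finset.sum_smul, twist_apply, Finset.smul_sum, smul_smul, Finset.mul_sum,
      smul_eq_mul]
    rw [Finset.sum_comm]
    refine Finset.sum_congr rfl fun i _ => Finset.sum_congr rfl fun j _ => ?_
    congr 1
    ring
  have e3 : ∑ i, ∑ k, (J * T σ * twist z d i (y σ k) * v (Sum.inl k)) • w (Sum.inl i) =
      ∑ i, (J * T σ * ∑ k, twist z d i (y σ k) * v (Sum.inl k)) • w (Sum.inl i) := by
    simp only [Finset.mul_sum, Finset.sum_smul, mul_assoc]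
  rw [e1, e2, e3, sub_sub, sub_sub, ← Finset.sum_add_distrib, ← Finset.sum_add_distrib]
  congr 1
  refine Finset.sum_congr rfl fun i _ => ?_
  rw [← add_smul, ← add_smul]
  congr 1
  simp only [smul_eq_mul]
  ring

/-- In the difference of the two pairings the terms with `z^j_i d_j y^σ_k` cancel by their symmetry
in `i, k`. The other terms without `ℓ` combine to the total derivatives of `ξ^j q` and `p M^j`,
which `Λ` annihilates. -/
theorem variation_skew {B : Type*} [AddCommGroup B] (hD : IsConn d D) (Λ : N →+ B)
    (hΛ : ∀ i m, Λ (D i m) = 0) (hy : ∀ σ i k, twist z d i (y σ k) = twist z d k (y σ i))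
    {v : ι ⊕ μ → R} {Lv : ι ⊕ μ → R} {ℓv : μ → R} (hv : IsVariation d d z y J T v Lv ℓv)
    {w : ι ⊕ μ → N} {Lw : ι ⊕ μ → N} {ℓw : μ → N} (hw : IsVariation d D z y J T w Lw ℓw) :
    Λ (∑ A, Lv A • w A) - Λ (∑ A, v A • Lw A) =
      Λ (J • ∑ σ, ℓv σ • charac y w σ) - Λ (J • ∑ σ, charac y v σ • ℓw σ) := by
  rw [sum_variation_smul hv, sum_smul_variation hw, Finset.smul_sum, Finset.smul_sum, ← map_sub,
    ← map_sub, ← Finset.sum_sub_distrib, ← Finset.sum_sub_distrib, map_sum, map_sum]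
  refine Finset.sum_congr rfl fun σ _ => ?_
  have e1 : ∑ i, ∑ k, (J * T σ * twist z d i (y σ k) * v (Sum.inl k)) • w (Sum.inl i) =
      ∑ i, ∑ k, (J * T σ * twist z d i (y σ k) * v (Sum.inl i)) • w (Sum.inl k) := by
    rw [Finset.sum_comm]
    simp_rw [hy σ]
  rw [e1]
  generalize ∑ i, ∑ k, (J * T σ * twist z d i (y σ k) * v (Sum.inl i)) • w (Sum.inl k) = S
  set ξ : ι → R := fun j => ∑ i, J * T σ * z j i * v (Sum.inl i)
  set M : ι → N := fun j => ∑ i, (J * T σ * z j i) • w (Sum.inl i)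
  set p := charac y v σ
  set q := charac y w σ
  have e2 : (∑ j, d j (ξ j) + J * ℓv σ) • q - ∑ j, d j p • M j - S -
      (p • (∑ j, D j (M j) + J • ℓw σ) - ∑ j, ξ j • D j q - S) =
      (J • ℓv σ • q - J • p • ℓw σ) + (∑ j, D j (ξ j • q) - ∑ j, D j (p • M j)) := by
    simp only [hD _ _ _, Finset.sum_add_distrib, add_smul, smul_add, Finset.sum_smul,
      Finset.smul_sum, smul_smul, mul_comm p]
    abel
  rw [e2, map_add, map_sub Λ (∑ j, _), map_sum, map_sum]
  simp [hΛ]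

end Variation

/-! ## Distributions -/

section Distributions

/-- Additive functionals on `R`. -/
def Dist (R : Type*) [CommRing R] : Type _ := R →+ ℝ

variable {R : Type*} [CommRing R]

instance : AddCommGroup (Dist R) := inferInstanceAs (AddCommGroup (R →+ ℝ))

/-- The value of a functional. -/
def Dist.app (f : R) : Dist R →+ ℝ := AddMonoidHom.eval f

theorem Dist.ext {φ ψ : Dist R} (h : ∀ f, Dist.app f φ = Dist.app f ψ) : φ = ψ :=
  AddMonoidHom.ext h

/-- The functional with given values. -/
def Dist.mk (φ : R →+ ℝ) : Dist R := φ

theorem Dist.app_add (φ : Dist R) (f g : R) :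
    Dist.app (f + g) φ = Dist.app f φ + Dist.app g φ := AddMonoidHom.map_add (φ : R →+ ℝ) f g

theorem Dist.app_zero_left (φ : Dist R) : Dist.app 0 φ = 0 := AddMonoidHom.map_zero (φ : R →+ ℝ)

instance : SMul R (Dist R) :=
  ⟨fun a φ => Dist.mk ((φ : R →+ ℝ).comp (AddMonoidHom.mulLeft a))⟩

theorem Dist.app_smul (a f : R) (φ : Dist R) : Dist.app f (a • φ) = Dist.app (a * f) φ := rfl

instance : Module R (Dist R) where
  one_smul φ := Dist.ext fun f => by rw [Dist.app_smul, one_mul]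
  mul_smul a b φ := Dist.ext fun f => by
    simp only [Dist.app_smul]
    rw [mul_comm a b, mul_assoc]
  smul_zero a := Dist.ext fun f => by simp [Dist.app_smul]
  smul_add a φ ψ := Dist.ext fun f => by simp [Dist.app_smul]
  add_smul a b φ := Dist.ext fun f => by
    rw [map_add, Dist.app_smul, Dist.app_smul, Dist.app_smul, add_mul, Dist.app_add]
  zero_smul φ := Dist.ext fun f => by
    rw [Dist.app_smul, zero_mul, Dist.app_zero_left, map_zero]

/-- The derivatives of a functional. -/
def Dist.deriv {ι : Type*} (d : ι → R →+ R) (i : ι) : Dist R →+ Dist R where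
  toFun φ := Dist.mk (-((φ : R →+ ℝ).comp (d i)))
  map_zero' := Dist.ext fun f => by
    change -(Dist.app (d i f) (0 : Dist R)) = Dist.app f (0 : Dist R)
    simp
  map_add' φ ψ := Dist.ext fun f => by
    change -(Dist.app (d i f) (φ + ψ)) = -(Dist.app (d i f) φ) + -(Dist.app (d i f) ψ)
    rw [map_add, neg_add]

variable {ι : Type*} {d : ι → R →+ R}

theorem Dist.app_deriv (i : ι) (f : R) (φ : Dist R) :
    Dist.app f (Dist.deriv d i φ) = -Dist.app (d i f) φ := rfl

theorem Dist.isConn_deriv (hd : IsConn d d) : IsConn d (Dist.deriv d) := by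
  intro i a φ
  apply Dist.ext
  intro f
  simp only [Dist.app_deriv, Dist.app_smul, map_add, hd.mul, Dist.app_add]
  ring

theorem Dist.commuting_deriv (hc : Commuting d) : Commuting (Dist.deriv d) := by
  intro i j φ
  apply Dist.ext
  intro f
  simp only [Dist.app_deriv, hc i j]

end Distributions

/-! ### Comparison of the Helmholtz operators of the two equations -/

theorem piola_functional {ι R N B : Type*} [Fintype ι] [CommRing R] [AddCommGroup N] [Module R N] [AddCommGroup B]
    {d : ι → R →+ R} {D : ι → N →+ N} {z : ι → ι → R} {J : R} (hD : IsConn d D)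
    (hJ : ∀ i, ∑ j, d j (J * z j i) = 0) (Λ : N →+ B) (hΛ : ∀ i m, Λ (D i m) = 0) (i : ι) (m : N) :
    Λ (J • twist z D i m) = 0 := by
  -- By the identity of Piola, `J z^j_i D_j m` is a total divergence.
  have : J • twist z D i m = ∑ j, D j ((J * z j i) • m) - (∑ j, d j (J * z j i)) • m := by
    simp only [hD _ _ _, Finset.sum_add_distrib, Finset.sum_smul, twist_apply, Finset.smul_sum,
      smul_smul]
    abel
  rw [this, hJ]
  simp [hΛ]

section Main

variable {ι μ : Type*} [Fintype ι] [DecidableEq ι] [Fintype μ] [DecidableEq μ]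
  {R : Type} [CommRing R]

/-- The Helmholtz operator of a homogeneous equation is determined by the Helmholtz operator of
the associated non-homogeneous equation. -/
theorem helmholtz_operator {d : ι → R →+ R} {z : ι → ι → R} {X : ι → R} (hd : IsConn d d)
    (hc : Commuting d) (hz : IsInverseJacobian d z X) {J : R}
    (hJ : ∀ i, ∑ j, d j (J * z j i) = 0) {y : μ → ι → R} {T : μ → R}
    (hy : ∀ σ i k, twist z d i (y σ k) = twist z d k (y σ i)) (s : ℕ)
    {b : ι ⊕ μ → ι ⊕ μ → List ι → R} (hb : ∀ A B, IsSymm (b A B))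
    {a : μ → μ → List ι → R} (ha : ∀ σ ν, IsSymm (a σ ν))
    (hvar : ∀ {N : Type} [AddCommGroup N] [Module R N] (D : ι → N →+ N), IsConn d D →
      Commuting D → ∀ w : ι ⊕ μ → N, IsVariation d D z y J T w (fun A => opSum s D (b A) w)
        (fun σ => opSum s (twist z D) (a σ) (charac y w)))
    (ev : R →+* ℝ) (v : ι ⊕ μ → R) :
    (∀ σ, ev (opSum s d (helmholtzCoeff s d b (Sum.inr σ)) v) =
      ev (J * opSum s (twist z d) (helmholtzCoeff s (twist z d) a σ) (charac y v))) ∧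
    (∀ i, ev (opSum s d (helmholtzCoeff s d b (Sum.inl i)) v) =
      -ev (J * ∑ σ, y σ i *
        opSum s (twist z d) (helmholtzCoeff s (twist z d) a σ) (charac y v))) := by
  have hD := Dist.isConn_deriv hd
  have hDc := Dist.commuting_deriv hc
  -- The integral of a functional is its value on `1`; it vanishes on derivatives because `d_i 1 =
  -- 0`.
  let Λ : Dist R →+ ℝ := Dist.app 1
  have hΛ : ∀ i m, Λ (Dist.deriv d i m) = 0 := by
    intro i m
    simp only [Λ]
    rw [Dist.app_deriv, hd.map_one, Dist.app_zero_left, neg_zero]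
  -- With respect to the twisted derivations the invariant integral is `Λ(J ·)`.
  have hΛ' : ∀ i m, (Λ.comp (DistribSMul.toAddMonoidHom (Dist R) J))
      (twist z (Dist.deriv d) i m) = 0 := fun i m => piola_functional hD hJ Λ hΛ i m
  have key : ∀ w : ι ⊕ μ → Dist R,
      Λ (∑ A, opSum s d (helmholtzCoeff s d b A) v • w A) =
      Λ (J • ∑ σ, opSum s (twist z d) (helmholtzCoeff s (twist z d) a σ) (charac y v) •
        charac y w σ) := by
    intro w
    rw [← opSum_adjoint hd hD hc Λ hΛ s b hb v w,
      variation_skew hD Λ hΛ hy (hvar d hd hc v) (hvar _ hD hDc w)]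
    exact opSum_adjoint hd.twist hD.twist (hz.commuting hd hc hd hc) _ hΛ' s a ha (charac y v)
      (charac y w)
  -- The delta functional at the point. In the slot `σ` its characteristic is again `δ` in the slot
  -- `σ`; in the slot `i` the characteristic is `-y^ν_i δ`, which explains the factor in the second
  -- formula.
  let δ : Dist R := Dist.mk ev.toAddMonoidHom
  have hδ : ∀ f : R, Λ (f • δ) = ev f := by
    intro f
    simp only [Λ, δ, Dist.app_smul, mul_one]
    rfl
  constructor
  · intro σ
    have h := key (Pi.single (Sum.inr σ) δ)
    have h1 : ∀ ν, charac y (Pi.single (Sum.inr σ) δ : ι ⊕ μ → Dist R) ν =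
        if ν = σ then δ else 0 := by
      intro ν
      simp [charac, Pi.single_apply]
    simpa [Pi.single_apply, h1, hδ, smul_smul] using h
  · intro i
    have h := key (Pi.single (Sum.inl i) δ)
    have h1 : ∀ ν, charac y (Pi.single (Sum.inl i) δ : ι ⊕ μ → Dist R) ν = -(y ν i • δ) := by
      intro ν
      simp [charac, Pi.single_apply]
    simp only [h1, smul_neg, smul_smul, Finset.sum_neg_distrib, ← Finset.sum_smul, map_neg,
      hδ] at h
    rw [Finset.sum_eq_single (Sum.inl i)] at h
    · rw [Pi.single_eq_same, hδ] at h
      rw [h]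
      simp only [mul_comm]
    · intro A _ hA
      rw [Pi.single_eq_of_ne hA, smul_zero]
    · simp

end Main

open Filter

/-! ## Germs of smooth functions -/

section Germs

variable {n : ℕ}

/-- The partial derivative `∂f/∂t^i`. -/
def pd (i : Fin n) (f : (Fin n → ℝ) → ℝ) (τ : Fin n → ℝ) : ℝ := fderiv ℝ f τ (Pi.single i 1)

theorem pd_congr {f g : (Fin n → ℝ) → ℝ} {τ : Fin n → ℝ} (h : f =ᶠ[𝓝 τ] g) (i : Fin n) :
    pd i f =ᶠ[𝓝 τ] pd i g := by
  filter_upwards [h.fderiv (𝕜 := ℝ)] with x hx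
  rw [pd, hx, pd]

theorem contDiffAt_pd {f : (Fin n → ℝ) → ℝ} {τ : Fin n → ℝ} (h : ContDiffAt ℝ ∞ f τ) (i : Fin n) :
    ContDiffAt ℝ ∞ (pd i f) τ :=
  (h.fderiv_right (m := ∞) (by norm_num)).clm_apply contDiffAt_const

theorem ContDiffAt.eventually_differentiableAt {V W : Type*} [NormedAddCommGroup V]
    [NormedSpace ℝ V] [NormedAddCommGroup W] [NormedSpace ℝ W] {f : V → W} {x : V}
    (h : ContDiffAt ℝ ∞ f x) : ∀ᶠ y in 𝓝 x, DifferentiableAt ℝ f y := by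
  have h1 : ContDiffAt ℝ 1 f x := h.of_le (by exact_mod_cast le_top)
  filter_upwards [h1.eventually (by simp)] with y hy
  exact hy.differentiableAt (by simp)

theorem two_le_infty : (2 : WithTop ℕ∞) ≤ ∞ := WithTop.coe_le_coe.2 (le_top : (2 : ℕ∞) ≤ ⊤)

theorem pd_comm {f : (Fin n → ℝ) → ℝ} {τ : Fin n → ℝ} (h : ContDiffAt ℝ 2 f τ) (i j : Fin n) :
    pd i (pd j f) τ = pd j (pd i f) τ := by
  have hs : IsSymmSndFDerivAt ℝ f τ := h.isSymmSndFDerivAt (by simp)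
  have hd : DifferentiableAt ℝ (fderiv ℝ f) τ :=
    (h.fderiv_right (m := 1) (by norm_num)).differentiableAt (by simp)
  have e : ∀ i j : Fin n, pd i (pd j f) τ =
      fderiv ℝ (fderiv ℝ f) τ (Pi.single i 1) (Pi.single j 1) := by
    intro i j
    have : fderiv ℝ (fun x => fderiv ℝ f x (Pi.single j 1)) τ = _ :=
      fderiv_clm_apply hd (differentiableAt_const _)
    unfold pd
    rw [this]
    simp
  rw [e, e]
  exact hs _ _

variable (n)

/-- The ring of germs at `0` of smooth functions. -/
def SmoothGerm : Subring (Germ (𝓝 (0 : Fin n → ℝ)) ℝ) where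
  carrier := {g | ∃ f : (Fin n → ℝ) → ℝ, ContDiffAt ℝ ∞ f 0 ∧ Germ.ofFun f = g}
  mul_mem' := by
    rintro _ _ ⟨f, hf, rfl⟩ ⟨g, hg, rfl⟩
    exact ⟨f * g, hf.mul hg, rfl⟩
  one_mem' := ⟨1, contDiffAt_const, rfl⟩
  add_mem' := by
    rintro _ _ ⟨f, hf, rfl⟩ ⟨g, hg, rfl⟩
    exact ⟨f + g, hf.add hg, rfl⟩
  zero_mem' := ⟨0, contDiffAt_const, rfl⟩
  neg_mem' := by
    rintro _ ⟨f, hf, rfl⟩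
    exact ⟨-f, hf.neg, rfl⟩

variable {n}

open Classical in
/-- The germ of a function (and `0` if the function is not smooth at `0`). -/
def germ (f : (Fin n → ℝ) → ℝ) : SmoothGerm n :=
  if h : ContDiffAt ℝ ∞ f 0 then ⟨f, f, h, rfl⟩ else 0

theorem coe_germ {f : (Fin n → ℝ) → ℝ} (h : ContDiffAt ℝ ∞ f 0) :
    (germ f : Germ (𝓝 (0 : Fin n → ℝ)) ℝ) = f := by rw [germ, dif_pos h]

theorem germ_congr {f g : (Fin n → ℝ) → ℝ} (h : f =ᶠ[𝓝 0] g) : germ f = germ g := by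
  by_cases hf : ContDiffAt ℝ ∞ f 0
  · apply Subtype.ext
    rw [coe_germ hf, coe_germ (hf.congr_of_eventuallyEq h.symm)]
    exact Germ.coe_eq.2 h
  · rw [germ, germ, dif_neg hf, dif_neg fun hg => hf (hg.congr_of_eventuallyEq h)]

theorem exists_germ_eq (a : SmoothGerm n) : ∃ f, ContDiffAt ℝ ∞ f 0 ∧ germ f = a := by
  obtain ⟨_, f, hf, rfl⟩ := a
  exact ⟨f, hf, Subtype.ext (coe_germ hf)⟩

theorem germ_eq_germ {f g : (Fin n → ℝ) → ℝ} (hf : ContDiffAt ℝ ∞ f 0) (hg : ContDiffAt ℝ ∞ g 0)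
    (h : germ f = germ g) : f =ᶠ[𝓝 0] g := by
  have := congrArg Subtype.val h
  rw [coe_germ hf, coe_germ hg] at this
  exact Germ.coe_eq.1 this

theorem germ_add {f g : (Fin n → ℝ) → ℝ} (hf : ContDiffAt ℝ ∞ f 0) (hg : ContDiffAt ℝ ∞ g 0) :
    germ (fun τ => f τ + g τ) = germ f + germ g := by
  apply Subtype.ext
  rw [Subring.coe_add, coe_germ hf, coe_germ hg, coe_germ (hf.add hg)]
  rfl

theorem germ_mul {f g : (Fin n → ℝ) → ℝ} (hf : ContDiffAt ℝ ∞ f 0) (hg : ContDiffAt ℝ ∞ g 0) :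
    germ (fun τ => f τ * g τ) = germ f * germ g := by
  apply Subtype.ext
  rw [Subring.coe_mul, coe_germ hf, coe_germ hg, coe_germ (hf.mul hg)]
  rfl

/-- The constant functions. -/
def constGerm : ℝ →+* SmoothGerm n where
  toFun c := germ fun _ => c
  map_one' := Subtype.ext (coe_germ contDiffAt_const)
  map_zero' := Subtype.ext (coe_germ contDiffAt_const)
  map_add' _ _ := germ_add contDiffAt_const contDiffAt_const
  map_mul' _ _ := germ_mul contDiffAt_const contDiffAt_const

theorem constGerm_apply (c : ℝ) : constGerm (n := n) c = germ fun _ => c := rfl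

theorem germ_sum {κ : Type*} (s : Finset κ) {f : κ → (Fin n → ℝ) → ℝ}
    (hf : ∀ k ∈ s, ContDiffAt ℝ ∞ (f k) 0) :
    germ (fun τ => ∑ k ∈ s, f k τ) = ∑ k ∈ s, germ (f k) := by
  classical
  induction s using Finset.induction_on with
  | empty =>
    simp only [Finset.sum_empty]
    exact (constGerm (n := n)).map_zero
  | insert a s ha ih =>
    simp only [Finset.sum_insert ha]
    rw [germ_add (hf _ (Finset.mem_insert_self _ _))
      (ContDiffAt.sum fun k hk => hf k (Finset.mem_insert_of_mem hk)),
      ih fun k hk => hf k (Finset.mem_insert_of_mem hk)]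

/-- The value of a germ at `0`. -/
def evGerm : SmoothGerm n →+* ℝ := Germ.valueRingHom.comp (SmoothGerm n).subtype

theorem evGerm_germ {f : (Fin n → ℝ) → ℝ} (hf : ContDiffAt ℝ ∞ f 0) : evGerm (germ f) = f 0 := by
  change Germ.value (germ f : Germ (𝓝 (0 : Fin n → ℝ)) ℝ) = f 0
  rw [coe_germ hf]
  rfl

theorem evGerm_const (c : ℝ) : evGerm (constGerm (n := n) c) = c :=
  evGerm_germ contDiffAt_const

theorem germ_pd_add {f g : (Fin n → ℝ) → ℝ} (hf : ContDiffAt ℝ ∞ f 0)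
    (hg : ContDiffAt ℝ ∞ g 0) (i : Fin n) :
    germ (pd i (fun τ => f τ + g τ)) = germ (pd i f) + germ (pd i g) := by
  rw [← germ_add (contDiffAt_pd hf i) (contDiffAt_pd hg i)]
  apply germ_congr
  filter_upwards [ContDiffAt.eventually_differentiableAt hf,
    ContDiffAt.eventually_differentiableAt hg] with τ h1 h2
  unfold pd
  rw [fderiv_fun_add h1 h2]
  rfl

/-- The partial derivative of a germ. -/
def dGerm (i : Fin n) : SmoothGerm n →+ SmoothGerm n where
  toFun a := germ (pd i (exists_germ_eq a).choose)
  map_zero' := by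
    have h := (exists_germ_eq (0 : SmoothGerm n)).choose_spec
    have h0 : (exists_germ_eq (0 : SmoothGerm n)).choose =ᶠ[𝓝 0] fun _ => 0 := by
      apply germ_eq_germ h.1 contDiffAt_const
      rw [h.2]
      exact (constGerm (n := n)).map_zero.symm
    rw [germ_congr (pd_congr h0 i)]
    have : pd i (fun _ : Fin n → ℝ => (0 : ℝ)) = fun _ => 0 := by
      funext τ
      simp [pd]
    rw [this]
    exact (constGerm (n := n)).map_zero
  map_add' a b := by
    have h := (exists_germ_eq (a + b)).choose_spec
    have ha := (exists_germ_eq a).choose_spec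
    have hb := (exists_germ_eq b).choose_spec
    rw [← germ_pd_add ha.1 hb.1]
    apply germ_congr (pd_congr _ i)
    apply germ_eq_germ h.1 (ha.1.add hb.1)
    rw [h.2, germ_add ha.1 hb.1, ha.2, hb.2]

theorem dGerm_germ {f : (Fin n → ℝ) → ℝ} (hf : ContDiffAt ℝ ∞ f 0) (i : Fin n) :
    dGerm i (germ f) = germ (pd i f) := by
  have h := (exists_germ_eq (germ f)).choose_spec
  exact germ_congr (pd_congr (germ_eq_germ h.1 hf h.2) i)

theorem isConn_dGerm : IsConn (dGerm (n := n)) dGerm := by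
  intro i a b
  obtain ⟨f, hf, rfl⟩ := exists_germ_eq a
  obtain ⟨g, hg, rfl⟩ := exists_germ_eq b
  rw [smul_eq_mul, smul_eq_mul, smul_eq_mul, ← germ_mul hf hg, dGerm_germ (hf.mul hg),
    dGerm_germ hf, dGerm_germ hg, ← germ_mul hf (contDiffAt_pd hg i),
    ← germ_mul (contDiffAt_pd hf i) hg,
    ← germ_add (hf.mul (contDiffAt_pd hg i)) ((contDiffAt_pd hf i).mul hg)]
  apply germ_congr
  filter_upwards [ContDiffAt.eventually_differentiableAt hf,
    ContDiffAt.eventually_differentiableAt hg] with τ h1 h2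
  unfold pd
  rw [fderiv_fun_mul h1 h2]
  simp [mul_comm]

theorem commuting_dGerm : Commuting (dGerm (n := n)) := by
  intro i j a
  obtain ⟨f, hf, rfl⟩ := exists_germ_eq a
  rw [dGerm_germ hf, dGerm_germ hf, dGerm_germ (contDiffAt_pd hf _),
    dGerm_germ (contDiffAt_pd hf _)]
  apply germ_congr
  have h2 : ContDiffAt ℝ 2 f 0 := hf.of_le two_le_infty
  filter_upwards [h2.eventually (by simp)] with τ h
  exact pd_comm h i j

end Germs

/-! ## Translations of Taylor polynomials -/

section Taylor

variable {n : ℕ}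

/-- The monomial `t^K / K!`. -/
def monom (K : Multiset (Fin n)) (τ : Fin n → ℝ) : ℝ :=
  ∏ i, τ i ^ K.count i / ((K.count i).factorial : ℝ)

theorem contDiff_monom {k : WithTop ℕ∞} (K : Multiset (Fin n)) : ContDiff ℝ k (monom K) := by
  unfold monom
  fun_prop

theorem monom_zero_right (K : Multiset (Fin n)) : monom K 0 = if K = 0 then 1 else 0 := by
  unfold monom
  split_ifs with h
  · simp [h]
  · obtain ⟨i, hi⟩ := Multiset.exists_mem_of_ne_zero h
    exact Finset.prod_eq_zero (Finset.mem_univ i) (by simp [Multiset.count_eq_zero, hi])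

theorem monom_zero_left (τ : Fin n → ℝ) : monom 0 τ = 1 := by simp [monom]

theorem pd_monom (i : Fin n) (K : Multiset (Fin n)) (τ : Fin n → ℝ) :
    pd i (monom K) τ = if i ∈ K then monom (K.erase i) τ else 0 := by
  have h1 : ∀ k : Fin n, HasFDerivAt (fun τ : Fin n → ℝ => τ k ^ K.count k /
      ((K.count k).factorial : ℝ)) (((K.count k * τ k ^ (K.count k - 1)) /
      ((K.count k).factorial : ℝ)) • ContinuousLinearMap.proj (R := ℝ) (φ := fun _ => ℝ) k) τ := by
    intro k
    have := ((hasDerivAt_pow (K.count k) (τ k)).div_const ((K.count k).factorial : ℝ)).comp_hasFDerivAt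
      τ (hasFDerivAt_apply (𝕜 := ℝ) k τ)
    exact this
  have h2 := HasFDerivAt.finsetProd (u := Finset.univ) (fun k _ => h1 k)
  unfold pd
  have h3 : monom K = fun τ : Fin n → ℝ => ∏ k, τ k ^ K.count k / ((K.count k).factorial : ℝ) := rfl
  rw [h3, h2.fderiv]
  simp only [sum_apply, smul_apply,
    ContinuousLinearMap.proj_apply, smul_eq_mul]
  rw [Finset.sum_eq_single i]
  · rw [Pi.single_eq_same, mul_one]
    split_ifs with hi
    · unfold monom
      rw [← Finset.prod_erase_mul _ _ (Finset.mem_univ i)]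
      congr 1
      · refine Finset.prod_congr rfl fun k hk => ?_
        rw [Multiset.count_erase_of_ne (Finset.ne_of_mem_erase hk)]
      · have : K.count i ≠ 0 := by rwa [Ne, Multiset.count_eq_zero, not_not]
        obtain ⟨c, hc⟩ := Nat.exists_eq_succ_of_ne_zero this
        rw [Multiset.count_erase_self, hc, Nat.factorial_succ]
        push_cast
        field_simp
    · simp [Multiset.count_eq_zero.2 hi]
  · intro k _ hk
    simp [hk]
  · simp

variable {ι : Type} {t : ℕ}

theorem Jet.get_of_lt (x : Jet ι n t) (A : ι) {J : Multiset (Fin n)} (h : t < J.card) :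
    x.get A J = 0 := dif_neg (not_le.2 h)

theorem Jet.get_of_le (x : Jet ι n t) (A : ι) {J : Multiset (Fin n)} (h : J.card ≤ t) :
    x.get A J = x A ⟨J, h⟩ := dif_pos h

theorem Jet.get_coe (x : Jet ι n t) (A : ι) (J : MIdx n t) : x.get A J.1 = x A J :=
  dif_pos J.2

/-- The coordinates of the translation by `τ` of the polynomial with coordinates `x` at `0`. -/
def translate (x : Jet ι n t) (τ : Fin n → ℝ) : Jet ι n t :=
  fun A J => ∑ K : MIdx n t, x.get A (J.1 + K.1) * monom K.1 τ

theorem get_translate (x : Jet ι n t) (τ : Fin n → ℝ) (A : ι) (J : Multiset (Fin n)) :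
    (translate x τ).get A J = ∑ K : MIdx n t, x.get A (J + K.1) * monom K.1 τ := by
  by_cases h : J.card ≤ t
  · rw [Jet.get_of_le _ _ h]
    rfl
  · rw [Jet.get_of_lt _ _ (not_le.1 h)]
    refine (Finset.sum_eq_zero fun K _ => ?_).symm
    rw [Jet.get_of_lt, zero_mul]
    rw [Multiset.card_add]
    omega

theorem translate_zero (x : Jet ι n t) : translate x 0 = x := by
  funext A J
  simp only [translate, monom_zero_right]
  rw [Finset.sum_eq_single (⟨0, Nat.zero_le _⟩ : MIdx n t)]
  · simp [Jet.get_coe]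
  · intro K _ hK
    have : K.1 ≠ 0 := fun h => hK (Subtype.ext h)
    simp [this]
  · simp

theorem contDiff_translate_apply {k : WithTop ℕ∞} (x : Jet ι n t) (A : ι) (J : MIdx n t) :
    ContDiff ℝ k (fun τ => translate x τ A J) :=
  ContDiff.sum fun K _ => contDiff_const.mul (contDiff_monom K.1)

theorem contDiff_translate_get {k : WithTop ℕ∞} (x : Jet ι n t) (A : ι) (J : Multiset (Fin n)) :
    ContDiff ℝ k (fun τ => (translate x τ).get A J) := by
  simp only [get_translate]
  exact ContDiff.sum fun K _ => contDiff_const.mul (contDiff_monom K.1)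

/-- Differentiation removes an `i` from each monomial `K` that contains it; reindexing by `K ↦ K -
i` gives monomials of degree less than `t`. The missing ones of degree `t` have coefficient zero,
because coordinates with more than `t` indices are zero by convention. -/
theorem pd_translate_get (x : Jet ι n t) (A : ι) (J : Multiset (Fin n)) (i : Fin n)
    (τ : Fin n → ℝ) :
    pd i (fun τ => (translate x τ).get A J) τ = (translate x τ).get A (i ::ₘ J) := by
  have h1 : pd i (fun τ => (translate x τ).get A J) τ =
      ∑ K : MIdx n t, x.get A (J + K.1) * pd i (monom K.1) τ := by
    simp only [get_translate, pd]
    rw [fderiv_fun_sum fun K _ => ((contDiff_monom K.1).contDiffAt.differentiableAt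
      (n := 1) (by simp)).const_mul _]
    simp only [sum_apply]
    refine Finset.sum_congr rfl fun K _ => ?_
    rw [fderiv_const_mul ((contDiff_monom K.1).contDiffAt.differentiableAt (n := 1) (by simp))]
    rfl
  rw [h1, get_translate]
  simp only [pd_monom, mul_ite, mul_zero]
  rw [← Finset.sum_filter]
  have h2 : ∑ K : MIdx n t, x.get A (i ::ₘ J + K.1) * monom K.1 τ =
      ∑ K ∈ Finset.univ.filter (fun K : MIdx n t => K.1.card < t),
        x.get A (i ::ₘ J + K.1) * monom K.1 τ := by
    symm
    apply Finset.sum_subset (Finset.subset_univ _)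
    intro K _ hK
    simp only [Finset.mem_filter, Finset.mem_univ, true_and, not_lt] at hK
    rw [Jet.get_of_lt, zero_mul]
    rw [Multiset.card_add, Multiset.card_cons]
    omega
  rw [h2]
  refine Finset.sum_bij' (fun K _ => ⟨K.1.erase i, (Multiset.card_erase_le).trans K.2⟩)
    (fun K hK => ⟨i ::ₘ K.1, by
      rw [Multiset.card_cons]
      exact (Finset.mem_filter.1 hK).2⟩) ?_ ?_ ?_ ?_ ?_
  · intro K hK
    have hK' := (Finset.mem_filter.1 hK).2
    simp only [Finset.mem_filter, Finset.mem_univ, true_and]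
    have := Multiset.card_erase_lt_of_mem hK'
    exact this.trans_le K.2
  · intro K hK
    simp
  · intro K hK
    have hK' := (Finset.mem_filter.1 hK).2
    exact Subtype.ext (Multiset.cons_erase hK')
  · intro K hK
    exact Subtype.ext (Multiset.erase_cons_head _ _)
  · intro K hK
    have hK' := (Finset.mem_filter.1 hK).2
    congr 2
    rw [Multiset.cons_add, ← Multiset.add_cons, Multiset.cons_erase hK']

variable [Fintype ι]

theorem contDiff_translate {k : WithTop ℕ∞} (x : Jet ι n t) : ContDiff ℝ k (translate x) :=
  contDiff_pi.2 fun A => contDiff_pi.2 fun J => contDiff_translate_apply x A J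

theorem contDiff_get {k : WithTop ℕ∞} (A : ι) (J : Multiset (Fin n)) :
    ContDiff ℝ k (fun x : Jet ι n t => x.get A J) := by
  by_cases h : J.card ≤ t
  · simp only [Jet.get_of_le _ _ h]
    fun_prop
  · simp only [Jet.get_of_lt _ _ (not_le.1 h)]
    exact contDiff_const

/-- The direction of the formal derivative. -/
def shift (i : Fin n) (x : Jet ι n t) : Jet ι n t := fun A J => x.get A (i ::ₘ J.1)

variable [DecidableEq ι]

theorem fderiv_eq_sum_pder (f : Jet ι n t → ℝ) (x u : Jet ι n t) :
    fderiv ℝ f x u = ∑ A, ∑ J : MIdx n t, u A J * pder A J.1 f x := by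
  have h : u = ∑ A, ∑ J : MIdx n t, u A J • (Pi.single A (Pi.single J 1) : Jet ι n t) := by
    funext B K
    simp only [Finset.sum_apply, Pi.smul_apply, smul_eq_mul]
    rw [Finset.sum_eq_single B]
    · rw [Finset.sum_eq_single K]
      · simp
      · intro J _ hJ
        simp [hJ.symm]
      · simp
    · intro A _ hA
      simp [hA.symm]
    · simp
  conv_lhs => rw [h]
  simp only [map_sum, map_smul, smul_eq_mul]
  refine Finset.sum_congr rfl fun A _ => Finset.sum_congr rfl fun J _ => ?_
  rw [pder, dif_pos J.2]

/-- The restriction to `|J| < t` in the formal derivative is automatic, as `x^A_{iJ}` is zero for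
`|J| = t`. Thus it is a derivative along a linear vector field. -/
theorem formalD_eq_fderiv (i : Fin n) (f : Jet ι n t → ℝ) (x : Jet ι n t) :
    formalD i f x = fderiv ℝ f x (shift i x) := by
  rw [fderiv_eq_sum_pder, formalD]
  refine Finset.sum_congr rfl fun A _ => Finset.sum_congr rfl fun J _ => ?_
  split_ifs with h
  · rfl
  · rw [shift, Jet.get_of_lt, zero_mul]
    rw [Multiset.card_cons]
    omega

theorem pder_eq_fderiv (A : ι) (J : MIdx n t) (f : Jet ι n t → ℝ) (x : Jet ι n t) :
    pder A J.1 f x = fderiv ℝ f x (Pi.single A (Pi.single J 1)) := dif_pos J.2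

theorem contDiff_shift {k : WithTop ℕ∞} (i : Fin n) :
    ContDiff ℝ k (shift i : Jet ι n t → Jet ι n t) :=
  contDiff_pi.2 fun A => contDiff_pi.2 fun _ => contDiff_get A _

theorem contDiffAt_formalD {f : Jet ι n t → ℝ} {x : Jet ι n t} (h : ContDiffAt ℝ ∞ f x)
    (i : Fin n) : ContDiffAt ℝ ∞ (formalD i f) x := by
  rw [funext (formalD_eq_fderiv i f)]
  exact (h.fderiv_right (m := ∞) (by norm_num)).clm_apply (contDiff_shift i).contDiffAt

theorem contDiffAt_formalDs {f : Jet ι n t → ℝ} {x : Jet ι n t} (h : ContDiffAt ℝ ∞ f x)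
    (J : List (Fin n)) : ContDiffAt ℝ ∞ (formalDs J f) x := by
  induction J with
  | nil => exact h
  | cons i J ih => exact contDiffAt_formalD ih i

theorem contDiffAt_pder {f : Jet ι n t → ℝ} {x : Jet ι n t} (h : ContDiffAt ℝ ∞ f x) (A : ι)
    (J : Multiset (Fin n)) : ContDiffAt ℝ ∞ (pder A J f) x := by
  unfold pder
  split_ifs with hJ
  · exact (h.fderiv_right (m := ∞) (by norm_num)).clm_apply contDiffAt_const
  · exact contDiffAt_const

/-- The truncated formal derivative is exact along a polynomial of degree at most `t`, whose
derivatives of order `t + 1` vanish. Hence no order is lost in passing to germs. -/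
theorem pd_comp_translate {f : Jet ι n t → ℝ} {x : Jet ι n t} {τ : Fin n → ℝ}
    (h : DifferentiableAt ℝ f (translate x τ)) (i : Fin n) :
    pd i (fun τ => f (translate x τ)) τ = formalD i f (translate x τ) := by
  have h1 : DifferentiableAt ℝ (translate x) τ :=
    (contDiff_translate (k := 1) x).contDiffAt.differentiableAt (by simp)
  have h2 : fderiv ℝ (fun τ => f (translate x τ)) τ = _ := fderiv_comp τ h h1
  rw [pd, h2, formalD_eq_fderiv]
  simp only [ContinuousLinearMap.comp_apply]
  congr 1
  funext A J
  have h3 : fderiv ℝ (fun τ => translate x τ A J) τ = _ :=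
    fderiv_apply (differentiableAt_pi.1 h1 A) J
  rw [fderiv_apply h1 A] at h3
  have h4 := pd_translate_get x A J.1 i τ
  simp only [Jet.get_coe, pd] at h4
  rw [shift, ← h4, h3]
  rfl

/-! ### Germs of functions along a polynomial -/

/-- The germ of the function `f` along the polynomial with coordinates `x`. -/
def pull (x : Jet ι n t) (f : Jet ι n t → ℝ) : SmoothGerm n := germ fun τ => f (translate x τ)

variable {x : Jet ι n t} {f g : Jet ι n t → ℝ}

theorem contDiffAt_comp_translate (hf : ContDiffAt ℝ ∞ f x) :
    ContDiffAt ℝ ∞ (fun τ => f (translate x τ)) 0 := by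
  rw [← translate_zero x] at hf
  exact hf.comp (0 : Fin n → ℝ) (contDiff_translate _).contDiffAt

theorem eventually_translate {p : Jet ι n t → Prop} (h : ∀ᶠ y in 𝓝 x, p y) :
    ∀ᶠ τ in 𝓝 (0 : Fin n → ℝ), p (translate x τ) := by
  have h1 : Tendsto (translate x) (𝓝 0) (𝓝 (translate x 0)) :=
    (contDiff_translate (k := 0) x).continuous.continuousAt
  rw [translate_zero] at h1
  exact h1.eventually h

theorem pull_congr (h : f =ᶠ[𝓝 x] g) : pull x f = pull x g :=
  germ_congr (eventually_translate h)

theorem pull_add (hf : ContDiffAt ℝ ∞ f x) (hg : ContDiffAt ℝ ∞ g x) :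
    pull x (fun y => f y + g y) = pull x f + pull x g :=
  germ_add (contDiffAt_comp_translate hf) (contDiffAt_comp_translate hg)

theorem pull_mul (hf : ContDiffAt ℝ ∞ f x) (hg : ContDiffAt ℝ ∞ g x) :
    pull x (fun y => f y * g y) = pull x f * pull x g :=
  germ_mul (contDiffAt_comp_translate hf) (contDiffAt_comp_translate hg)

theorem pull_const (c : ℝ) : pull x (fun _ => c) = constGerm c := rfl

theorem pull_zero : pull x (fun _ => 0) = 0 := (constGerm (n := n)).map_zero

theorem pull_const_mul (c : ℝ) (hf : ContDiffAt ℝ ∞ f x) :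
    pull x (fun y => c * f y) = constGerm c * pull x f := by
  rw [pull_mul contDiffAt_const hf, pull_const]

theorem pull_sum {κ : Type*} (s : Finset κ) {f : κ → Jet ι n t → ℝ}
    (hf : ∀ k ∈ s, ContDiffAt ℝ ∞ (f k) x) :
    pull x (fun y => ∑ k ∈ s, f k y) = ∑ k ∈ s, pull x (f k) :=
  germ_sum s fun k hk => contDiffAt_comp_translate (hf k hk)

theorem evGerm_pull (hf : ContDiffAt ℝ ∞ f x) : evGerm (pull x f) = f x := by
  rw [pull, evGerm_germ (contDiffAt_comp_translate hf), translate_zero]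

theorem dGerm_pull (hf : ContDiffAt ℝ ∞ f x) (i : Fin n) :
    dGerm i (pull x f) = pull x (formalD i f) := by
  rw [pull, dGerm_germ (contDiffAt_comp_translate hf)]
  apply germ_congr
  filter_upwards [eventually_translate (ContDiffAt.eventually_differentiableAt hf)] with τ h
  exact pd_comp_translate h i

theorem iter_dGerm_pull (hf : ContDiffAt ℝ ∞ f x) (J : List (Fin n)) :
    iter dGerm J (pull x f) = pull x (formalDs J f) := by
  induction J with
  | nil => rfl
  | cons i J ih => rw [iter_cons, ih, dGerm_pull (contDiffAt_formalDs hf J)]; rfl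

theorem formalD_get (A : ι) (J : Multiset (Fin n)) (i : Fin n) (x : Jet ι n t) :
    formalD i (fun x => x.get A J) x = x.get A (i ::ₘ J) := by
  have h := pd_comp_translate (f := fun x : Jet ι n t => x.get A J) (x := x) (τ := 0)
    ((contDiff_get (k := 1) A J).contDiffAt.differentiableAt (by simp)) i
  rw [pd_translate_get, translate_zero] at h
  exact h.symm

end Taylor

/-! ## Variations of functions of jets -/

section Variations

variable {n t : ℕ} {ι : Type} [Fintype ι] [DecidableEq ι] {N : Type*} [AddCommGroup N]
  [Module (SmoothGerm n) N] {x : Jet ι n t}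

/-- The variation `∑ u^A_J ∂f/∂x^A_J`. -/
def vari (x : Jet ι n t) (u : ι → MIdx n t → N) (f : Jet ι n t → ℝ) : N :=
  ∑ A, ∑ J : MIdx n t, pull x (pder A J.1 f) • u A J

variable {u : ι → MIdx n t → N} {f g : Jet ι n t → ℝ}

/-- A variation is linear in the differential, so every rule of calculus for `fderiv` (products,
sums, determinants, compositions) is transferred to variations through this lemma. -/
theorem vari_of_fderiv {κ : Type*} (s : Finset κ) {g h : κ → Jet ι n t → ℝ}
    (hg : ∀ k ∈ s, ContDiffAt ℝ ∞ (g k) x) (hh : ∀ k ∈ s, ContDiffAt ℝ ∞ (h k) x)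
    (hf : ∀ᶠ y in 𝓝 x, ∀ e, fderiv ℝ f y e = ∑ k ∈ s, g k y * fderiv ℝ (h k) y e) :
    vari x u f = ∑ k ∈ s, pull x (g k) • vari x u (h k) := by
  have h1 : ∀ A (J : MIdx n t), pull x (pder A J.1 f) =
      ∑ k ∈ s, pull x (g k) * pull x (pder A J.1 (h k)) := by
    intro A J
    rw [pull_congr (g := fun y => ∑ k ∈ s, g k y * pder A J.1 (h k) y),
      pull_sum s fun k hk => (hg k hk).mul (contDiffAt_pder (hh k hk) A J.1)]
    · exact Finset.sum_congr rfl fun k hk =>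
        pull_mul (hg k hk) (contDiffAt_pder (hh k hk) A J.1)
    · filter_upwards [hf] with y hy
      simp only [pder_eq_fderiv]
      exact hy _
  simp only [vari, h1, Finset.sum_smul, Finset.smul_sum, smul_smul]
  rw [Finset.sum_comm (s := s)]
  exact Finset.sum_congr rfl fun A _ => Finset.sum_comm

theorem vari_congr (h : f =ᶠ[𝓝 x] g) : vari x u f = vari x u g := by
  unfold vari
  refine Finset.sum_congr rfl fun A _ => Finset.sum_congr rfl fun J _ => ?_
  congr 1
  apply pull_congr
  filter_upwards [h.fderiv (𝕜 := ℝ)] with y hy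
  rw [pder_eq_fderiv, pder_eq_fderiv, hy]

theorem vari_const (c : ℝ) : vari x u (fun _ => c) = 0 := by
  have := vari_of_fderiv (x := x) (u := u) (f := fun _ => c) (∅ : Finset Unit)
    (g := fun _ _ => 0) (h := fun _ _ => 0) (by simp) (by simp) (by simp)
  simpa using this

theorem vari_mul (hf : ContDiffAt ℝ ∞ f x) (hg : ContDiffAt ℝ ∞ g x) :
    vari x u (fun y => f y * g y) = pull x f • vari x u g + pull x g • vari x u f := by
  have := vari_of_fderiv (x := x) (u := u) (f := fun y => f y * g y) (Finset.univ : Finset Bool)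
    (g := fun b => if b then f else g) (h := fun b => if b then g else f)
    (by simp [hf, hg]) (by simp [hf, hg]) (by
      filter_upwards [ContDiffAt.eventually_differentiableAt hf,
        ContDiffAt.eventually_differentiableAt hg] with y h1 h2 e
      rw [fderiv_fun_mul h1 h2]
      simp)
  simpa using this

theorem vari_sum {κ : Type*} (s : Finset κ) {f : κ → Jet ι n t → ℝ}
    (hf : ∀ k ∈ s, ContDiffAt ℝ ∞ (f k) x) :
    vari x u (fun y => ∑ k ∈ s, f k y) = ∑ k ∈ s, vari x u (f k) := by
  have := vari_of_fderiv (x := x) (u := u) (f := fun y => ∑ k ∈ s, f k y) s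
    (g := fun _ _ => 1) (h := f) (fun _ _ => contDiffAt_const) hf (by
      have : ∀ᶠ y in 𝓝 x, ∀ k ∈ s, DifferentiableAt ℝ (f k) y :=
        (Finset.eventually_all s).2 fun k hk => ContDiffAt.eventually_differentiableAt (hf k hk)
      filter_upwards [this] with y h e
      rw [fderiv_fun_sum h]
      simp)
  simpa [pull_const] using this

theorem vari_neg (hf : ContDiffAt ℝ ∞ f x) : vari x u (fun y => -f y) = -vari x u f := by
  have h := vari_mul (u := u) (contDiffAt_const (c := (-1 : ℝ))) hf
  simp only [neg_one_mul] at h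
  rw [h, vari_const, pull_const]
  simp

theorem fderiv_get (A : ι) (J : Multiset (Fin n)) (y e : Jet ι n t) :
    fderiv ℝ (fun y : Jet ι n t => y.get A J) y e = e.get A J := by
  by_cases h : J.card ≤ t
  · simp only [Jet.get_of_le _ _ h]
    have h1 := fderiv_apply (𝕜 := ℝ) (Φ := fun y : Jet ι n t => y A) (x := y)
      (by fun_prop) ⟨J, h⟩
    have h2 := fderiv_apply (𝕜 := ℝ) (Φ := fun y : Jet ι n t => y) (x := y) (by fun_prop) A
    rw [h1, h2]
    simp
  · simp only [Jet.get_of_lt _ _ (not_le.1 h)]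
    simp

theorem vari_get (A : ι) {K : Multiset (Fin n)} (h : K.card ≤ t) :
    vari x u (fun y => y.get A K) = u A ⟨K, h⟩ := by
  unfold vari
  have h1 : ∀ (B : ι) (J : MIdx n t), pder B J.1 (fun y : Jet ι n t => y.get A K) =
      fun _ => if B = A ∧ J = ⟨K, h⟩ then 1 else 0 := by
    intro B J
    funext y
    rw [pder_eq_fderiv, fderiv_get, Jet.get_of_le _ _ h]
    by_cases hB : B = A
    · subst hB
      simp [Pi.single_apply, eq_comm]
    · simp [hB]
  simp only [h1, pull_const]
  rw [Finset.sum_eq_single A, Finset.sum_eq_single ⟨K, h⟩]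
  · simp
  · intro J _ hJ
    simp [hJ]
  · simp
  · intro B _ hB
    simp [hB]
  · simp

/-- The derivation `d_i` is itself a variation, with `u^A_J = x^A_{iJ}`; formulas proved for
arbitrary variations therefore apply to it. -/
theorem dGerm_pull_eq_vari (hf : ContDiffAt ℝ ∞ f x) (i : Fin n) :
    dGerm i (pull x f) = vari x (fun A J => pull x (fun y => y.get A (i ::ₘ J.1))) f := by
  have h : formalD i f = fun y => ∑ A, ∑ J : MIdx n t, y.get A (i ::ₘ J.1) * pder A J.1 f y := by
    funext y
    rw [formalD_eq_fderiv, fderiv_eq_sum_pder]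
    rfl
  have hs : ∀ A (J : MIdx n t), ContDiffAt ℝ ∞ (fun y => y.get A (i ::ₘ J.1) * pder A J.1 f y) x :=
    fun A J => (contDiff_get A _).contDiffAt.mul (contDiffAt_pder hf A J.1)
  rw [dGerm_pull hf, h, pull_sum _ fun A _ => ContDiffAt.sum fun J _ => hs A J]
  unfold vari
  refine Finset.sum_congr rfl fun A _ => ?_
  rw [pull_sum _ fun J _ => hs A J]
  refine Finset.sum_congr rfl fun J _ => ?_
  rw [pull_mul (contDiff_get A _).contDiffAt (contDiffAt_pder hf A J.1), smul_eq_mul, mul_comm]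

/-! ### The order of a function -/

/-- The function `f` does not depend on the coordinates of order greater than `r`. -/
def HasOrder (r : ℕ) (f : Jet ι n t → ℝ) : Prop :=
  ∀ y u : Jet ι n t, (∀ A J, J.1.card ≤ r → u A J = 0) → f (y + u) = f y

/-- Differentiability is not required, since `fderiv` is zero where it fails. Statements about the
order of a function thus hold without smoothness. -/
theorem fderiv_eq_zero_of_invariant {V : Type*} [NormedAddCommGroup V] [NormedSpace ℝ V]
    {f : V → ℝ} {y e : V} (h : ∀ c : ℝ, f (y + c • e) = f y) : fderiv ℝ f y e = 0 := by
  by_cases hf : DifferentiableAt ℝ f y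
  · rw [← hf.lineDeriv_eq_fderiv, lineDeriv]
    simp [h]
  · simp [fderiv_zero_of_not_differentiableAt hf]

theorem HasOrder.pder_eq_zero {r : ℕ} (h : HasOrder r f) (A : ι) {J : Multiset (Fin n)}
    (hJ : r < J.card) : pder A J f = fun _ => 0 := by
  funext y
  unfold pder
  split_ifs with hJ'
  · apply fderiv_eq_zero_of_invariant
    intro c
    apply h
    intro B K hK
    have : K ≠ ⟨J, hJ'⟩ := by
      rintro rfl
      exact absurd hK (not_le.2 hJ)
    by_cases hB : B = A
    · subst hB
      simp [this]
    · simp [hB]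
  · rfl

theorem HasOrder.pder_add {r : ℕ} (h : HasOrder r f) {y u : Jet ι n t}
    (hu : ∀ A J, J.1.card ≤ r → u A J = 0) (A : ι) (J : Multiset (Fin n)) :
    pder A J f (y + u) = pder A J f y := by
  unfold pder
  split_ifs
  · rw [← fderiv_comp_add_right]
    congr 2
    funext z
    exact h z u hu
  · rfl

theorem Jet.get_add (y u : Jet ι n t) (A : ι) (J : Multiset (Fin n)) :
    (y + u).get A J = y.get A J + u.get A J := by
  unfold Jet.get
  split_ifs
  · rfl
  · simp

theorem get_eq_zero {r : ℕ} {u : Jet ι n t} (hu : ∀ A J, J.1.card ≤ r → u A J = 0) (A : ι)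
    {J : Multiset (Fin n)} (hJ : J.card ≤ r) : u.get A J = 0 := by
  unfold Jet.get
  split_ifs with h
  · exact hu A ⟨J, h⟩ hJ
  · rfl

theorem HasOrder.formalD {r : ℕ} (h : HasOrder r f) (i : Fin n) :
    HasOrder (r + 1) (formalD i f) := by
  intro y u hu
  have hu' : ∀ A (J : MIdx n t), J.1.card ≤ r → u A J = 0 := fun A J hJ => hu A J (by omega)
  unfold Velocity.formalD
  refine Finset.sum_congr rfl fun A _ => Finset.sum_congr rfl fun J _ => ?_
  split_ifs
  · rw [h.pder_add hu']
    by_cases hJ : J.1.card ≤ r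
    · rw [Jet.get_add, get_eq_zero hu A (J := i ::ₘ J.1) (by rw [Multiset.card_cons]; omega),
        add_zero]
    · rw [h.pder_eq_zero A (not_le.1 hJ)]
      simp
  · rfl

theorem hasOrder_get (A : ι) (J : Multiset (Fin n)) :
    HasOrder J.card (fun y : Jet ι n t => y.get A J) := by
  intro y u hu
  change (y + u).get A J = y.get A J
  rw [Jet.get_add, get_eq_zero hu A le_rfl, add_zero]

/-! ### The variation defined by a section -/

/-- `D_K` for a multi-index `K`. -/
def iterM (D : Fin n → N →+ N) (K : Multiset (Fin n)) (m : N) : N := iter D (K.sort (· ≤ ·)) m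

theorem iterM_coe {D : Fin n → N →+ N} (hc : Commuting D) (L : List (Fin n)) (m : N) :
    iterM D (L : Multiset (Fin n)) m = iter D L m := by
  apply hc.iter_perm
  rw [← Multiset.coe_eq_coe, Multiset.sort_eq]

theorem iterM_cons {D : Fin n → N →+ N} (hc : Commuting D) (i : Fin n) (K : Multiset (Fin n))
    (m : N) : iterM D (i ::ₘ K) m = D i (iterM D K m) := by
  induction K using Quotient.inductionOn with
  | h L => rw [Multiset.quot_mk_to_coe, Multiset.cons_coe, iterM_coe hc, iterM_coe hc, iter_cons]

/-- The derivatives `D_J w^A`. -/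
def jetOf (t : ℕ) (D : Fin n → N →+ N) (w : ι → N) (A : ι) (J : MIdx n t) : N := iterM D J.1 (w A)

theorem shift_single (i : Fin n) (B : ι) (K : MIdx n t) :
    shift i (Pi.single B (Pi.single K 1) : Jet ι n t) = if i ∈ K.1 then
      Pi.single B (Pi.single ⟨K.1.erase i, Multiset.card_erase_le.trans K.2⟩ 1) else 0 := by
  funext A J
  unfold shift Jet.get
  by_cases hA : A = B
  · subst hA
    split_ifs with h1 h2 h2
    · simp only [Pi.single_eq_same, Pi.single_apply]
      congr 1
      apply propext
      rw [Subtype.ext_iff, Subtype.ext_iff]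
      constructor
      · rintro h
        simp [← h]
      · rintro h
        simp only at h
        simp only [h, Multiset.cons_erase h2]
    · rw [Pi.single_eq_same, Pi.single_eq_of_ne]
      · rfl
      · rintro rfl
        simp at h2
    · rw [Pi.single_eq_same, Pi.single_eq_of_ne]
      rintro rfl
      apply h1
      simp only [Multiset.cons_erase h2]
      exact K.2
    · rfl
  · split_ifs <;> simp [hA]

/-- The second derivatives of `f` are symmetric, so the commutator comes only from the differential
of the linear field `shift i`, which sends the basis vector of `K` to that of `K - i`. -/
theorem pder_formalD {y : Jet ι n t} (hf : ContDiffAt ℝ 2 f y) (i : Fin n) (B : ι) (K : MIdx n t) :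
    pder B K.1 (formalD i f) y = formalD i (pder B K.1 f) y +
      if i ∈ K.1 then pder B (K.1.erase i) f y else 0 := by
  have hs : IsSymmSndFDerivAt ℝ f y := hf.isSymmSndFDerivAt (by simp)
  have hd : DifferentiableAt ℝ (fderiv ℝ f) y :=
    (hf.fderiv_right (m := 1) (by norm_num)).differentiableAt (by simp)
  have hS : ∀ e, fderiv ℝ (shift i : Jet ι n t → Jet ι n t) y e = shift i e := by
    intro e
    funext A J
    have h0 : DifferentiableAt ℝ (shift i : Jet ι n t → Jet ι n t) y :=
      (contDiff_shift (k := 1) i).contDiffAt.differentiableAt (by simp)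
    have h1 := fderiv_apply (𝕜 := ℝ) (Φ := fun y : Jet ι n t => shift i y A) (x := y)
      (differentiableAt_pi.1 h0 A) J
    rw [fderiv_apply h0 A] at h1
    have h2 := congrArg (fun L => L e) h1
    have h3 := fderiv_get A (i ::ₘ J.1) y e
    change _ = e.get A (i ::ₘ J.1)
    rw [← h3]
    exact h2.symm
  have e1 : fderiv ℝ (fun y => fderiv ℝ f y (shift i y)) y = _ :=
    fderiv_clm_apply hd ((contDiff_shift (k := 1) i).contDiffAt.differentiableAt (by simp))
  have e2 : fderiv ℝ (fun y => fderiv ℝ f y (Pi.single B (Pi.single K 1))) y = _ :=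
    fderiv_clm_apply hd (differentiableAt_const _)
  have e3 : (pder B K.1 f) = fun y => fderiv ℝ f y (Pi.single B (Pi.single K 1)) :=
    funext fun y => pder_eq_fderiv B K f y
  rw [pder_eq_fderiv, formalD_eq_fderiv, funext (formalD_eq_fderiv i f), e1, e3, e2]
  simp only [add_apply, ContinuousLinearMap.comp_apply,
    ContinuousLinearMap.flip_apply, hS, shift_single, fderiv_fun_const]
  rw [hs (Pi.single B (Pi.single K 1)) (shift i y), add_comm]
  simp only [Pi.zero_apply, zero_apply, map_zero, zero_add]
  congr 1
  split_ifs
  · rw [← pder_eq_fderiv B ⟨K.1.erase i, Multiset.card_erase_le.trans K.2⟩ f y]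
  · simp

/-- A prolonged variation commutes with total derivatives: the extra term of `pder_formalD` supplies
`D_i D_K w^A`. For `|K| = t` this term is missing from the truncated sum; since `r < t` its
coefficient is zero. -/
theorem vari_formalD {D : Fin n → N →+ N} (hD : IsConn dGerm D) (hc : Commuting D) (w : ι → N)
    (hf : ContDiffAt ℝ ∞ f x) {r : ℕ} (hr : HasOrder r f) (hrt : r < t) (i : Fin n) :
    vari x (jetOf t D w) (formalD i f) = D i (vari x (jetOf t D w) f) := by
  have h1 : ∀ A (J : MIdx n t), pull x (pder A J.1 (formalD i f)) =
      dGerm i (pull x (pder A J.1 f)) + if i ∈ J.1 then pull x (pder A (J.1.erase i) f) else 0 := by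
    intro A J
    have h2 : pull x (pder A J.1 (formalD i f)) = pull x (fun y => formalD i (pder A J.1 f) y +
        if i ∈ J.1 then pder A (J.1.erase i) f y else 0) := by
      apply pull_congr
      filter_upwards [(hf.of_le two_le_infty).eventually (by simp)] with y hy
      exact pder_formalD hy i A J
    rw [h2, dGerm_pull (contDiffAt_pder hf A J.1)]
    split_ifs
    · exact pull_add (contDiffAt_formalD (contDiffAt_pder hf A J.1) i) (contDiffAt_pder hf A _)
    · simp
  simp only [vari, h1, add_smul, Finset.sum_add_distrib, map_sum, hD _ _ _]
  rw [add_comm]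
  congr 1
  refine Finset.sum_congr rfl fun A _ => ?_
  simp only [ite_smul, zero_smul]
  rw [← Finset.sum_filter]
  have h2 : ∑ K : MIdx n t, pull x (pder A K.1 f) • D i (jetOf t D w A K) =
      ∑ K ∈ Finset.univ.filter (fun K : MIdx n t => K.1.card < t),
        pull x (pder A K.1 f) • D i (jetOf t D w A K) := by
    symm
    apply Finset.sum_subset (Finset.subset_univ _)
    intro K _ hK
    simp only [Finset.mem_filter, Finset.mem_univ, true_and, not_lt] at hK
    rw [hr.pder_eq_zero A (hrt.trans_le hK), pull_zero, zero_smul]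
  rw [h2]
  refine Finset.sum_bij' (fun K _ => ⟨K.1.erase i, (Multiset.card_erase_le).trans K.2⟩)
    (fun K hK => ⟨i ::ₘ K.1, by
      rw [Multiset.card_cons]
      exact (Finset.mem_filter.1 hK).2⟩) ?_ ?_ ?_ ?_ ?_
  · intro K hK
    have hK' := (Finset.mem_filter.1 hK).2
    simp only [Finset.mem_filter, Finset.mem_univ, true_and]
    have := Multiset.card_erase_lt_of_mem hK'
    exact this.trans_le K.2
  · intro K hK
    simp
  · intro K hK
    have hK' := (Finset.mem_filter.1 hK).2
    exact Subtype.ext (Multiset.cons_erase hK')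
  · intro K hK
    exact Subtype.ext (Multiset.erase_cons_head _ _)
  · intro K hK
    have hK' := (Finset.mem_filter.1 hK).2
    congr 1
    rw [jetOf, jetOf, ← iterM_cons hc, Multiset.cons_erase hK']

end Variations

/-! ## The functions `z^i_I` and `y^σ_I` -/

section Coordinates

variable {n m t : ℕ} {N : Type*} [AddCommGroup N] [Module (SmoothGerm n) N]
  {x : Jet (Fin n ⊕ Fin m) n t}

theorem contDiff_xMat_apply {k : WithTop ℕ∞} (i j : Fin n) :
    ContDiff ℝ k (fun y : Jet (Fin n ⊕ Fin m) n t => xMat y i j) := contDiff_get _ _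

theorem contDiff_matrix_det {V : Type*} [NormedAddCommGroup V] [NormedSpace ℝ V] {k : WithTop ℕ∞}
    {A : V → Matrix (Fin n) (Fin n) ℝ} (h : ∀ i j, ContDiff ℝ k (fun y => A y i j)) :
    ContDiff ℝ k (fun y => (A y).det) := by
  simp only [Matrix.det_apply']
  exact ContDiff.sum fun π _ => contDiff_const.mul (contDiff_prod fun i _ => h _ _)

theorem contDiff_det_xMat {k : WithTop ℕ∞} :
    ContDiff ℝ k (fun y : Jet (Fin n ⊕ Fin m) n t => (xMat y).det) :=
  contDiff_matrix_det contDiff_xMat_apply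

theorem contDiffAt_xMat_inv {k : WithTop ℕ∞} (hx : (xMat x).det ≠ 0) (i j : Fin n) :
    ContDiffAt ℝ k (fun y : Jet (Fin n ⊕ Fin m) n t => (xMat y)⁻¹ i j) x := by
  simp only [Matrix.inv_def, Ring.inverse_eq_inv', Matrix.smul_apply, smul_eq_mul,
    Matrix.adjugate_apply]
  refine (contDiff_det_xMat.contDiffAt.inv hx).mul (contDiff_matrix_det fun a b => ?_).contDiffAt
  by_cases h : a = j
  · subst h
    simp only [Matrix.updateRow_self]
    exact contDiff_const
  · simp only [Matrix.updateRow_ne h]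
    exact contDiff_xMat_apply _ _

theorem eventually_det_ne_zero (hx : (xMat x).det ≠ 0) : ∀ᶠ y in 𝓝 x, (xMat y).det ≠ 0 :=
  (contDiff_det_xMat (k := 0)).continuous.continuousAt.eventually_ne hx

theorem xMat_add (y u : Jet (Fin n ⊕ Fin m) n t) : xMat (y + u) = xMat y + xMat u := by
  ext i j
  exact Jet.get_add _ _ _ _

theorem xMat_smul (c : ℝ) (u : Jet (Fin n ⊕ Fin m) n t) : xMat (c • u) = c • xMat u := by
  ext i j
  simp only [xMat, Jet.get, Matrix.smul_apply, smul_eq_mul]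
  split_ifs <;> simp

/-- The germ of `z^j_i`. -/
def zGerm (x : Jet (Fin n ⊕ Fin m) n t) (j i : Fin n) : SmoothGerm n :=
  pull x (fun y => (xMat y)⁻¹ j i)

/-- The derivations `z^j_i d_j`. -/
abbrev eGerm (x : Jet (Fin n ⊕ Fin m) n t) : Fin n → SmoothGerm n →+ SmoothGerm n :=
  twist (zGerm x) dGerm

/-- The germ of `x^i`. -/
def xGerm (x : Jet (Fin n ⊕ Fin m) n t) (i : Fin n) : SmoothGerm n :=
  pull x (fun y => y.get (Sum.inl i) 0)

theorem dGerm_xGerm (j k : Fin n) : dGerm j (xGerm x k) = pull x (fun y => xMat y k j) := by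
  rw [xGerm, dGerm_pull (contDiff_get _ _).contDiffAt]
  congr 1
  funext y
  rw [formalD_get]
  rfl

theorem sum_zGerm_mul (hx : (xMat x).det ≠ 0) (i k : Fin n) :
    ∑ j, zGerm x j i * pull x (fun y => xMat y k j) = if i = k then 1 else 0 := by
  have : ∀ j, zGerm x j i * pull x (fun y => xMat y k j) =
      pull x (fun y => (xMat y)⁻¹ j i * xMat y k j) := fun j =>
    (pull_mul (contDiffAt_xMat_inv hx _ _) (contDiff_xMat_apply _ _).contDiffAt).symm
  simp only [this]
  rw [← pull_sum Finset.univ (f := fun j y => (xMat y)⁻¹ j i * xMat y k j) fun j _ =>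
    (contDiffAt_xMat_inv hx _ _).mul (contDiff_xMat_apply _ _).contDiffAt,
    pull_congr (g := fun _ => if i = k then 1 else 0), pull_const]
  · split_ifs <;> simp
  · filter_upwards [eventually_det_ne_zero hx] with y hy
    have h := congrFun (congrFun (Matrix.mul_nonsing_inv (xMat y) (Ne.isUnit hy)) k) i
    rw [Matrix.mul_apply, Matrix.one_apply] at h
    simp only [eq_comm (a := i), ← h, mul_comm]

theorem sum_zGerm_mul' (hx : (xMat x).det ≠ 0) (l j : Fin n) :
    ∑ k, zGerm x l k * pull x (fun y => xMat y k j) = if l = j then 1 else 0 := by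
  have : ∀ k, zGerm x l k * pull x (fun y => xMat y k j) =
      pull x (fun y => (xMat y)⁻¹ l k * xMat y k j) := fun k =>
    (pull_mul (contDiffAt_xMat_inv hx _ _) (contDiff_xMat_apply _ _).contDiffAt).symm
  simp only [this]
  rw [← pull_sum Finset.univ (f := fun k y => (xMat y)⁻¹ l k * xMat y k j) fun k _ =>
    (contDiffAt_xMat_inv hx _ _).mul (contDiff_xMat_apply _ _).contDiffAt,
    pull_congr (g := fun _ => if l = j then 1 else 0), pull_const]
  · split_ifs <;> simp
  · filter_upwards [eventually_det_ne_zero hx] with y hy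
    have h := congrFun (congrFun (Matrix.nonsing_inv_mul (xMat y) (Ne.isUnit hy)) l) j
    rw [Matrix.mul_apply, Matrix.one_apply] at h
    exact h

theorem isInverseJacobian (hx : (xMat x).det ≠ 0) :
    IsInverseJacobian dGerm (zGerm x) (xGerm x) where
  left i k := by simp only [dGerm_xGerm, sum_zGerm_mul hx]
  right l j := by simp only [dGerm_xGerm, sum_zGerm_mul' hx]

variable {u : Fin n ⊕ Fin m → MIdx n t → N}

/-- Obtained by varying `𝐱 · 𝐱⁻¹ = 1` for the matrices `(x^i_j)` and `(z^i_j)`. -/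
theorem vari_xMat_inv (hx : (xMat x).det ≠ 0) (j i : Fin n) :
    vari x u (fun y => (xMat y)⁻¹ j i) =
      -∑ k, ∑ l, (zGerm x j k * zGerm x l i) • vari x u (fun y => xMat y k l) := by
  have h0 : ∀ k, ∑ l, (pull x (fun y => xMat y k l) • vari x u (fun y => (xMat y)⁻¹ l i) +
      zGerm x l i • vari x u (fun y => xMat y k l)) = 0 := by
    intro k
    have h1 : vari x u (fun y => ∑ l, xMat y k l * (xMat y)⁻¹ l i) = 0 := by
      rw [vari_congr (g := fun _ => if k = i then 1 else 0), vari_const]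
      filter_upwards [eventually_det_ne_zero hx] with y hy
      have h := congrFun (congrFun (Matrix.mul_nonsing_inv (xMat y) (Ne.isUnit hy)) k) i
      rw [Matrix.mul_apply, Matrix.one_apply] at h
      exact h
    rw [vari_sum _ fun l _ =>
      (contDiff_xMat_apply _ _).contDiffAt.mul (contDiffAt_xMat_inv hx _ _)] at h1
    rw [← h1]
    exact Finset.sum_congr rfl fun l _ =>
      (vari_mul (contDiff_xMat_apply _ _).contDiffAt (contDiffAt_xMat_inv hx _ _)).symm
  have h2 : ∑ k, zGerm x j k • ∑ l, (pull x (fun y => xMat y k l) •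
      vari x u (fun y => (xMat y)⁻¹ l i) + zGerm x l i • vari x u (fun y => xMat y k l)) = 0 := by
    simp [h0]
  simp only [Finset.smul_sum, smul_add, Finset.sum_add_distrib, smul_smul] at h2
  rw [Finset.sum_comm] at h2
  simp only [← Finset.sum_smul, sum_zGerm_mul' hx] at h2
  simp only [ite_smul, one_smul, zero_smul, Finset.sum_ite_eq, Finset.mem_univ, if_true] at h2
  exact eq_neg_of_add_eq_zero_left h2

/-- Jacobi's formula: factor `det(𝐱 + c𝐞) = det(𝐱) det(1 + c 𝐱⁻¹𝐞)`; the linear term in `c` of the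
second factor is a trace. -/
theorem fderiv_det {y : Jet (Fin n ⊕ Fin m) n t} (hy : (xMat y).det ≠ 0)
    (e : Jet (Fin n ⊕ Fin m) n t) :
    fderiv ℝ (fun y : Jet (Fin n ⊕ Fin m) n t => (xMat y).det) y e =
      ∑ p : Fin n × Fin n, ((xMat y).det * (xMat y)⁻¹ p.2 p.1) *
        fderiv ℝ (fun y : Jet (Fin n ⊕ Fin m) n t => xMat y p.1 p.2) y e := by
  have h1 : ∀ p : Fin n × Fin n,
      fderiv ℝ (fun y : Jet (Fin n ⊕ Fin m) n t => xMat y p.1 p.2) y e = xMat e p.1 p.2 :=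
    fun p => fderiv_get _ _ _ _
  simp only [h1]
  rw [← ((contDiff_det_xMat (k := 1)).contDiffAt.differentiableAt (by simp)).lineDeriv_eq_fderiv]
  have h2 : ∀ c : ℝ, (xMat (y + c • e)).det =
      (xMat y).det * (1 + c • ((xMat y)⁻¹ * xMat e)).det := by
    intro c
    rw [← Matrix.det_mul, mul_add, mul_one, Matrix.mul_smul, ← mul_assoc,
      Matrix.mul_nonsing_inv _ (Ne.isUnit hy), one_mul, xMat_add, xMat_smul]
  have h3 : HasDerivAt (fun c : ℝ => (1 + c • ((xMat y)⁻¹ * xMat e)).det)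
      (((xMat y)⁻¹ * xMat e).trace) 0 := by
    obtain ⟨p, hp⟩ : ∃ p : Polynomial ℝ, ∀ c : ℝ, (1 + c • ((xMat y)⁻¹ * xMat e)).det =
        1 + ((xMat y)⁻¹ * xMat e).trace * c + p.eval c * c ^ 2 :=
      ⟨_, fun c => Matrix.det_one_add_smul c _⟩
    rw [funext hp]
    have h4 := (((hasDerivAt_id (0 : ℝ)).const_mul (((xMat y)⁻¹ * xMat e).trace)).const_add 1).add
      ((p.hasDerivAt 0).mul (hasDerivAt_pow 2 (0 : ℝ)))
    refine h4.congr_deriv ?_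
    simp
  unfold lineDeriv
  simp only [h2]
  rw [(h3.const_mul _).deriv, Matrix.trace]
  simp only [Matrix.diag_apply, Matrix.mul_apply, Finset.mul_sum]
  rw [Finset.sum_comm, Fintype.sum_prod_type]
  exact Finset.sum_congr rfl fun k _ => Finset.sum_congr rfl fun l _ => by ring

theorem vari_det (hx : (xMat x).det ≠ 0) : vari x u (fun y => (xMat y).det) =
    pull x (fun y => (xMat y).det) • ∑ k, ∑ l, zGerm x l k • vari x u (fun y => xMat y k l) := by
  rw [vari_of_fderiv (Finset.univ : Finset (Fin n × Fin n))
    (g := fun p y => (xMat y).det * (xMat y)⁻¹ p.2 p.1) (h := fun p y => xMat y p.1 p.2)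
    (fun p _ => contDiff_det_xMat.contDiffAt.mul (contDiffAt_xMat_inv hx _ _))
    (fun p _ => (contDiff_xMat_apply _ _).contDiffAt)]
  · simp only [Fintype.sum_prod_type, Finset.smul_sum, smul_smul]
    refine Finset.sum_congr rfl fun k _ => Finset.sum_congr rfl fun l _ => ?_
    rw [pull_mul contDiff_det_xMat.contDiffAt (contDiffAt_xMat_inv hx _ _)]
    rfl
  · filter_upwards [eventually_det_ne_zero hx] with y hy e
    exact fderiv_det hy e

theorem dGerm_det (hx : (xMat x).det ≠ 0) (j : Fin n) :
    dGerm j (pull x (fun y => (xMat y).det)) = pull x (fun y => (xMat y).det) *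
      ∑ i, ∑ k, zGerm x k i * dGerm j (dGerm k (xGerm x i)) := by
  rw [dGerm_pull_eq_vari contDiff_det_xMat.contDiffAt, vari_det hx, smul_eq_mul]
  congr 1
  refine Finset.sum_congr rfl fun i _ => Finset.sum_congr rfl fun k _ => ?_
  rw [smul_eq_mul, dGerm_xGerm, dGerm_pull_eq_vari (contDiff_xMat_apply _ _).contDiffAt]

theorem piola_det (hx : (xMat x).det ≠ 0) (i : Fin n) :
    ∑ j, dGerm j (pull x (fun y => (xMat y).det) * zGerm x j i) = 0 :=
  (isInverseJacobian hx).piola isConn_dGerm commuting_dGerm _ (dGerm_det hx) i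

theorem commuting_eGerm (hx : (xMat x).det ≠ 0) : Commuting (eGerm x) :=
  (isInverseJacobian hx).commuting isConn_dGerm commuting_dGerm isConn_dGerm commuting_dGerm

/-! ### The functions `y^σ_I` -/

theorem contDiffAt_yCoord (hx : (xMat x).det ≠ 0) (σ : Fin m) (I : List (Fin n)) :
    ContDiffAt ℝ ∞ (yCoord σ I) x := by
  induction I with
  | nil => exact (contDiff_get _ _).contDiffAt
  | cons i I ih =>
    exact ContDiffAt.sum fun j _ => (contDiffAt_xMat_inv hx _ _).mul (contDiffAt_formalD ih j)

theorem xMat_add_of_order {y u : Jet (Fin n ⊕ Fin m) n t} {r : ℕ} (hr : 1 ≤ r)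
    (hu : ∀ A (J : MIdx n t), J.1.card ≤ r → u A J = 0) : xMat (y + u) = xMat y := by
  ext i j
  exact hasOrder_get (Sum.inl i) {j} y u fun A J hJ =>
    hu A J (hJ.trans (by rw [Multiset.card_singleton]; exact hr))

theorem hasOrder_yCoord (σ : Fin m) (I : List (Fin n)) :
    HasOrder I.length (yCoord σ I : Jet (Fin n ⊕ Fin m) n t → ℝ) := by
  induction I with
  | nil => exact hasOrder_get _ 0
  | cons i I ih =>
    intro y u hu
    simp only [yCoord]
    refine Finset.sum_congr rfl fun j _ => ?_
    rw [xMat_add_of_order (by simp) hu, ih.formalD j y u hu]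

/-- The germ of `x^σ`. -/
def yGerm (x : Jet (Fin n ⊕ Fin m) n t) (σ : Fin m) : SmoothGerm n :=
  pull x (fun y => y.get (Sum.inr σ) 0)

theorem pull_yCoord (hx : (xMat x).det ≠ 0) (σ : Fin m) (I : List (Fin n)) :
    pull x (yCoord σ I) = iter (eGerm x) I (yGerm x σ) := by
  induction I with
  | nil => rfl
  | cons i I ih =>
    rw [iter_cons, ← ih, twist_apply]
    have h1 : yCoord σ (i :: I) = fun y : Jet (Fin n ⊕ Fin m) n t =>
      ∑ j, (xMat y)⁻¹ j i * formalD j (yCoord σ I) y := rfl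
    have hs := contDiffAt_yCoord hx σ I
    rw [h1, pull_sum _ fun j _ => (contDiffAt_xMat_inv hx _ _).mul (contDiffAt_formalD hs j)]
    refine Finset.sum_congr rfl fun j _ => ?_
    rw [pull_mul (contDiffAt_xMat_inv hx _ _) (contDiffAt_formalD hs j), dGerm_pull hs]
    rfl

theorem vari_jetOf_xMat (ht : 1 ≤ t) {D : Fin n → N →+ N} (w : Fin n ⊕ Fin m → N) (k l : Fin n) :
    vari x (jetOf t D w) (fun y => xMat y k l) = D l (w (Sum.inl k)) := by
  have h : ({l} : Multiset (Fin n)).card ≤ t := by rw [Multiset.card_singleton]; exact ht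
  have := vari_get (x := x) (u := jetOf t D w) (Sum.inl k) h
  change vari x (jetOf t D w) (fun y => y.get (Sum.inl k) {l}) = _
  rw [this, jetOf, iterM]
  simp

/-- The prolongation formula. -/
theorem vari_yCoord (hx : (xMat x).det ≠ 0) (ht : 1 ≤ t) {D : Fin n → N →+ N}
    (hD : IsConn dGerm D) (hc : Commuting D) (w : Fin n ⊕ Fin m → N) (σ : Fin m)
    (I : List (Fin n)) (hI : I.length ≤ t) :
    vari x (jetOf t D w) (yCoord σ I) =
      iter (twist (zGerm x) D) I (charac (fun σ i => eGerm x i (yGerm x σ)) w σ) +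
        ∑ k, iter (eGerm x) I (eGerm x k (yGerm x σ)) • w (Sum.inl k) := by
  induction I with
  | nil =>
    have h := vari_get (x := x) (u := jetOf t D w) (Sum.inr σ) (K := 0) (Nat.zero_le _)
    change vari x (jetOf t D w) (fun y => y.get (Sum.inr σ) 0) = _
    rw [h, jetOf, iterM]
    simp [charac]
  | cons i I ih =>
    rw [List.length_cons] at hI
    have hs := contDiffAt_yCoord hx σ I
    have h1 : yCoord σ (i :: I) = fun y : Jet (Fin n ⊕ Fin m) n t =>
      ∑ j, (xMat y)⁻¹ j i * formalD j (yCoord σ I) y := rfl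
    have h2 : vari x (jetOf t D w) (yCoord σ (i :: I)) =
        ∑ j, (zGerm x j i • D j (vari x (jetOf t D w) (yCoord σ I)) +
          dGerm j (pull x (yCoord σ I)) • vari x (jetOf t D w) (fun y => (xMat y)⁻¹ j i)) := by
      rw [h1, vari_sum _ fun j _ => (contDiffAt_xMat_inv hx _ _).mul (contDiffAt_formalD hs j)]
      refine Finset.sum_congr rfl fun j _ => ?_
      rw [vari_mul (contDiffAt_xMat_inv hx _ _) (contDiffAt_formalD hs j), ← dGerm_pull hs,
        vari_formalD hD hc w hs (hasOrder_yCoord σ I) (by omega)]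
      rfl
    -- The variation of `z^j_i` yields exactly the terms needed to cancel the derivatives of `w^k`
    -- that arise when the induction hypothesis is differentiated.
    have h3 : ∑ j, dGerm j (pull x (yCoord σ I)) •
        vari x (jetOf t D w) (fun y => (xMat y)⁻¹ j i) =
        -∑ k, eGerm x k (pull x (yCoord σ I)) • twist (zGerm x) D i (w (Sum.inl k)) := by
      simp only [vari_xMat_inv hx, smul_neg, Finset.sum_neg_distrib, vari_jetOf_xMat ht,
        twist_apply, Finset.smul_sum, smul_smul]
      congr 1
      rw [Finset.sum_comm]
      refine Finset.sum_congr rfl fun k _ => ?_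
      rw [Finset.sum_comm]
      refine Finset.sum_congr rfl fun l _ => ?_
      rw [Finset.sum_mul, Finset.sum_smul]
      refine Finset.sum_congr rfl fun j _ => ?_
      congr 1
      rw [smul_eq_mul]
      ring
    have hce := commuting_eGerm hx
    have h4 : ∀ k, eGerm x k (pull x (yCoord σ I)) =
        iter (eGerm x) I (eGerm x k (yGerm x σ)) := by
      intro k
      rw [pull_yCoord hx, ← iter_cons, hce.iter_perm _ (List.perm_append_singleton k I).symm,
        iter_append]
      rfl
    rw [h2, Finset.sum_add_distrib, h3, ← twist_apply, ih (by omega)]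
    simp only [map_add, map_sum, hD.twist _ _ _, Finset.sum_add_distrib, iter_cons, h4]
    abel

end Coordinates

/-! ## Functions on the Grassmann manifold -/

section Grassmann

variable {n m t : ℕ} {f : Gr n m t → ℝ} {g : Gr n m t}

/-- The vector `∂/∂y^σ_J`. -/
def grVec (ν : Fin m) (K : MIdx n t) : Gr n m t := (0, Pi.single ν (Pi.single K 1))

theorem pderY_eq_fderiv (ν : Fin m) (K : MIdx n t) (f : Gr n m t → ℝ) (g : Gr n m t) :
    pderY ν K.1 f g = fderiv ℝ f g (grVec ν K) := dif_pos K.2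

theorem fderiv_gr_eq_sum (f : Gr n m t → ℝ) (g e : Gr n m t) :
    fderiv ℝ f g e = ∑ i, e.1 i * fderiv ℝ f g (Pi.single i 1, 0) +
      ∑ ν, ∑ K : MIdx n t, e.2 ν K * pderY ν K.1 f g := by
  have h1 : e = ∑ i, e.1 i • ((Pi.single i 1, 0) : Gr n m t) +
      ∑ ν, ∑ K : MIdx n t, e.2 ν K • grVec ν K := by
    refine Prod.ext ?_ ?_
    · funext k
      simp [grVec, Prod.fst_sum, Finset.sum_apply, Pi.single_apply]
    · funext ν K
      simp only [Prod.snd_add, Prod.snd_sum, Prod.smul_snd, smul_zero, Finset.sum_const_zero,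
        zero_add, Finset.sum_apply, grVec, Pi.smul_apply, smul_eq_mul]
      rw [Finset.sum_eq_single ν, Finset.sum_eq_single K]
      · simp
      · intro K' _ hK
        simp [hK.symm]
      · simp
      · intro ν' _ hν
        simp [hν.symm]
      · simp
  conv_lhs => rw [h1]
  simp only [map_add, map_sum, map_smul, smul_eq_mul, pderY_eq_fderiv]

/-- The direction of the total derivative. -/
def grShift (i : Fin n) (g : Gr n m t) : Gr n m t := (Pi.single i 1, shift i g.2)

theorem grD_eq_fderiv (i : Fin n) (f : Gr n m t → ℝ) (g : Gr n m t) :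
    grD i f g = fderiv ℝ f g (grShift i g) := by
  rw [fderiv_gr_eq_sum, grD]
  congr 1
  · simp [grShift, Pi.single_apply]
  · refine Finset.sum_congr rfl fun ν _ => Finset.sum_congr rfl fun J _ => ?_
    split_ifs with h
    · rfl
    · have h0 : (grShift i g).2 ν J = 0 := Jet.get_of_lt _ _ (by rw [Multiset.card_cons]; omega)
      rw [h0, zero_mul]

theorem contDiffAt_grD (h : ContDiffAt ℝ ∞ f g) (i : Fin n) : ContDiffAt ℝ ∞ (grD i f) g := by
  rw [funext (grD_eq_fderiv i f)]
  exact (h.fderiv_right (m := ∞) (by norm_num)).clm_apply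
    (contDiffAt_const.prodMk ((contDiff_shift i).contDiffAt.comp g contDiffAt_snd))

theorem contDiffAt_grDs (h : ContDiffAt ℝ ∞ f g) (J : List (Fin n)) :
    ContDiffAt ℝ ∞ (grDs J f) g := by
  induction J with
  | nil => exact h
  | cons i J ih => exact contDiffAt_grD ih i

theorem contDiffAt_pderY (h : ContDiffAt ℝ ∞ f g) (ν : Fin m) (J : Multiset (Fin n)) :
    ContDiffAt ℝ ∞ (pderY ν J f) g := by
  unfold pderY
  split_ifs
  · exact (h.fderiv_right (m := ∞) (by norm_num)).clm_apply contDiffAt_const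
  · exact contDiffAt_const

theorem contDiffAt_grDel (h : ContDiffAt ℝ ∞ f g) (ν : Fin m) (J : List (Fin n)) :
    ContDiffAt ℝ ∞ (grDel ν J f) g := contDiffAt_const.mul (contDiffAt_pderY h ν _)

/-- The function `f` does not depend on the coordinates of order greater than `r`. -/
def HasGrOrder (r : ℕ) (f : Gr n m t → ℝ) : Prop :=
  ∀ (g : Gr n m t) (u : Jet (Fin m) n t), (∀ σ J, J.1.card ≤ r → u σ J = 0) →
    f (g + (0, u)) = f g

theorem HasGrOrder.pderY_eq_zero {r : ℕ} (h : HasGrOrder r f) (ν : Fin m) {J : Multiset (Fin n)}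
    (hJ : r < J.card) : pderY ν J f = fun _ => 0 := by
  funext g
  unfold pderY
  split_ifs with hJ'
  · apply fderiv_eq_zero_of_invariant
    intro c
    have : c • ((0, Pi.single ν (Pi.single ⟨J, hJ'⟩ 1)) : Gr n m t) =
        (0, c • Pi.single ν (Pi.single ⟨J, hJ'⟩ 1)) := by
      rw [Prod.smul_mk, smul_zero]
    rw [this]
    apply h
    intro B K hK
    have hne : K ≠ ⟨J, hJ'⟩ := by
      rintro rfl
      exact absurd hK (not_le.2 hJ)
    by_cases hB : B = ν
    · subst hB
      simp [hne]
    · simp [hB]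
  · rfl

theorem HasGrOrder.fderiv_add {r : ℕ} (h : HasGrOrder r f) {g : Gr n m t} {u : Jet (Fin m) n t}
    (hu : ∀ σ J, J.1.card ≤ r → u σ J = 0) : fderiv ℝ f (g + (0, u)) = fderiv ℝ f g := by
  rw [← fderiv_comp_add_right]
  congr 1
  funext z
  exact h z u hu

theorem HasGrOrder.pderY_add {r : ℕ} (h : HasGrOrder r f) {g : Gr n m t} {u : Jet (Fin m) n t}
    (hu : ∀ σ J, J.1.card ≤ r → u σ J = 0) (ν : Fin m) (J : Multiset (Fin n)) :
    pderY ν J f (g + (0, u)) = pderY ν J f g := by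
  unfold pderY
  rw [h.fderiv_add hu]

theorem HasGrOrder.grDel {r : ℕ} (h : HasGrOrder r f) (ν : Fin m) (J : List (Fin n)) :
    HasGrOrder r (grDel ν J f) := by
  intro g u hu
  unfold Velocity.grDel
  rw [h.pderY_add hu]

theorem HasGrOrder.grD {r : ℕ} (h : HasGrOrder r f) (i : Fin n) : HasGrOrder (r + 1) (grD i f) := by
  intro g u hu
  have hu' : ∀ A (J : MIdx n t), J.1.card ≤ r → u A J = 0 := fun A J hJ => hu A J (by omega)
  unfold Velocity.grD
  congr 1
  · rw [h.fderiv_add hu']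
  · refine Finset.sum_congr rfl fun A _ => Finset.sum_congr rfl fun J _ => ?_
    split_ifs
    · rw [h.pderY_add hu']
      by_cases hJ : J.1.card ≤ r
      · change (g.2 + u).get _ _ * _ = _
        rw [Jet.get_add, get_eq_zero hu A (J := i ::ₘ J.1) (by rw [Multiset.card_cons]; omega),
          add_zero]
      · rw [h.pderY_eq_zero A (not_le.1 hJ)]
        simp
    · rfl

theorem HasGrOrder.grDs {r : ℕ} (h : HasGrOrder r f) (J : List (Fin n)) :
    HasGrOrder (r + J.length) (grDs J f) := by
  induction J with
  | nil => exact h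
  | cons i J ih => exact ih.grD i

theorem hasGrOrder_trunc {s : ℕ} (f : Gr n m s → ℝ) :
    HasGrOrder s (fun g : Gr n m t => f (g.trunc s)) := by
  intro g u hu
  simp only [Gr.trunc, Prod.fst_add, Prod.snd_add, add_zero]
  congr 2
  funext A J
  simp only [Jet.trunc]
  rw [Jet.get_add, get_eq_zero hu A J.2, add_zero]

theorem hasOrder_trunc {ι : Type} [Fintype ι] [DecidableEq ι] {s : ℕ} (f : Jet ι n s → ℝ) :
    HasOrder s (fun x : Jet ι n t => f (x.trunc s)) := by
  intro g u hu
  simp only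
  congr 1
  funext A J
  simp only [Jet.trunc]
  rw [Jet.get_add, get_eq_zero hu A J.2, add_zero]

/-! ### Pulling back along the projection -/

variable {x : Jet (Fin n ⊕ Fin m) n t}

theorem contDiffAt_rho (hx : (xMat x).det ≠ 0) :
    ContDiffAt ℝ ∞ (rho : Jet (Fin n ⊕ Fin m) n t → Gr n m t) x :=
  (contDiffAt_pi.2 fun _ => (contDiff_get _ _).contDiffAt).prodMk
    (contDiffAt_pi.2 fun σ => contDiffAt_pi.2 fun _ => contDiffAt_yCoord hx σ _)

theorem fderiv_rho (hx : (xMat x).det ≠ 0) (e : Jet (Fin n ⊕ Fin m) n t) :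
    fderiv ℝ (rho : Jet (Fin n ⊕ Fin m) n t → Gr n m t) x e =
      (fun i => fderiv ℝ (fun y : Jet (Fin n ⊕ Fin m) n t => y.get (Sum.inl i) 0) x e,
        fun ν K => fderiv ℝ (yCoord ν (K.1.sort (· ≤ ·))) x e) := by
  have h1 : ∀ i, HasFDerivAt (fun y : Jet (Fin n ⊕ Fin m) n t => y.get (Sum.inl i) 0)
      (fderiv ℝ (fun y : Jet (Fin n ⊕ Fin m) n t => y.get (Sum.inl i) 0) x) x := fun i =>
    ((contDiff_get (k := 1) _ _).contDiffAt.differentiableAt (by simp)).hasFDerivAt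
  have h2 : ∀ ν (K : MIdx n t), HasFDerivAt (yCoord ν (K.1.sort (· ≤ ·)))
      (fderiv ℝ (yCoord ν (K.1.sort (· ≤ ·))) x) x := fun ν K =>
    ((contDiffAt_yCoord hx ν _).differentiableAt (by simp)).hasFDerivAt
  have h3 := (hasFDerivAt_pi.2 h1).prodMk
    (hasFDerivAt_pi.2 fun ν => hasFDerivAt_pi.2 fun K => h2 ν K)
  have h4 : fderiv ℝ (rho : Jet (Fin n ⊕ Fin m) n t → Gr n m t) x = _ := h3.fderiv
  rw [h4]
  rfl

theorem eventually_rho (hx : (xMat x).det ≠ 0) {p : Gr n m t → Prop}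
    (h : ∀ᶠ g in 𝓝 (rho x), p g) : ∀ᶠ y in 𝓝 x, p (rho y) :=
  (contDiffAt_rho hx).continuousAt.eventually h

variable {N : Type*} [AddCommGroup N] [Module (SmoothGerm n) N]
  {u : Fin n ⊕ Fin m → MIdx n t → N}

theorem vari_comp_rho (hx : (xMat x).det ≠ 0) (hf : ContDiffAt ℝ ∞ f (rho x)) :
    vari x u (fun y => f (rho y)) =
      ∑ i, pull x (fun y => fderiv ℝ f (rho y) (Pi.single i 1, 0)) •
        vari x u (fun y => y.get (Sum.inl i) 0) +
      ∑ ν, ∑ K : MIdx n t, pull x (fun y => pderY ν K.1 f (rho y)) •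
        vari x u (yCoord ν (K.1.sort (· ≤ ·))) := by
  have hs : ContDiffAt ℝ ∞ (fderiv ℝ f) (rho x) := hf.fderiv_right (m := ∞) (by norm_num)
  rw [vari_of_fderiv (Finset.univ : Finset (Fin n ⊕ (Fin m × MIdx n t)))
    (g := Sum.elim (fun i y => fderiv ℝ f (rho y) (Pi.single i 1, 0))
      (fun p y => pderY p.1 p.2.1 f (rho y)))
    (h := Sum.elim (fun i y => y.get (Sum.inl i) 0)
      (fun p => yCoord p.1 (p.2.1.sort (· ≤ ·))))]
  · rw [Fintype.sum_sum_type, Fintype.sum_prod_type]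
    rfl
  · rintro (i | p) _
    · exact (hs.comp x (contDiffAt_rho hx)).clm_apply contDiffAt_const
    · exact (contDiffAt_pderY hf _ _).comp x (contDiffAt_rho hx)
  · rintro (i | p) _
    · exact (contDiff_get _ _).contDiffAt
    · exact contDiffAt_yCoord hx _ _
  · filter_upwards [eventually_det_ne_zero hx,
      eventually_rho hx (ContDiffAt.eventually_differentiableAt hf)] with y hy hfy e
    have h1 : fderiv ℝ (fun y => f (rho y)) y = _ :=
      fderiv_comp y hfy ((contDiffAt_rho hy).differentiableAt (by simp))
    rw [h1, ContinuousLinearMap.comp_apply, fderiv_gr_eq_sum, fderiv_rho hy,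
      Fintype.sum_sum_type, Fintype.sum_prod_type]
    simp only [Sum.elim_inl, Sum.elim_inr, mul_comm]

theorem contDiffAt_comp_rho (hx : (xMat x).det ≠ 0) (hf : ContDiffAt ℝ ∞ f (rho x)) :
    ContDiffAt ℝ ∞ (fun y => f (rho y)) x := hf.comp x (contDiffAt_rho hx)

/-- Chain rule; since `e_i x^k = δ^k_i`, only one derivative in the base directions survives. -/
theorem eGerm_pull_rho (hx : (xMat x).det ≠ 0) (hf : ContDiffAt ℝ ∞ f (rho x)) (i : Fin n) :
    eGerm x i (pull x (fun y => f (rho y))) =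
      pull x (fun y => fderiv ℝ f (rho y) (Pi.single i 1, 0)) +
      ∑ ν, ∑ K : MIdx n t, pull x (fun y => pderY ν K.1 f (rho y)) *
        eGerm x i (pull x (yCoord ν (K.1.sort (· ≤ ·)))) := by
  have h1 : ∀ j, dGerm j (pull x (fun y => f (rho y))) =
      ∑ k, pull x (fun y => fderiv ℝ f (rho y) (Pi.single k 1, 0)) * dGerm j (xGerm x k) +
      ∑ ν, ∑ K : MIdx n t, pull x (fun y => pderY ν K.1 f (rho y)) *
        dGerm j (pull x (yCoord ν (K.1.sort (· ≤ ·)))) := by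
    intro j
    rw [dGerm_pull_eq_vari (contDiffAt_comp_rho hx hf), vari_comp_rho hx hf]
    simp only [xGerm, dGerm_pull_eq_vari (contDiff_get (ι := Fin n ⊕ Fin m) _ _).contDiffAt,
      dGerm_pull_eq_vari (contDiffAt_yCoord hx _ _), smul_eq_mul]
  have h2 : pull x (fun y => fderiv ℝ f (rho y) (Pi.single i 1, 0)) =
      ∑ k, pull x (fun y => fderiv ℝ f (rho y) (Pi.single k 1, 0)) *
        ∑ j, zGerm x j i * dGerm j (xGerm x k) := by
    simp only [(isInverseJacobian hx).left]
    simp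
  rw [h2]
  simp only [twist_apply, smul_eq_mul, h1, mul_add, Finset.sum_add_distrib, Finset.mul_sum]
  congr 1
  · rw [Finset.sum_comm]
    exact Finset.sum_congr rfl fun k _ => Finset.sum_congr rfl fun j _ => by ring
  · rw [Finset.sum_comm]
    refine Finset.sum_congr rfl fun k _ => ?_
    rw [Finset.sum_comm]
    exact Finset.sum_congr rfl fun j _ => Finset.sum_congr rfl fun l _ => by ring

theorem pull_yCoord_sort (hx : (xMat x).det ≠ 0) (σ : Fin m) (K : Multiset (Fin n)) :
    pull x (yCoord σ (K.sort (· ≤ ·))) = iterM (eGerm x) K (yGerm x σ) := pull_yCoord hx σ _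

/-- The derivation `e_i` is projected by `ρ` to `D_i`, because `e_i y^σ_K = y^σ_{iK}`. The total
derivative is cut off at order `t`, which is harmless for a function of order `r < t`. -/
theorem eGerm_pull_grD (hx : (xMat x).det ≠ 0) (hf : ContDiffAt ℝ ∞ f (rho x)) {r : ℕ}
    (hr : HasGrOrder r f) (hrt : r < t) (i : Fin n) :
    eGerm x i (pull x (fun y => f (rho y))) = pull x (fun y => grD i f (rho y)) := by
  have hs : ContDiffAt ℝ ∞ (fderiv ℝ f) (rho x) := hf.fderiv_right (m := ∞) (by norm_num)
  have hs1 : ContDiffAt ℝ ∞ (fun y : Jet (Fin n ⊕ Fin m) n t =>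
      fderiv ℝ f (rho y) (Pi.single i 1, 0)) x :=
    (hs.comp x (contDiffAt_rho hx)).clm_apply contDiffAt_const
  have hs2 : ∀ ν (K : MIdx n t), ContDiffAt ℝ ∞ (fun y : Jet (Fin n ⊕ Fin m) n t =>
      if K.1.card < t then (rho y).2.get ν (i ::ₘ K.1) * pderY ν K.1 f (rho y) else 0) x := by
    intro ν K
    split_ifs with h
    · exact ((contDiff_get ν _).contDiffAt.comp x
        (contDiffAt_snd.comp x (contDiffAt_rho hx))).mul
          (contDiffAt_comp_rho hx (contDiffAt_pderY hf ν _))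
    · exact contDiffAt_const
  rw [eGerm_pull_rho hx hf]
  unfold grD
  rw [pull_add hs1 (ContDiffAt.sum fun ν _ => ContDiffAt.sum fun K _ => hs2 ν K),
    pull_sum _ fun ν _ => ContDiffAt.sum fun K _ => hs2 ν K]
  congr 1
  refine Finset.sum_congr rfl fun ν _ => ?_
  rw [pull_sum _ fun K _ => hs2 ν K]
  refine Finset.sum_congr rfl fun K _ => ?_
  split_ifs with h
  · have h1 : (i ::ₘ K.1).card ≤ t := by
      rw [Multiset.card_cons]
      omega
    have h2 : (fun y : Jet (Fin n ⊕ Fin m) n t => (rho y).2.get ν (i ::ₘ K.1)) =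
        yCoord ν ((i ::ₘ K.1).sort (· ≤ ·)) := by
      funext y
      rw [Jet.get_of_le _ _ h1]
      rfl
    rw [pull_mul (by rw [h2]; exact contDiffAt_yCoord hx _ _)
      (contDiffAt_comp_rho hx (contDiffAt_pderY hf ν _)), h2, pull_yCoord_sort hx,
      pull_yCoord_sort hx, iterM_cons (commuting_eGerm hx), mul_comm]
  · rw [hr.pderY_eq_zero ν (hrt.trans_le (not_lt.1 h)), pull_zero, zero_mul]

/-- Every total derivative raises the order by one. For a function of order `s` and up to `s`
derivatives, this is where `t ≥ 2s` enters. -/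
theorem iter_eGerm_pull (hx : (xMat x).det ≠ 0) (hf : ContDiffAt ℝ ∞ f (rho x)) {r : ℕ}
    (hr : HasGrOrder r f) (J : List (Fin n)) (hrt : r + J.length ≤ t) :
    iter (eGerm x) J (pull x (fun y => f (rho y))) = pull x (fun y => grDs J f (rho y)) := by
  induction J with
  | nil => rfl
  | cons i J ih =>
    rw [List.length_cons] at hrt
    rw [iter_cons, ih (by omega), eGerm_pull_grD hx (contDiffAt_grDs hf J) (hr.grDs J) (by omega)]
    rfl

end Grassmann

/-! ### Linearization of a homogeneous equation -/

section Homogeneous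

variable {n m s t : ℕ} {x : Jet (Fin n ⊕ Fin m) n t}

/-- The regrouping behind the linearization of `det(𝐱) T_σ ∘ ρ`: the coefficient assembled in front
of `w^i` is the chain-rule expression of `e_i(T_σ ∘ ρ)`. -/
theorem smul_sum_chain_rule {R N ι κ μ : Type*} [CommRing R] [AddCommGroup N] [Module R N]
    [Fintype ι] [Fintype κ] [Fintype μ] (a b : R) (g : ι → R) (p : μ → κ → R) (q : μ → κ → N)
    (c : ι → μ → κ → R) (w e : ι → N) :
    a • (∑ i, g i • w i + ∑ ν, ∑ K, p ν K • (q ν K + ∑ k, c k ν K • w k)) + b • a • ∑ i, e i =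
      a • ∑ i, (b • e i + (g i + ∑ ν, ∑ K, p ν K * c i ν K) • w i) +
        a • ∑ ν, ∑ K, p ν K • q ν K := by
  have h : ∑ i, (∑ ν, ∑ K, p ν K * c i ν K) • w i =
      ∑ ν, ∑ K, p ν K • ∑ k, c k ν K • w k := by
    simp only [Finset.sum_smul, Finset.smul_sum, smul_smul]
    rw [Finset.sum_comm]
    exact Finset.sum_congr rfl fun ν _ => Finset.sum_comm
  simp only [smul_add, add_smul, Finset.sum_add_distrib, h, smul_comm b a, ← Finset.smul_sum]
  abel

/-- The weights compensate for the number of orderings of a multi-index, so that a weighted sum over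
sequences is a plain sum over multi-indices. -/
theorem weight_sum {N : Type*} [AddCommGroup N] [Module (SmoothGerm n) N] (hst : s ≤ t)
    (G : Multiset (Fin n) → N) (hG : ∀ K : MIdx n t, s < K.1.card → G K.1 = 0) :
    ∑ l ∈ Finset.range (s + 1), seqSum l (fun I : List (Fin n) =>
      constGerm (n := n) (weight (I : Multiset (Fin n))) • G (I : Multiset (Fin n))) =
    ∑ K : MIdx n t, G K.1 := by
  have h1 : ∀ l ∈ Finset.range (s + 1), seqSum l (fun I : List (Fin n) =>
      constGerm (n := n) (weight (I : Multiset (Fin n))) • G (I : Multiset (Fin n))) =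
      ∑ K : MIdx n t, constGerm (n := n) (seqSum l (fun I : List (Fin n) =>
        if (I : Multiset (Fin n)) = K.1 then weight K.1 else 0)) • G K.1 := by
    intro l hl
    rw [Finset.mem_range] at hl
    simp only [map_seqSum, seqSum_smul]
    rw [← seqSum_sum]
    refine seqSum_congr fun I hI => ?_
    rw [Finset.sum_eq_single (⟨(I : Multiset (Fin n)), by rw [Multiset.coe_card]; omega⟩ : MIdx n t)]
    · rw [if_pos rfl]
    · intro K _ hK
      rw [if_neg, map_zero, zero_smul]
      rintro h
      exact hK (Subtype.ext h.symm)
    · simp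
  rw [Finset.sum_congr rfl h1, Finset.sum_comm]
  refine Finset.sum_congr rfl fun K _ => ?_
  rw [← Finset.sum_smul, ← map_sum]
  by_cases hK : K.1.card ≤ s
  · rw [Finset.sum_eq_single K.1.card]
    · rw [seqSum_weight_indicator, map_one, one_smul]
    · intro l _ hl
      refine (seqSum_congr fun I hI => if_neg ?_).trans (seqSum_zero_fun (ι := Fin n) l)
      rintro h
      rw [← h, Multiset.coe_card] at hl
      exact hl hI.symm
    · intro h
      rw [Finset.mem_range] at h
      omega
  · rw [hG K (not_le.1 hK), smul_zero]

/-- The coefficients `∂^I_B 𝓣_A`. -/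
def velCoeff (x : Jet (Fin n ⊕ Fin m) n t) (F : Fin n ⊕ Fin m → Jet (Fin n ⊕ Fin m) n s → ℝ)
    (A B : Fin n ⊕ Fin m) (I : List (Fin n)) : SmoothGerm n :=
  pull x (del B I (fun y => F A (y.trunc s)))

/-- The coefficients `Δ^I_ν T_σ ∘ ρ`. -/
def grCoeff (x : Jet (Fin n ⊕ Fin m) n t) (T : Fin m → Gr n m s → ℝ) (σ ν : Fin m)
    (I : List (Fin n)) : SmoothGerm n :=
  pull x (fun y => grDel ν I (fun g => T σ (g.trunc s)) (rho y))

theorem isSymm_velCoeff (F : Fin n ⊕ Fin m → Jet (Fin n ⊕ Fin m) n s → ℝ)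
    (A B : Fin n ⊕ Fin m) : IsSymm (velCoeff x F A B) := by
  intro I K h
  unfold velCoeff
  congr 1
  funext y
  rw [del, del, Multiset.coe_eq_coe.2 h]

theorem isSymm_grCoeff (T : Fin m → Gr n m s → ℝ) (σ ν : Fin m) : IsSymm (grCoeff x T σ ν) := by
  intro I K h
  unfold grCoeff
  congr 1
  funext y
  rw [grDel, grDel, Multiset.coe_eq_coe.2 h]

/-- In a neighbourhood of `x`, the functions `F_A` are the components of the homogeneous equation
associated with the `T_σ`. -/
structure IsHomogeneousAt (x : Jet (Fin n ⊕ Fin m) n t)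
    (F : Fin n ⊕ Fin m → Jet (Fin n ⊕ Fin m) n s → ℝ) (T : Fin m → Gr n m s → ℝ) : Prop where
  order_pos : 1 ≤ s
  order_le : 2 * s ≤ t
  det_ne_zero : (xMat x).det ≠ 0
  smooth : ∀ σ, ContDiffAt ℝ ∞ (fun g : Gr n m t => T σ (g.trunc s)) (rho x)
  fibre : ∀ σ, (fun y => F (Sum.inr σ) (y.trunc s)) =ᶠ[𝓝 x]
    fun y => (xMat y).det * T σ ((rho y).trunc s)
  base : ∀ i, (fun y => F (Sum.inl i) (y.trunc s)) =ᶠ[𝓝 x]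
    fun y => -∑ σ, yCoord σ [i] y * ((xMat y).det * T σ ((rho y).trunc s))

variable {F : Fin n ⊕ Fin m → Jet (Fin n ⊕ Fin m) n s → ℝ} {T : Fin m → Gr n m s → ℝ}

/-- The germ of `T_σ ∘ ρ`. -/
def tGerm (x : Jet (Fin n ⊕ Fin m) n t) (T : Fin m → Gr n m s → ℝ) (σ : Fin m) : SmoothGerm n :=
  pull x (fun y => T σ ((rho y).trunc s))

/-- The germ of `det(𝐱)`. -/
def detGerm (x : Jet (Fin n ⊕ Fin m) n t) : SmoothGerm n := pull x (fun y => (xMat y).det)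

/-- The germ of `y^σ_i`. -/
def y1Germ (x : Jet (Fin n ⊕ Fin m) n t) (σ : Fin m) (i : Fin n) : SmoothGerm n :=
  eGerm x i (yGerm x σ)

namespace IsHomogeneousAt

variable (h : IsHomogeneousAt x F T)
include h

theorem contDiffAt_fibre (σ : Fin m) :
    ContDiffAt ℝ ∞ (fun y => (xMat y).det * T σ ((rho y).trunc s)) x :=
  contDiff_det_xMat.contDiffAt.mul (contDiffAt_comp_rho h.det_ne_zero (h.smooth σ))

theorem contDiffAt_expr (A : Fin n ⊕ Fin m) : ContDiffAt ℝ ∞ (fun y => F A (y.trunc s)) x := by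
  rcases A with i | σ
  · exact (ContDiffAt.sum fun σ _ => (contDiffAt_yCoord h.det_ne_zero σ [i]).mul
      (h.contDiffAt_fibre σ)).neg.congr_of_eventuallyEq (h.base i)
  · exact (h.contDiffAt_fibre σ).congr_of_eventuallyEq (h.fibre σ)

variable {N : Type*} [AddCommGroup N] [Module (SmoothGerm n) N]

/-- Identifies the operator with the coefficients `∂^I_B 𝓣_A` as the linearization of `𝓣_A`, to
which the calculus of variations of functions applies. The next lemma is the counterpart for `T_σ ∘
ρ`. -/
theorem opSum_velCoeff {D : Fin n → N →+ N} (hc : Commuting D) (w : Fin n ⊕ Fin m → N)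
    (A : Fin n ⊕ Fin m) :
    opSum s D (velCoeff x F A) w = vari x (jetOf t D w) (fun y => F A (y.trunc s)) := by
  unfold opSum vari
  refine Finset.sum_congr rfl fun B _ => ?_
  have hst : s ≤ t := by have := h.order_le; omega
  have h1 := weight_sum (N := N) hst (fun K => pull x (pder B K (fun y => F A (y.trunc s))) •
    iterM D K (w B)) (fun K hK => by
      rw [(hasOrder_trunc (t := t) (F A)).pder_eq_zero B hK, pull_zero, zero_smul])
  change _ = ∑ K : MIdx n t, pull x (pder B K.1 (fun y => F A (y.trunc s))) • iterM D K.1 (w B)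
  rw [← h1]
  refine Finset.sum_congr rfl fun l _ => seqSum_congr fun I _ => ?_
  rw [iterM_coe hc, smul_smul, ← pull_const_mul _ (contDiffAt_pder (h.contDiffAt_expr A) B _)]
  rfl

theorem opSum_grCoeff {D : Fin n → N →+ N} (hc : Commuting D) (w : Fin m → N) (σ : Fin m) :
    opSum s D (grCoeff x T σ) w = ∑ ν, ∑ K : MIdx n t,
      pull x (fun y => pderY ν K.1 (fun g : Gr n m t => T σ (g.trunc s)) (rho y)) •
        iterM D K.1 (w ν) := by
  unfold opSum
  refine Finset.sum_congr rfl fun B _ => ?_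
  have hst : s ≤ t := by have := h.order_le; omega
  have h1 := weight_sum (N := N) hst (fun K => pull x (fun y => pderY B K
    (fun g : Gr n m t => T σ (g.trunc s)) (rho y)) • iterM D K (w B)) (fun K hK => by
      rw [(hasGrOrder_trunc (t := t) (T σ)).pderY_eq_zero B hK, pull_zero, zero_smul])
  rw [← h1]
  refine Finset.sum_congr rfl fun l _ => seqSum_congr fun I _ => ?_
  rw [iterM_coe hc, smul_smul, ← pull_const_mul _ (contDiffAt_comp_rho h.det_ne_zero
    (contDiffAt_pderY (h.smooth σ) B _))]
  rfl

/-- For the fibre components, the variation of the determinant gives `det(𝐱) T_σ e_k w^k`, and that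
of `T_σ ∘ ρ` gives, by the prolongation formula, `ℓ_σ(Q) + e_k(T_σ) w^k`. The terms with `w^k` add
up to `det(𝐱) e_k(T_σ w^k)`, a total divergence by Piola. The base components need only the product
rule and the prolongation formula for `y^σ_i`. -/
theorem isVariation (D : Fin n → N →+ N) (hD : IsConn dGerm D) (hc : Commuting D)
    (w : Fin n ⊕ Fin m → N) :
    IsVariation dGerm D (zGerm x) (y1Germ x) (detGerm x) (tGerm x T) w
      (fun A => opSum s D (velCoeff x F A) w)
      (fun σ => opSum s (twist (zGerm x) D) (grCoeff x T σ) (charac (y1Germ x) w)) := by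
  have hx := h.det_ne_zero
  have ht : 1 ≤ t := by have := h.order_le; have := h.order_pos; omega
  have hce := commuting_eGerm hx
  have hcE : Commuting (twist (zGerm x) D) :=
    (isInverseJacobian hx).commuting isConn_dGerm commuting_dGerm hD hc
  have hf : ∀ σ, pull x (fun y => (xMat y).det * T σ ((rho y).trunc s)) =
      detGerm x * tGerm x T σ := fun σ =>
    pull_mul contDiff_det_xMat.contDiffAt (contDiffAt_comp_rho hx (h.smooth σ))
  constructor
  · intro σ
    simp only [h.opSum_velCoeff hc, h.opSum_grCoeff hcE]
    rw [vari_congr (h.fibre σ), vari_mul contDiff_det_xMat.contDiffAt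
      (contDiffAt_comp_rho hx (h.smooth σ)), vari_det hx, vari_comp_rho hx (h.smooth σ)]
    have e1 : ∑ k, ∑ l, zGerm x l k • vari x (jetOf t D w) (fun y => xMat y k l) =
        ∑ k, twist (zGerm x) D k (w (Sum.inl k)) := by
      simp only [vari_jetOf_xMat ht, twist_apply]
    have e2 : ∀ i, vari x (jetOf t D w) (fun y => y.get (Sum.inl i) 0) = w (Sum.inl i) := by
      intro i
      rw [vari_get (Sum.inl i) (K := 0) (Nat.zero_le _)]
      simp [jetOf, iterM]
    have e3 : ∀ ν (K : MIdx n t), vari x (jetOf t D w) (yCoord ν (K.1.sort (· ≤ ·))) =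
        iterM (twist (zGerm x) D) K.1 (charac (y1Germ x) w ν) +
          ∑ k, eGerm x k (pull x (yCoord ν (K.1.sort (· ≤ ·)))) • w (Sum.inl k) := by
      intro ν K
      rw [vari_yCoord hx ht hD hc w ν _ (by rw [Multiset.length_sort]; exact K.2)]
      congr 1
      refine Finset.sum_congr rfl fun k _ => ?_
      rw [pull_yCoord hx, ← iter_cons, hce.iter_perm _ (List.perm_append_singleton k _).symm,
        iter_append]
      rfl
    have e4 : ∑ j, D j (∑ i, (detGerm x * tGerm x T σ * zGerm x j i) • w (Sum.inl i)) =
        detGerm x • ∑ i, twist (zGerm x) D i (tGerm x T σ • w (Sum.inl i)) := by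
      simp only [map_sum]
      rw [Finset.sum_comm, Finset.smul_sum]
      refine Finset.sum_congr rfl fun i _ => ?_
      have e5 : ∀ j, D j ((detGerm x * tGerm x T σ * zGerm x j i) • w (Sum.inl i)) =
          (detGerm x * zGerm x j i) • D j (tGerm x T σ • w (Sum.inl i)) +
            dGerm j (detGerm x * zGerm x j i) • (tGerm x T σ • w (Sum.inl i)) := by
        intro j
        rw [← hD, smul_smul, mul_right_comm]
      simp only [e5, Finset.sum_add_distrib]
      rw [← Finset.sum_smul, detGerm, piola_det hx, zero_smul, add_zero, twist_apply,
        Finset.smul_sum]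
      simp only [smul_smul]
    rw [e4]
    simp only [e1, e2, e3, hD.twist _ _ _]
    have e6 : ∀ i, eGerm x i (tGerm x T σ) = _ := fun i => eGerm_pull_rho hx (h.smooth σ) i
    simp only [e6]
    exact smul_sum_chain_rule _ _ _ _ _ (fun i ν (K : MIdx n t) => eGerm x i
      (pull x (yCoord ν (K.1.sort (· ≤ ·))))) _ _
  · intro i
    simp only [h.opSum_velCoeff hc]
    have hs := fun σ => (contDiffAt_yCoord hx σ [i]).mul (h.contDiffAt_fibre σ)
    rw [vari_congr (h.base i), vari_neg (ContDiffAt.sum fun σ _ => hs σ), vari_sum _ fun σ _ => hs σ]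
    congr 1
    refine Finset.sum_congr rfl fun σ _ => ?_
    rw [vari_mul (contDiffAt_yCoord hx σ [i]) (h.contDiffAt_fibre σ), hf, pull_yCoord hx,
      ← vari_congr (h.fibre σ), vari_yCoord hx ht hD hc w σ [i] (by simpa using ht)]
    rfl

/-- The Helmholtz operators of the two equations. -/
theorem helmholtz_germ (v : Fin n ⊕ Fin m → SmoothGerm n) :
    (∀ σ, evGerm (opSum s dGerm (helmholtzCoeff s dGerm (velCoeff x F) (Sum.inr σ)) v) =
      evGerm (detGerm x * opSum s (eGerm x) (helmholtzCoeff s (eGerm x) (grCoeff x T) σ)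
        (charac (y1Germ x) v))) ∧
    (∀ i, evGerm (opSum s dGerm (helmholtzCoeff s dGerm (velCoeff x F) (Sum.inl i)) v) =
      -evGerm (detGerm x * ∑ σ, y1Germ x σ i * opSum s (eGerm x)
        (helmholtzCoeff s (eGerm x) (grCoeff x T) σ) (charac (y1Germ x) v))) := by
  have hy : ∀ σ i k, twist (zGerm x) dGerm i (y1Germ x σ k) =
      twist (zGerm x) dGerm k (y1Germ x σ i) := fun σ i k => commuting_eGerm h.det_ne_zero i k _
  have hJ : ∀ i, ∑ j, dGerm j (detGerm x * zGerm x j i) = 0 := piola_det h.det_ne_zero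
  exact helmholtz_operator (d := dGerm) (z := zGerm x) (J := detGerm x) (y := y1Germ x)
    (T := tGerm x T) (b := velCoeff x F) (a := grCoeff x T) isConn_dGerm commuting_dGerm
    (isInverseJacobian h.det_ne_zero) hJ hy s (isSymm_velCoeff F) (isSymm_grCoeff T)
    (fun D hD hc w => h.isVariation D hD hc w) evGerm v

end IsHomogeneousAt

end Homogeneous

/-! ### Extraction of the coefficients of an operator by polynomial test functions -/

section Extraction

variable {n m s t : ℕ}

/-! ### Polynomial test functions -/

/-- The coordinate `τ^i` on the source. -/
def coordGerm (i : Fin n) : SmoothGerm n := germ fun τ => τ i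

theorem dGerm_coordGerm (i j : Fin n) :
    dGerm j (coordGerm i) = if j = i then 1 else 0 := by
  have h1 : ContDiffAt ℝ ∞ (fun τ : Fin n → ℝ => τ i) 0 := (contDiff_apply ℝ ℝ i).contDiffAt
  rw [coordGerm, dGerm_germ h1]
  have h2 : pd j (fun τ : Fin n → ℝ => τ i) = fun _ => if j = i then (1 : ℝ) else 0 := by
    funext τ
    rw [pd, (hasFDerivAt_apply (𝕜 := ℝ) i τ).fderiv]
    simp [Pi.single_apply, eq_comm]
  rw [h2, ← constGerm_apply]
  split_ifs
  · exact map_one _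
  · exact map_zero _

/-- The germ of `(r₁! ⋯ r_n! / k!) τ^K / K!`. -/
def testGerm (K : Multiset (Fin n)) : SmoothGerm n := constGerm (weight K) * germ (monom K)

theorem testGerm_zero : testGerm (0 : Multiset (Fin n)) = 1 := by
  have h1 : germ (monom (0 : Multiset (Fin n))) = 1 := by
    rw [show monom (0 : Multiset (Fin n)) = fun _ => 1 from funext monom_zero_left,
      ← constGerm_apply, map_one]
  simp [testGerm, h1, weight]

theorem iter_dGerm_monom (J : List (Fin n)) (K : Multiset (Fin n)) :
    evGerm (iter dGerm J (germ (monom K))) = if (J : Multiset (Fin n)) = K then 1 else 0 := by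
  induction J using List.reverseRecOn generalizing K with
  | nil =>
    rw [iter_nil, evGerm_germ (contDiff_monom K).contDiffAt, monom_zero_right]
    simp [eq_comm]
  | append_singleton J i ih =>
    rw [iter_append, iter_cons, iter_nil, dGerm_germ (contDiff_monom K).contDiffAt]
    by_cases hi : i ∈ K
    · have h1 : pd i (monom K) = monom (K.erase i) := funext fun τ => by rw [pd_monom, if_pos hi]
      rw [h1, ih]
      have h2 : ((J ++ [i] : List (Fin n)) : Multiset (Fin n)) = i ::ₘ (J : Multiset (Fin n)) := by
        rw [Multiset.cons_coe, Multiset.coe_eq_coe]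
        exact List.perm_append_singleton i J
      rw [h2]
      congr 1
      rw [eq_iff_iff]
      constructor
      · intro h
        rw [h, Multiset.cons_erase hi]
      · intro h
        rw [← h, Multiset.erase_cons_head]
    · have h1 : pd i (monom K) = fun _ => 0 := funext fun τ => by rw [pd_monom, if_neg hi]
      rw [h1, ← constGerm_apply, map_zero, iter_zero, map_zero, if_neg]
      rintro rfl
      exact hi (by simp)

theorem iter_dGerm_testGerm (J : List (Fin n)) (K : Multiset (Fin n)) :
    evGerm (iter dGerm J (testGerm K)) = if (J : Multiset (Fin n)) = K then weight K else 0 := by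
  have h : ∀ (c : ℝ) (a : SmoothGerm n), iter dGerm J (constGerm c * a) =
      constGerm c * iter dGerm J a := by
    intro c a
    induction J with
    | nil => rfl
    | cons i J ih =>
      rw [iter_cons, ih, isConn_dGerm.mul, constGerm_apply, dGerm_germ contDiffAt_const]
      have h1 : pd i (fun _ : Fin n → ℝ => c) = fun _ => 0 := by
        funext τ
        simp [pd]
      rw [h1, ← constGerm_apply (0 : ℝ), map_zero, zero_mul, add_zero]
      rfl
  rw [testGerm, h, map_mul, evGerm_const, iter_dGerm_monom, mul_ite, mul_one, mul_zero]

/-- Only the rearrangements of `J` contribute; on them `c` is constant and the weights add up to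
one. Symmetry is indispensable, as an operator determines only the symmetric part of its
coefficients. -/
theorem sum_iter_testGerm {c : List (Fin n) → ℝ} (hc : IsSymm c) (J : List (Fin n))
    (hJ : J.length ≤ s) :
    ∑ l ∈ Finset.range (s + 1), seqSum l (fun I =>
      c I * evGerm (iter dGerm I (testGerm (J : Multiset (Fin n))))) = c J := by
  rw [Finset.sum_eq_single J.length]
  · have h := seqSum_weight_indicator (J : Multiset (Fin n))
    rw [Multiset.coe_card] at h
    rw [← mul_one (c J), ← h, ← smul_eq_mul, smul_seqSum]
    refine seqSum_congr fun I _ => ?_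
    rw [iter_dGerm_testGerm]
    split_ifs with hI
    · rw [hc I J (Multiset.coe_eq_coe.1 hI), smul_eq_mul]
    · rw [mul_zero, smul_zero]
  · intro l _ hl
    refine (seqSum_congr fun I hI => ?_).trans (seqSum_zero_fun (ι := Fin n) l)
    rw [iter_dGerm_testGerm, if_neg, mul_zero]
    intro h
    have := (Multiset.coe_eq_coe.1 h).length_eq
    omega
  · intro h
    rw [Finset.mem_range] at h
    omega

/-! ### The symmetrization projector -/

/-- Both sequences have the same monotone rearrangement; compose the two sorting permutations. -/
theorem exists_perm_of_ofFn_perm {k : ℕ} {f g : Fin k → Fin n}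
    (h : (List.ofFn f).Perm (List.ofFn g)) : ∃ π : Equiv.Perm (Fin k), f = g ∘ π := by
  have h1 : (List.ofFn (f ∘ Tuple.sort f)).Perm (List.ofFn (g ∘ Tuple.sort g)) :=
    ((Tuple.sort f).ofFn_comp_perm f).trans (h.trans ((Tuple.sort g).ofFn_comp_perm g).symm)
  have h2 : f ∘ Tuple.sort f = g ∘ Tuple.sort g := List.ofFn_injective
    (h1.eq_of_pairwise' (Tuple.monotone_sort f).sortedLE_ofFn.pairwise
      (Tuple.monotone_sort g).sortedLE_ofFn.pairwise)
  refine ⟨(Tuple.sort f).symm.trans (Tuple.sort g), ?_⟩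
  funext a
  have := congrFun h2 ((Tuple.sort f).symm a)
  simpa using this

/-- The weight is invariant under permutations, so `f` may be replaced by its average over them. The
average is constant on the rearrangements of `j`, whose total weight is one. -/
theorem sum_weight_eq_symmetrize {k : ℕ} (f : (Fin k → Fin n) → ℝ) (j : Fin k → Fin n) :
    ∑ j' : Fin k → Fin n, f j' * (if (List.ofFn j' : Multiset (Fin n)) = List.ofFn j then
      weight (List.ofFn j : Multiset (Fin n)) else 0) = symmetrize f j := by
  set w : (Fin k → Fin n) → ℝ := fun j' => if (List.ofFn j' : Multiset (Fin n)) = List.ofFn j then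
      weight (List.ofFn j : Multiset (Fin n)) else 0 with hw
  have hinv : ∀ π : Equiv.Perm (Fin k),
      ∑ j', f j' * w j' = ∑ j', f (fun a => j' (π a)) * w j' := by
    intro π
    rw [← (Equiv.arrowCongr π.symm (Equiv.refl (Fin n))).sum_comp]
    refine Finset.sum_congr rfl fun j' _ => ?_
    have h1 : (Equiv.arrowCongr π.symm (Equiv.refl (Fin n))) j' = j' ∘ π := rfl
    have h2 : w (j' ∘ π) = w j' := by
      simp only [hw, Multiset.coe_eq_coe.2 (π.ofFn_comp_perm j')]
    rw [h1, h2]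
    rfl
  have hk : (k.factorial : ℝ) ≠ 0 := Nat.cast_ne_zero.2 k.factorial_ne_zero
  have hsum : ∑ j', w j' = 1 := by
    have := seqSum_weight_indicator (List.ofFn j : Multiset (Fin n))
    rw [Multiset.coe_card, List.length_ofFn] at this
    exact this
  have h3 : (k.factorial : ℝ) * ∑ j', f j' * w j' =
      ∑ j', (∑ π : Equiv.Perm (Fin k), f (fun a => j' (π a))) * w j' := by
    simp only [Finset.sum_mul]
    rw [Finset.sum_comm, Finset.sum_congr rfl fun π _ => (hinv π).symm, Finset.sum_const,
      Finset.card_univ, Fintype.card_perm, Fintype.card_fin, nsmul_eq_mul]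
  rw [symmetrize, eq_div_iff hk, mul_comm, h3,
    ← mul_one (∑ π : Equiv.Perm (Fin k), f fun a => j (π a)), ← hsum, Finset.mul_sum]
  refine Finset.sum_congr rfl fun j' _ => ?_
  by_cases hj : (List.ofFn j' : Multiset (Fin n)) = List.ofFn j
  · obtain ⟨π, rfl⟩ := exists_perm_of_ofFn_perm (Multiset.coe_eq_coe.1 hj)
    congr 1
    exact Equiv.sum_comp (Equiv.mulLeft π) (fun ψ : Equiv.Perm (Fin k) => f fun a => j (ψ a))
  · have h4 : w j' = 0 := if_neg hj
    rw [h4, mul_zero, mul_zero]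

/-! ### The functions `z^i_I` -/

variable {x : Jet (Fin n ⊕ Fin m) n t}

theorem contDiffAt_zCoord (hx : (xMat x).det ≠ 0) (i : Fin n) (I : List (Fin n)) :
    ContDiffAt ℝ ∞ (zCoord i I) x := by
  match I with
  | [] => exact contDiffAt_const
  | [j] => exact contDiffAt_xMat_inv hx i j
  | j :: k :: J =>
    exact ContDiffAt.sum fun p _ => (contDiffAt_xMat_inv hx _ _).mul
      (contDiffAt_formalD (contDiffAt_zCoord hx i (k :: J)) p)

theorem eGerm_coordGerm (i j : Fin n) : eGerm x i (coordGerm j) = zGerm x j i := by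
  rw [eGerm, twist_apply]
  simp [dGerm_coordGerm]

theorem pull_zCoord (hx : (xMat x).det ≠ 0) (i : Fin n) {I : List (Fin n)} (hI : I ≠ []) :
    pull x (zCoord i I) = iter (eGerm x) I (coordGerm i) := by
  match I with
  | [] => exact absurd rfl hI
  | [j] => rw [iter_cons, iter_nil, eGerm_coordGerm]; rfl
  | j :: k :: J =>
    rw [iter_cons, ← pull_zCoord hx i (List.cons_ne_nil k J), eGerm, twist_apply]
    have h1 : zCoord i (j :: k :: J) = fun y : Jet (Fin n ⊕ Fin m) n t =>
      ∑ p, (xMat y)⁻¹ p j * formalD p (zCoord i (k :: J)) y := rfl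
    have hs := contDiffAt_zCoord hx i (k :: J)
    rw [h1, pull_sum _ fun p _ => (contDiffAt_xMat_inv hx _ _).mul (contDiffAt_formalD hs p)]
    refine Finset.sum_congr rfl fun p _ => ?_
    rw [pull_mul (contDiffAt_xMat_inv hx _ _) (contDiffAt_formalD hs p), dGerm_pull hs]
    rfl

theorem ofFn_comp_emb_ne_nil {l : ℕ} (c : OrderedFinpartition l) (I : Fin l → Fin n)
    (a : Fin c.length) : List.ofFn (I ∘ c.emb a) ≠ [] := by
  intro h
  have h1 := congrArg List.length h
  rw [List.length_ofFn, List.length_nil] at h1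
  have := c.partSize_pos a
  omega

theorem evGerm_iter_zCoord (hx : (xMat x).det ≠ 0) (i : Fin n) {I : List (Fin n)} (hI : I ≠ []) :
    evGerm (iter (eGerm x) I (coordGerm i)) = zCoord i I x := by
  rw [← pull_zCoord hx i hI, evGerm_pull (contDiffAt_zCoord hx i I)]

theorem evGerm_iter_yCoord (hx : (xMat x).det ≠ 0) (σ : Fin m) (I : List (Fin n)) :
    evGerm (iter (eGerm x) I (yGerm x σ)) = yCoord σ I x := by
  rw [← pull_yCoord hx, evGerm_pull (contDiffAt_yCoord hx σ I)]

/-- The derivatives of the test functions along the fields `D_i`. -/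
theorem evGerm_iter_testGerm (hx : (xMat x).det ≠ 0) {k l : ℕ} (I : Fin l → Fin n)
    (j : Fin k → Fin n) :
    evGerm (iter (eGerm x) (List.ofFn I) (testGerm (List.ofFn j : Multiset (Fin n)))) =
      zSum j I x := by
  -- Faà di Bruno for `e_i = (e_i τ^j) ∂_j`, where `e_i τ^j = z^j_i`. At `0` only the partitions
  -- into `k` blocks survive, since the test function is a monomial of degree `k`.
  rw [iter_eq_sum_partitions (d := eGerm x) isConn_dGerm.twist coordGerm (e := dGerm)
    (fun i f => by simp only [eGerm_coordGerm]; exact twist_apply _ _ _ _), map_sum, zSum]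
  refine Finset.sum_congr rfl fun c _ => ?_
  rw [map_sum]
  simp only [map_mul, map_prod, iter_dGerm_testGerm]
  have h1 : ∀ (j' : Fin c.length → Fin n) a, evGerm (iter (eGerm x)
      (List.ofFn (I ∘ c.emb a)) (coordGerm (j' a))) = zCoord (j' a) (List.ofFn (I ∘ c.emb a)) x :=
    fun j' a => evGerm_iter_zCoord hx (j' a) (ofFn_comp_emb_ne_nil c I a)
  simp only [h1]
  split_ifs with h
  · subst h
    exact sum_weight_eq_symmetrize
      (fun j' => ∏ a, zCoord (j' a) (List.ofFn (I ∘ c.emb a)) x) j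
  · refine Finset.sum_eq_zero fun j' _ => ?_
    rw [if_neg, mul_zero]
    intro h2
    have := (Multiset.coe_eq_coe.1 h2).length_eq
    simp only [List.length_ofFn] at this
    exact h this

theorem zSum_eq_zero {k l : ℕ} (h : l < k) (j : Fin k → Fin n) (I : Fin l → Fin n) :
    zSum j I x = 0 := by
  refine Finset.sum_eq_zero fun c _ => dif_neg ?_
  have := c.length_le
  omega

/-- `𝐳 · 𝐱 = e`. -/
theorem zCoord_comp (hx : (xMat x).det ≠ 0) (i : Fin n) {l : ℕ} (I : Fin l → Fin n) (hl : 1 ≤ l)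
    (hlt : l ≤ t) :
    ∑ c : OrderedFinpartition l, ∑ j : Fin c.length → Fin n,
      (∏ a, x.get (Sum.inl (j a)) (List.ofFn (I ∘ c.emb a) : List (Fin n))) *
        zCoord i (List.ofFn j) x = if List.ofFn I = [i] then 1 else 0 := by
  -- Faà di Bruno with the derivations interchanged, `∂_i = (∂_i x^j) e_j`, applied to the source
  -- coordinate `τ^i`. Its derivatives along the `e_j` are the `z^i_J`, and its ordinary derivatives
  -- are trivial.
  have h := congrArg evGerm (iter_eq_sum_partitions isConn_dGerm (xGerm x) (e := eGerm x)
    (fun i f => by rw [(isInverseJacobian hx).eq_sum_twist]; rfl) I (coordGerm i))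
  rw [map_sum] at h
  simp only [map_sum, map_mul, map_prod] at h
  have h1 : ∀ (k : Fin n) (J : List (Fin n)), evGerm (iter dGerm J (xGerm x k)) =
      x.get (Sum.inl k) (J : Multiset (Fin n)) := by
    intro k J
    rw [xGerm, iter_dGerm_pull (contDiff_get _ _).contDiffAt,
      evGerm_pull (contDiffAt_formalDs (contDiff_get _ _).contDiffAt J)]
    clear hx h
    revert x
    suffices h2 : formalDs J (fun x : Jet (Fin n ⊕ Fin m) n t => x.get (Sum.inl k) 0) =
        fun x => x.get (Sum.inl k) (J : Multiset (Fin n)) from fun {x} => congrFun h2 x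
    induction J with
    | nil => rfl
    | cons i J ih =>
      change formalD i (formalDs J _) = _
      rw [ih]
      funext x
      rw [formalD_get]
      rfl
  simp only [h1] at h
  have h2 : ∀ (c : OrderedFinpartition l) (j : Fin c.length → Fin n),
      evGerm (iter (eGerm x) (List.ofFn j) (coordGerm i)) = zCoord i (List.ofFn j) x := by
    intro c j
    refine evGerm_iter_zCoord hx i fun h3 => ?_
    have h4 := congrArg List.length h3
    rw [List.length_ofFn, List.length_nil] at h4
    have := c.length_pos (by omega)
    omega
  simp only [h2] at h
  rw [← h]
  obtain ⟨l, rfl⟩ : ∃ l', l = l' + 1 := ⟨l - 1, by omega⟩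
  rw [List.ofFn_succ']
  rw [List.concat_eq_append, iter_append, iter_cons, iter_nil, dGerm_coordGerm]
  rcases Nat.eq_zero_or_pos l with rfl | hl
  · simp only [List.ofFn_zero, iter_nil, List.nil_append, List.cons.injEq, and_true]
    split_ifs <;> simp
  · rw [if_neg (c := _ ++ [I (Fin.last l)] = [i]) (by
      intro h
      have := congrArg List.length h
      simp only [List.length_append, List.length_ofFn, List.length_singleton] at this
      omega)]
    have h5 : ∀ c : ℝ, iter dGerm (List.ofFn fun i : Fin l => I i.castSucc)
        (constGerm (n := n) c) = 0 := by
      intro c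
      obtain ⟨l, rfl⟩ : ∃ l', l = l' + 1 := ⟨l - 1, by omega⟩
      rw [List.ofFn_succ', List.concat_eq_append, iter_append, iter_cons, iter_nil,
        constGerm_apply, dGerm_germ contDiffAt_const]
      have h1 : pd (I (Fin.last l).castSucc) (fun _ : Fin n → ℝ => c) = fun _ => 0 := by
        funext τ
        simp [pd]
      rw [h1, ← constGerm_apply (0 : ℝ), map_zero, iter_zero]
    split_ifs
    · rw [← map_one (constGerm (n := n)), h5, map_zero]
    · rw [iter_zero, map_zero]

end Extraction

/-! ### The eight formulas at a point -/

section Formulas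

variable {n m s t : ℕ} {x : Jet (Fin n ⊕ Fin m) n t}
  {F : Fin n ⊕ Fin m → Jet (Fin n ⊕ Fin m) n s → ℝ} {T : Fin m → Gr n m s → ℝ}

theorem isSymm_helmholtz (A B : Fin n ⊕ Fin m) : IsSymm fun J => helmholtz s t F A B J x := by
  intro I J h
  have h1 : ∀ (f : Jet (Fin n ⊕ Fin m) n t → ℝ) (A : Fin n ⊕ Fin m) (K : List (Fin n)),
      del A (I ++ K) f = del A (J ++ K) f := by
    intro f A K
    funext y
    rw [del, del, Multiset.coe_eq_coe.2 (h.append_right K)]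
  have h2 := h1 (fun x' => F A (x'.trunc s)) B []
  simp only [List.append_nil] at h2
  simp only [helmholtz, lieEuler, h1, h2, h.length_eq]

theorem isSymm_grHelmholtz (σ ν : Fin m) (g : Gr n m t) :
    IsSymm fun J => grHelmholtz s t T σ ν J g := by
  intro I J h
  have h1 : ∀ (f : Gr n m t → ℝ) (ν : Fin m) (K : List (Fin n)),
      grDel ν (I ++ K) f = grDel ν (J ++ K) f := by
    intro f A K
    funext y
    rw [grDel, grDel, Multiset.coe_eq_coe.2 (h.append_right K)]
  have h2 := h1 (fun x' => T σ (x'.trunc s)) ν []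
  simp only [List.append_nil] at h2
  simp only [grHelmholtz, grLieEuler, h1, h2, h.length_eq]

namespace IsHomogeneousAt

variable (h : IsHomogeneousAt x F T)
include h

theorem contDiffAt_del (A B : Fin n ⊕ Fin m) (J : List (Fin n)) :
    ContDiffAt ℝ ∞ (del B J fun x' => F A (x'.trunc s)) x :=
  contDiffAt_const.mul (contDiffAt_pder (h.contDiffAt_expr A) B _)

theorem evGerm_velCoeff (A B : Fin n ⊕ Fin m) (J K : List (Fin n)) :
    evGerm (iter dGerm K (velCoeff x F A B J)) =
      formalDs K (del B J fun x' => F A (x'.trunc s)) x := by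
  rw [velCoeff, iter_dGerm_pull (h.contDiffAt_del A B J),
    evGerm_pull (contDiffAt_formalDs (h.contDiffAt_del A B J) K)]

theorem evGerm_grCoeff (σ ν : Fin m) (J K : List (Fin n)) (hK : K.length ≤ s) :
    evGerm (iter (eGerm x) K (grCoeff x T σ ν J)) =
      grDs K (grDel ν J fun g => T σ (g.trunc s)) (rho x) := by
  have h1 := contDiffAt_grDel (h.smooth σ) ν J
  have h2 := ((hasGrOrder_trunc (t := t) (T σ)).grDel ν J)
  have := h.order_le
  rw [grCoeff, iter_eGerm_pull h.det_ne_zero h1 h2 K (by omega),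
    evGerm_pull (contDiffAt_comp_rho h.det_ne_zero (contDiffAt_grDs h1 K))]

theorem evGerm_helmholtzCoeff (A B : Fin n ⊕ Fin m) (J : List (Fin n)) :
    evGerm (helmholtzCoeff s dGerm (velCoeff x F) A B J) = helmholtz s t F A B J x := by
  have h1 := h.evGerm_velCoeff A B J []
  rw [iter_nil] at h1
  simp only [helmholtzCoeff, eulerCoeff, map_sub, map_mul, map_pow, map_neg, map_one, map_sum, h1,
    map_seqSum, apply_ite (evGerm (n := n)), map_natCast, map_zero, h.evGerm_velCoeff]
  rfl

theorem evGerm_helmholtzCoeff_gr (σ ν : Fin m) (J : List (Fin n)) :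
    evGerm (helmholtzCoeff s (eGerm x) (grCoeff x T) σ ν J) =
      grHelmholtz s t T σ ν J (rho x) := by
  have h1 := h.evGerm_grCoeff σ ν J [] (Nat.zero_le _)
  rw [iter_nil] at h1
  simp only [helmholtzCoeff, eulerCoeff, map_sub, map_mul, map_pow, map_neg, map_one, map_sum, h1,
    map_seqSum, apply_ite (evGerm (n := n)), map_natCast, map_zero, grHelmholtz, grLieEuler]
  congr 2
  refine Finset.sum_congr rfl fun l hl => Finset.sum_congr rfl fun K _ => ?_
  rw [Finset.mem_range] at hl
  beta_reduce
  rw [h.evGerm_grCoeff ν σ _ _ (by rw [List.length_ofFn]; omega)]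

end IsHomogeneousAt

/-- The value at `x` of the operator with the coefficients `H^I_{σν}`, applied to the functions
`u^ν`. -/
def grOp (x : Jet (Fin n ⊕ Fin m) n t) (T : Fin m → Gr n m s → ℝ) (σ : Fin m)
    (u : Fin m → SmoothGerm n) : ℝ :=
  ∑ ν, ∑ l ∈ Finset.range (s + 1), seqSum l (fun I =>
    grHelmholtz s t T σ ν I (rho x) * evGerm (iter (eGerm x) I (u ν)))

namespace IsHomogeneousAt

variable (h : IsHomogeneousAt x F T)
include h

theorem evGerm_grOp (σ : Fin m) (u : Fin m → SmoothGerm n) :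
    evGerm (opSum s (eGerm x) (helmholtzCoeff s (eGerm x) (grCoeff x T) σ) u) =
      grOp x T σ u := by
  simp only [opSum, map_sum, map_seqSum, smul_eq_mul, map_mul, h.evGerm_helmholtzCoeff_gr]
  rfl

theorem evGerm_opSum_single (A B : Fin n ⊕ Fin m) (J : List (Fin n)) (hJ : J.length ≤ s) :
    evGerm (opSum s dGerm (helmholtzCoeff s dGerm (velCoeff x F) A)
      (Pi.single B (testGerm (J : Multiset (Fin n))))) = helmholtz s t F A B J x := by
  simp only [opSum, map_sum, map_seqSum, smul_eq_mul, map_mul, h.evGerm_helmholtzCoeff]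
  rw [Finset.sum_eq_single B]
  · rw [Pi.single_eq_same]
    exact sum_iter_testGerm (isSymm_helmholtz A B) J hJ
  · intro C _ hC
    refine Finset.sum_eq_zero fun l _ =>
      (seqSum_congr fun I _ => ?_).trans (seqSum_zero_fun (ι := Fin n) l)
    rw [Pi.single_eq_of_ne hC, iter_zero, map_zero, mul_zero]
  · simp

theorem evGerm_detGerm : evGerm (detGerm x) = (xMat x).det :=
  evGerm_pull contDiff_det_xMat.contDiffAt

theorem evGerm_y1Germ (σ : Fin m) (i : Fin n) : evGerm (y1Germ x σ i) = yCoord σ [i] x :=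
  evGerm_iter_yCoord h.det_ne_zero σ [i]

/-- The test monomial in the slot `B` isolates one coefficient of the Helmholtz operator; the
right-hand side then depends on the index type of `B` only through the characteristic. -/
theorem helmholtz_fibre (σ : Fin m) (B : Fin n ⊕ Fin m) (J : List (Fin n)) (hJ : J.length ≤ s) :
    helmholtz s t F (Sum.inr σ) B J x = (xMat x).det *
      grOp x T σ (charac (y1Germ x) (Pi.single B (testGerm (J : Multiset (Fin n))))) := by
  rw [← h.evGerm_opSum_single _ B J hJ, (h.helmholtz_germ _).1, map_mul, h.evGerm_detGerm,
    h.evGerm_grOp]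

theorem helmholtz_base (p : Fin n) (B : Fin n ⊕ Fin m) (J : List (Fin n)) (hJ : J.length ≤ s) :
    helmholtz s t F (Sum.inl p) B J x = -((xMat x).det * ∑ σ, yCoord σ [p] x *
      grOp x T σ (charac (y1Germ x) (Pi.single B (testGerm (J : Multiset (Fin n)))))) := by
  rw [← h.evGerm_opSum_single _ B J hJ, (h.helmholtz_germ _).2, map_mul, h.evGerm_detGerm]
  simp only [map_sum, map_mul, h.evGerm_grOp, h.evGerm_y1Germ]

omit h in
theorem charac_single_inr (y : Fin m → Fin n → SmoothGerm n) (ν : Fin m) (u : SmoothGerm n) :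
    charac y (Pi.single (Sum.inr ν) u) = Pi.single ν u := by
  funext μ
  simp [charac, Pi.single_apply]

omit h in
theorem charac_single_inl (y : Fin m → Fin n → SmoothGerm n) (p : Fin n) (u : SmoothGerm n) :
    charac y (Pi.single (Sum.inl p) u) = fun ν => -(y ν p * u) := by
  funext μ
  simp [charac, Pi.single_apply]

end IsHomogeneousAt

theorem grOp_single (σ ν : Fin m) (u : SmoothGerm n) :
    grOp x T σ (Pi.single ν u) = ∑ l ∈ Finset.range (s + 1), seqSum l (fun I =>
      grHelmholtz s t T σ ν I (rho x) * evGerm (iter (eGerm x) I u)) := by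
  rw [grOp, Finset.sum_eq_single ν]
  · rw [Pi.single_eq_same]
  · intro μ _ hμ
    refine Finset.sum_eq_zero fun l _ =>
      (seqSum_congr fun I _ => ?_).trans (seqSum_zero_fun (ι := Fin n) l)
    rw [Pi.single_eq_of_ne hμ, iter_zero, map_zero, mul_zero]
  · simp

theorem grOp_neg (σ : Fin m) (u : Fin m → SmoothGerm n) :
    grOp x T σ (fun ν => -u ν) = -grOp x T σ u := by
  simp only [grOp, iter_neg, map_neg, mul_neg, seqSum, Finset.sum_neg_distrib]

theorem evGerm_iter_one (J : List (Fin n)) :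
    evGerm (iter (eGerm x) J 1) = if J = [] then 1 else 0 := by
  induction J using List.reverseRecOn with
  | nil => simp
  | append_singleton J i _ =>
    rw [iter_append, iter_cons, iter_nil, (isConn_dGerm.twist (z := zGerm x)).map_one, iter_zero]
    simp

theorem grOp_single_one (σ ν : Fin m) :
    grOp x T σ (Pi.single ν 1) = grHelmholtz s t T σ ν [] (rho x) := by
  rw [grOp_single, Finset.sum_eq_single 0]
  · rw [seqSum_zero, evGerm_iter_one, if_pos rfl, mul_one]
  · intro l _ hl
    refine (seqSum_congr fun I hI => ?_).trans (seqSum_zero_fun (ι := Fin n) l)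
    rw [evGerm_iter_one, if_neg, mul_zero]
    rintro rfl
    exact hl hI.symm
  · simp

theorem sum_range_eq_sum_Icc {k : ℕ} {M : Type*} [AddCommMonoid M] (f : ℕ → M)
    (hf : ∀ l < k, f l = 0) (r : ℕ) :
    ∑ l ∈ Finset.range (r + 1), f l = ∑ l ∈ Finset.Icc k r, f l := by
  symm
  refine Finset.sum_subset ?_ ?_
  · intro l hl
    rw [Finset.mem_Icc] at hl
    rw [Finset.mem_range]
    omega
  · intro l hl hl'
    rw [Finset.mem_range] at hl
    rw [Finset.mem_Icc] at hl'
    exact hf l (by omega)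

theorem grOp_single_testGerm (hx : (xMat x).det ≠ 0) (σ ν : Fin m) {k : ℕ} (j : Fin k → Fin n) :
    grOp x T σ (Pi.single ν (testGerm (List.ofFn j : Multiset (Fin n)))) =
      ∑ l ∈ Finset.Icc k s, ∑ I : Fin l → Fin n,
        zSum j I x * grHelmholtz s t T σ ν (List.ofFn I) (rho x) := by
  rw [grOp_single]
  simp only [seqSum, evGerm_iter_testGerm hx]
  rw [sum_range_eq_sum_Icc (k := k) _ fun l hl =>
    Finset.sum_eq_zero fun I _ => by rw [zSum_eq_zero hl, mul_zero]]
  simp only [mul_comm]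

/-- Since the `e_i` commute, the derivative `e_p`, applied first, may be written as the outermost
one. -/
theorem evGerm_iter_y1Germ (hx : (xMat x).det ≠ 0) (ν : Fin m) (p : Fin n) (I : List (Fin n)) :
    evGerm (iter (eGerm x) I (y1Germ x ν p)) = yCoord ν (p :: I) x := by
  rw [← evGerm_iter_yCoord hx, (commuting_eGerm hx).iter_perm _
    (List.perm_append_singleton p I).symm, iter_append]
  rfl

theorem grOp_y1Germ (hx : (xMat x).det ≠ 0) (σ : Fin m) (p : Fin n) :
    grOp x T σ (fun ν => y1Germ x ν p) =
      ∑ l₀ ∈ Finset.range (s + 1), ∑ I₀ : Fin l₀ → Fin n, ∑ ν,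
        yCoord ν (p :: List.ofFn I₀) x * grHelmholtz s t T σ ν (List.ofFn I₀) (rho x) := by
  simp only [grOp, evGerm_iter_y1Germ hx, seqSum]
  rw [Finset.sum_comm]
  refine Finset.sum_congr rfl fun l _ => ?_
  rw [Finset.sum_comm]
  simp only [mul_comm]

/-- Leibniz rule: the derivatives `I` that fall on the monomial give `Z_I`, the derivatives `I₀`
that fall on `y^ν_p` give `y^ν_{pI₀}`, and the binomial coefficient counts the distributions. Terms
with `|I| < k` vanish, as `I` then has no partition into `k` blocks. -/
theorem grOp_y1Germ_mul_testGerm (hx : (xMat x).det ≠ 0) (σ : Fin m) (p : Fin n) {k : ℕ}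
    (j : Fin k → Fin n) :
    grOp x T σ (fun ν => y1Germ x ν p * testGerm (List.ofFn j : Multiset (Fin n))) =
      ∑ l₀ ∈ Finset.range (s + 1), ∑ I₀ : Fin l₀ → Fin n,
        ∑ l ∈ Finset.Icc k (s - l₀), ∑ I : Fin l → Fin n,
          ((l + l₀).choose l : ℝ) * zSum j I x * ∑ ν, yCoord ν (p :: List.ofFn I₀) x *
            grHelmholtz s t T σ ν (List.ofFn I ++ List.ofFn I₀) (rho x) := by
  have h1 : ∀ ν, ∑ l ∈ Finset.range (s + 1), seqSum l (fun I =>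
      grHelmholtz s t T σ ν I (rho x) * evGerm (iter (eGerm x) I
        (y1Germ x ν p * testGerm (List.ofFn j : Multiset (Fin n))))) =
      ∑ l₀ ∈ Finset.range (s + 1), ∑ l ∈ Finset.Icc k (s - l₀),
        ∑ I₀ : Fin l₀ → Fin n, ∑ I : Fin l → Fin n, ((l + l₀).choose l : ℝ) * zSum j I x *
          (yCoord ν (p :: List.ofFn I₀) x *
            grHelmholtz s t T σ ν (List.ofFn I ++ List.ofFn I₀) (rho x)) := by
    intro ν
    have h2 : ∀ l, seqSum l (fun I =>
        grHelmholtz s t T σ ν I (rho x) * evGerm (iter (eGerm x) I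
          (y1Germ x ν p * testGerm (List.ofFn j : Multiset (Fin n))))) =
        ∑ pq ∈ Finset.HasAntidiagonal.antidiagonal l, ∑ I₀ : Fin pq.2 → Fin n,
          ∑ I : Fin pq.1 → Fin n, ((pq.1 + pq.2).choose pq.1 : ℝ) * zSum j I x *
          (yCoord ν (p :: List.ofFn I₀) x *
            grHelmholtz s t T σ ν (List.ofFn I ++ List.ofFn I₀) (rho x)) := by
      intro l
      -- The numerical coefficients are regarded as constant germs, so that the Leibniz rule in the
      -- ring of germs applies.
      have h3 := congrArg evGerm (seqSum_smul_iter (d := eGerm x) (D := eGerm x)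
        isConn_dGerm.twist (fun J => constGerm (grHelmholtz s t T σ ν J (rho x)))
        (fun I K h => congrArg constGerm (isSymm_grHelmholtz σ ν (rho x) I K h)) l (y1Germ x ν p)
        (testGerm (List.ofFn j : Multiset (Fin n))))
      simp only [map_seqSum, map_sum, smul_eq_mul, map_mul, evGerm_const, map_nsmul] at h3
      rw [h3]
      refine Finset.sum_congr rfl fun pq hpq => ?_
      rw [Finset.HasAntidiagonal.mem_antidiagonal] at hpq
      simp only [seqSum, evGerm_iter_testGerm hx, evGerm_iter_y1Germ hx]
      rw [Finset.sum_comm, hpq, nsmul_eq_mul, Finset.mul_sum]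
      refine Finset.sum_congr rfl fun I₀ _ => ?_
      rw [Finset.mul_sum]
      exact Finset.sum_congr rfl fun I _ => by ring
    simp only [h2]
    rw [sum_range_antidiagonal s (fun l l₀ => ∑ I₀ : Fin l₀ → Fin n,
          ∑ I : Fin l → Fin n, ((l + l₀).choose l : ℝ) * zSum j I x *
          (yCoord ν (p :: List.ofFn I₀) x *
            grHelmholtz s t T σ ν (List.ofFn I ++ List.ofFn I₀) (rho x))), Finset.sum_comm]
    refine Finset.sum_congr rfl fun l₀ hl₀ => ?_
    rw [Finset.mem_range] at hl₀
    rw [← Finset.sum_filter]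
    symm
    refine Finset.sum_subset ?_ ?_
    · intro l hl
      rw [Finset.mem_Icc] at hl
      rw [Finset.mem_filter, Finset.mem_range]
      omega
    · intro l hl hl'
      rw [Finset.mem_filter, Finset.mem_range] at hl
      rw [Finset.mem_Icc] at hl'
      have hlk : l < k := by omega
      simp only [zSum_eq_zero hlk, mul_zero, zero_mul, Finset.sum_const_zero]
  rw [grOp, Finset.sum_congr rfl fun ν _ => h1 ν, Finset.sum_comm]
  refine Finset.sum_congr rfl fun l₀ _ => ?_
  simp only [Finset.mul_sum]
  rw [Finset.sum_comm]
  rw [Finset.sum_comm (s := (Finset.univ : Finset (Fin l₀ → Fin n)))]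
  refine Finset.sum_congr rfl fun l _ => ?_
  rw [Finset.sum_comm]
  refine Finset.sum_congr rfl fun I₀ _ => ?_
  rw [Finset.sum_comm]

theorem testGerm_nil : testGerm (([] : List (Fin n)) : Multiset (Fin n)) = 1 := testGerm_zero

theorem grOp_charac_inl (hx : (xMat x).det ≠ 0) (σ : Fin m) (p : Fin n) {k : ℕ}
    (j : Fin k → Fin n) :
    grOp x T σ (charac (y1Germ x) (Pi.single (Sum.inl p)
      (testGerm (List.ofFn j : Multiset (Fin n))))) =
      -∑ l₀ ∈ Finset.range (s + 1), ∑ I₀ : Fin l₀ → Fin n,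
        ∑ l ∈ Finset.Icc k (s - l₀), ∑ I : Fin l → Fin n,
          ((l + l₀).choose l : ℝ) * zSum j I x * ∑ ν, yCoord ν (p :: List.ofFn I₀) x *
            grHelmholtz s t T σ ν (List.ofFn I ++ List.ofFn I₀) (rho x) := by
  rw [IsHomogeneousAt.charac_single_inl, grOp_neg, grOp_y1Germ_mul_testGerm hx]

theorem grOp_charac_inl_nil (hx : (xMat x).det ≠ 0) (σ : Fin m) (p : Fin n) :
    grOp x T σ (charac (y1Germ x) (Pi.single (Sum.inl p)
      (testGerm (([] : List (Fin n)) : Multiset (Fin n))))) =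
      -∑ l₀ ∈ Finset.range (s + 1), ∑ I₀ : Fin l₀ → Fin n, ∑ ν,
        yCoord ν (p :: List.ofFn I₀) x * grHelmholtz s t T σ ν (List.ofFn I₀) (rho x) := by
  rw [IsHomogeneousAt.charac_single_inl, testGerm_nil]
  simp only [mul_one]
  rw [grOp_neg, grOp_y1Germ hx]

/-- The Helmholtz expressions of a homogeneous equation in terms of those of the associated
non-homogeneous equation. -/
theorem IsHomogeneousAt.helmholtz (h : IsHomogeneousAt x F T) :
    let D : ℝ := (xMat x).det
    let HH : Fin n ⊕ Fin m → Fin n ⊕ Fin m → List (Fin n) → ℝ :=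
      fun A B J => Velocity.helmholtz s t F A B J x
    let H : Fin m → Fin m → List (Fin n) → ℝ := fun σ ν I => grHelmholtz s t T σ ν I (rho x)
    let y : Fin m → List (Fin n) → ℝ := fun σ I => yCoord σ I x
    (∀ σ ν, HH (Sum.inr σ) (Sum.inr ν) [] = D * H σ ν []) ∧
    (∀ σ ν, ∀ k : ℕ, 1 ≤ k → k ≤ s → ∀ j : Fin k → Fin n,
      HH (Sum.inr σ) (Sum.inr ν) (List.ofFn j) =
        D * ∑ l ∈ Finset.Icc k s, ∑ I : Fin l → Fin n, zSum j I x * H σ ν (List.ofFn I)) ∧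
    (∀ σ p, HH (Sum.inr σ) (Sum.inl p) [] =
      -(D * ∑ l₀ ∈ Finset.range (s + 1), ∑ I₀ : Fin l₀ → Fin n, ∑ ν,
          y ν (p :: List.ofFn I₀) * H σ ν (List.ofFn I₀))) ∧
    (∀ σ p, ∀ k : ℕ, 1 ≤ k → k ≤ s → ∀ j : Fin k → Fin n,
      HH (Sum.inr σ) (Sum.inl p) (List.ofFn j) =
        -(D * ∑ l₀ ∈ Finset.range (s + 1), ∑ I₀ : Fin l₀ → Fin n,
          ∑ l ∈ Finset.Icc k (s - l₀), ∑ I : Fin l → Fin n,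
            ((l + l₀).choose l : ℝ) * zSum j I x *
              ∑ ν, y ν (p :: List.ofFn I₀) * H σ ν (List.ofFn I ++ List.ofFn I₀))) ∧
    (∀ p ν, HH (Sum.inl p) (Sum.inr ν) [] = -(D * ∑ σ, y σ [p] * H σ ν [])) ∧
    (∀ p ν, ∀ k : ℕ, 1 ≤ k → k ≤ s → ∀ j : Fin k → Fin n,
      HH (Sum.inl p) (Sum.inr ν) (List.ofFn j) =
        -(D * ∑ σ, y σ [p] * ∑ l ∈ Finset.Icc k s, ∑ I : Fin l → Fin n,
          zSum j I x * H σ ν (List.ofFn I))) ∧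
    (∀ p q, HH (Sum.inl p) (Sum.inl q) [] =
      D * ∑ σ, y σ [p] * ∑ l₀ ∈ Finset.range (s + 1), ∑ I₀ : Fin l₀ → Fin n, ∑ ν,
        y ν (q :: List.ofFn I₀) * H σ ν (List.ofFn I₀)) ∧
    (∀ p q, ∀ k : ℕ, 1 ≤ k → k ≤ s → ∀ j : Fin k → Fin n,
      HH (Sum.inl p) (Sum.inl q) (List.ofFn j) =
        D * ∑ σ, y σ [p] * ∑ l₀ ∈ Finset.range (s + 1), ∑ I₀ : Fin l₀ → Fin n,
          ∑ l ∈ Finset.Icc k (s - l₀), ∑ I : Fin l → Fin n,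
            ((l + l₀).choose l : ℝ) * zSum j I x *
              ∑ ν, y ν (q :: List.ofFn I₀) * H σ ν (List.ofFn I ++ List.ofFn I₀)) := by
  intro D HH H y
  have hx := h.det_ne_zero
  have h0 : ([] : List (Fin n)).length ≤ s := Nat.zero_le _
  have hl : ∀ {k : ℕ} (j : Fin k → Fin n), k ≤ s → (List.ofFn j).length ≤ s := fun j hk => by
    rwa [List.length_ofFn]
  simp only [D, HH, H, y]
  refine ⟨fun σ ν => ?_, fun σ ν k _ hk j => ?_, fun σ p => ?_, fun σ p k _ hk j => ?_,
    fun p ν => ?_, fun p ν k _ hk j => ?_, fun p q => ?_, fun p q k _ hk j => ?_⟩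
  · rw [h.helmholtz_fibre _ _ _ h0, charac_single_inr, testGerm_nil, grOp_single_one]
  · rw [h.helmholtz_fibre _ _ _ (hl j hk), charac_single_inr, grOp_single_testGerm hx]
  · rw [h.helmholtz_fibre _ _ _ h0, grOp_charac_inl_nil hx, mul_neg]
  · rw [h.helmholtz_fibre _ _ _ (hl j hk), grOp_charac_inl hx, mul_neg]
  · rw [h.helmholtz_base _ _ _ h0, charac_single_inr, testGerm_nil]
    simp only [grOp_single_one]
  · rw [h.helmholtz_base _ _ _ (hl j hk), charac_single_inr]
    simp only [grOp_single_testGerm hx]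
  · rw [h.helmholtz_base _ _ _ h0]
    simp only [grOp_charac_inl_nil hx, mul_neg, Finset.sum_neg_distrib, neg_neg]
  · rw [h.helmholtz_base _ _ _ (hl j hk)]
    simp only [grOp_charac_inl hx, mul_neg, Finset.sum_neg_distrib, neg_neg]

end Formulas

/-! ### Contact of maps and its invariance under composition -/

section Contact

variable {n : ℕ}

/-- Iterated partial derivatives. -/
def pds (J : List (Fin n)) (f : (Fin n → ℝ) → ℝ) : (Fin n → ℝ) → ℝ := J.foldr pd f

theorem contDiffAt_pds {f : (Fin n → ℝ) → ℝ} {τ : Fin n → ℝ} (hf : ContDiffAt ℝ ∞ f τ)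
    (J : List (Fin n)) : ContDiffAt ℝ ∞ (pds J f) τ := by
  induction J with
  | nil => exact hf
  | cons i J ih => exact contDiffAt_pd ih i

theorem iter_dGerm_germ {f : (Fin n → ℝ) → ℝ} (hf : ContDiffAt ℝ ∞ f 0) (J : List (Fin n)) :
    iter dGerm J (germ f) = germ (pds J f) := by
  induction J with
  | nil => rfl
  | cons i J ih => rw [iter_cons, ih, dGerm_germ (contDiffAt_pds hf J)]; rfl

theorem iteratedFDeriv_eq_pds (f : (Fin n → ℝ) → ℝ) (J : List (Fin n)) {τ : Fin n → ℝ}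
    (hf : ContDiffAt ℝ J.length f τ) :
    iteratedFDeriv ℝ J.length f τ (fun a => Pi.single (J.get a) 1) = pds J f τ := by
  induction J generalizing τ with
  | nil => exact iteratedFDeriv_zero_apply _
  | cons i J ih =>
    have hf' : ContDiffAt ℝ (J.length + 1 : ℕ) f τ := hf
    change iteratedFDeriv ℝ (J.length + 1) f τ _ = _
    have hd : DifferentiableAt ℝ (iteratedFDeriv ℝ J.length f) τ :=
      hf'.differentiableAt_iteratedFDeriv (by exact_mod_cast Nat.lt_succ_self _)
    rw [iteratedFDeriv_succ_apply_left, ← fderiv_continuousMultilinear_apply_const_apply hd]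
    have h1 : (fun y => iteratedFDeriv ℝ J.length f y (fun a => Pi.single (J.get a) 1)) =ᶠ[𝓝 τ]
        pds J f := by
      filter_upwards [hf'.eventually (by simp)] with y hy
      exact ih (hy.of_le (by exact_mod_cast Nat.le_succ _))
    change fderiv ℝ (fun y => iteratedFDeriv ℝ J.length f y
      (fun a => Pi.single (J.get a) 1)) τ (Pi.single i 1) = fderiv ℝ (pds J f) τ (Pi.single i 1)
    rw [h1.fderiv_eq]

theorem evGerm_iter_dGerm {f : (Fin n → ℝ) → ℝ} (hf : ContDiffAt ℝ ∞ f 0) (J : List (Fin n)) :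
    evGerm (iter dGerm J (germ f)) =
      iteratedFDeriv ℝ J.length f 0 (fun a => Pi.single (J.get a) 1) := by
  rw [iteratedFDeriv_eq_pds f J (hf.of_le (by exact_mod_cast le_top)), iter_dGerm_germ hf,
    evGerm_germ (contDiffAt_pds hf J)]

/-- The germs with vanishing derivatives of order at most `k`. -/
def IsFlat (k : ℕ) (c : SmoothGerm n) : Prop :=
  ∀ J : List (Fin n), J.length ≤ k → evGerm (iter dGerm J c) = 0

theorem IsFlat.add {k : ℕ} {a b : SmoothGerm n} (ha : IsFlat k a) (hb : IsFlat k b) :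
    IsFlat k (a + b) := by
  intro J hJ
  rw [iter_add, map_add, ha J hJ, hb J hJ, add_zero]

theorem IsFlat.sum {κ : Type*} {k : ℕ} (s : Finset κ) {a : κ → SmoothGerm n}
    (ha : ∀ i ∈ s, IsFlat k (a i)) : IsFlat k (∑ i ∈ s, a i) := by
  intro J hJ
  rw [iter_sum, map_sum]
  exact Finset.sum_eq_zero fun i hi => ha i hi J hJ

theorem isFlat_succ {k : ℕ} {c : SmoothGerm n} :
    IsFlat (k + 1) c ↔ evGerm c = 0 ∧ ∀ i, IsFlat k (dGerm i c) := by
  constructor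
  · intro h
    refine ⟨h [] (Nat.zero_le _), fun i J hJ => ?_⟩
    have := h (J ++ [i]) (by simpa using hJ)
    rwa [iter_append] at this
  · rintro ⟨h0, h⟩ J hJ
    induction J using List.reverseRecOn with
    | nil => exact h0
    | append_singleton J i _ =>
      rw [iter_append]
      exact h i J (by simpa using hJ)

theorem IsFlat.mono {k l : ℕ} {c : SmoothGerm n} (h : IsFlat k c) (hl : l ≤ k) : IsFlat l c :=
  fun J hJ => h J (hJ.trans hl)

theorem IsFlat.mul {k : ℕ} {c : SmoothGerm n} (h : IsFlat k c) (a : SmoothGerm n) :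
    IsFlat k (a * c) := by
  induction k generalizing a c with
  | zero =>
    intro J hJ
    obtain rfl := List.length_eq_zero_iff.1 (Nat.le_zero.1 hJ)
    have := h [] le_rfl
    rw [iter_nil] at this
    rw [iter_nil, map_mul, this, mul_zero]
  | succ k ih =>
    rw [isFlat_succ]
    refine ⟨by rw [map_mul, (isFlat_succ.1 h).1, mul_zero], fun i => ?_⟩
    rw [isConn_dGerm.mul]
    exact (ih ((isFlat_succ.1 h).2 i) a).add (ih (h.mono (Nat.le_succ k)) _)

variable {ι : Type} [Fintype ι] [DecidableEq ι]

theorem dGerm_comp {P : (Fin n → ℝ) → ι → ℝ} (hP : ContDiffAt ℝ ∞ P 0) {f : (ι → ℝ) → ℝ}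
    (hf : ContDiffAt ℝ ∞ f (P 0)) (i : Fin n) :
    dGerm i (germ fun τ => f (P τ)) =
      ∑ A, germ (fun τ => fderiv ℝ f (P τ) (Pi.single A 1)) * dGerm i (germ fun τ => P τ A) := by
  have hPA := contDiffAt_pi.1 hP
  have h1 : ∀ A, ContDiffAt ℝ ∞ (fun τ => fderiv ℝ f (P τ) (Pi.single A 1)) 0 := fun A =>
    ((hf.fderiv_right (m := ∞) (by norm_num)).comp (0 : Fin n → ℝ) hP).clm_apply contDiffAt_const
  rw [dGerm_germ (f := fun τ => f (P τ)) (hf.comp (0 : Fin n → ℝ) hP)]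
  simp only [dGerm_germ (hPA _)]
  have h2 : ∀ A, germ (fun τ => fderiv ℝ f (P τ) (Pi.single A 1)) * germ (pd i fun τ => P τ A) =
      germ (fun τ => fderiv ℝ f (P τ) (Pi.single A 1) * pd i (fun τ => P τ A) τ) := fun A =>
    (germ_mul (h1 A) (contDiffAt_pd (hPA A) i)).symm
  simp only [h2]
  rw [← germ_sum _ fun A _ => (h1 A).mul (contDiffAt_pd (hPA A) i)]
  apply germ_congr
  filter_upwards [ContDiffAt.eventually_differentiableAt hP,
    hP.continuousAt.eventually (ContDiffAt.eventually_differentiableAt hf)] with τ h3 h4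
  have h5 : fderiv ℝ (fun τ => f (P τ)) τ = _ := fderiv_comp τ h4 h3
  have h6 : ∀ A, pd i (fun τ => P τ A) τ = fderiv ℝ P τ (Pi.single i 1) A := by
    intro A
    rw [pd, fderiv_apply h3]
    rfl
  rw [pd, h5, ContinuousLinearMap.comp_apply]
  simp only [h6]
  conv_lhs => rw [pi_eq_sum_univ' (fderiv ℝ P τ (Pi.single i 1))]
  rw [map_sum]
  refine Finset.sum_congr rfl fun A _ => ?_
  rw [map_smul, smul_eq_mul, mul_comm]

/-- Differentiating, `∂_i(f∘P - f∘Q) = ∑_A ((f_A∘P - f_A∘Q) ∂_i P^A + (f_A∘Q) ∂_i(P^A - Q^A))` with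
`f_A` the partial derivatives of `f`. Both terms are flat to one order less, by induction and by
hypothesis, and flat germs of a given order form an ideal. -/
theorem isFlat_comp {P Q : (Fin n → ℝ) → ι → ℝ} (hP : ContDiffAt ℝ ∞ P 0)
    (hQ : ContDiffAt ℝ ∞ Q 0) {k : ℕ}
    (h : ∀ A, IsFlat k (germ (fun τ => P τ A) - germ fun τ => Q τ A)) (h0 : P 0 = Q 0)
    {f : (ι → ℝ) → ℝ} (hf : ContDiffAt ℝ ∞ f (P 0)) :
    IsFlat k (germ (fun τ => f (P τ)) - germ fun τ => f (Q τ)) := by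
  have hev : ∀ {f : (ι → ℝ) → ℝ}, ContDiffAt ℝ ∞ f (P 0) →
      evGerm (germ (fun τ => f (P τ)) - germ fun τ => f (Q τ)) = 0 := by
    intro f hf
    have hf' : ContDiffAt ℝ ∞ f (Q 0) := h0 ▸ hf
    rw [map_sub, evGerm_germ (f := fun τ => f (P τ)) (hf.comp (0 : Fin n → ℝ) hP),
      evGerm_germ (f := fun τ => f (Q τ)) (hf'.comp (0 : Fin n → ℝ) hQ), h0, sub_self]
  induction k generalizing f with
  | zero =>
    intro J hJ
    obtain rfl := List.length_eq_zero_iff.1 (Nat.le_zero.1 hJ)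
    exact hev hf
  | succ k ih =>
    rw [isFlat_succ]
    refine ⟨hev hf, fun i => ?_⟩
    rw [map_sub, dGerm_comp hP hf, dGerm_comp hQ (h0 ▸ hf), ← Finset.sum_sub_distrib]
    refine IsFlat.sum _ fun A _ => ?_
    have h1 := (isFlat_succ.1 (h A)).2 i
    rw [map_sub] at h1
    have h2 := ih (fun A => (h A).mono (Nat.le_succ k))
      (f := fun y => fderiv ℝ f y (Pi.single A 1))
      ((hf.fderiv_right (m := ∞) (by norm_num)).clm_apply contDiffAt_const)
    have h3 := (h2.mul (dGerm i (germ fun τ => P τ A))).add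
      (h1.mul (germ fun τ => fderiv ℝ f (Q τ) (Pi.single A 1)))
    convert h3 using 1
    ring

end Contact

/-! ### Passage from order `s` to order `t` -/

section Truncation

variable {n m s t : ℕ}

theorem get_trunc {ι : Type} (y : Jet ι n t) (A : ι) {J : Multiset (Fin n)}
    (hJ : J.card ≤ s) : (y.trunc s).get A J = y.get A J := by
  rw [Jet.get_of_le _ _ hJ]
  rfl

theorem contDiff_trunc {ι : Type} [Fintype ι] {k : WithTop ℕ∞} :
    ContDiff ℝ k (Jet.trunc s : Jet ι n t → Jet ι n s) :=
  contDiff_pi.2 fun A => contDiff_pi.2 fun J => contDiff_get A J.1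

theorem contDiff_grTrunc {k : WithTop ℕ∞} : ContDiff ℝ k (Gr.trunc s : Gr n m t → Gr n m s) :=
  contDiff_fst.prodMk (contDiff_trunc.comp contDiff_snd)

theorem trunc_add {ι : Type} [Fintype ι] [DecidableEq ι] (y u : Jet ι n t) : (y + u).trunc s = y.trunc s + u.trunc s := by
  funext A J
  exact Jet.get_add y u A J.1

theorem fderiv_trunc {ι : Type} [Fintype ι] [DecidableEq ι] (y u : Jet ι n t) :
    fderiv ℝ (Jet.trunc s : Jet ι n t → Jet ι n s) y u = u.trunc s := by
  have hl : IsLinearMap ℝ (Jet.trunc s : Jet ι n t → Jet ι n s) :=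
    ⟨trunc_add, fun c u => by
      funext A J
      simp only [Jet.trunc, Jet.get, Pi.smul_apply]
      split_ifs <;> simp⟩
  let L : Jet ι n t →L[ℝ] Jet ι n s :=
    ⟨hl.mk' _, (contDiff_trunc (k := 0)).continuous⟩
  exact congrArg (fun l : Jet ι n t →L[ℝ] Jet ι n s => l u) L.fderiv

theorem xMat_trunc (hs : 1 ≤ s) (y : Jet (Fin n ⊕ Fin m) n t) :
    xMat (y.trunc s) = xMat y := by
  ext i j
  exact get_trunc y (Sum.inl i) (by rw [Multiset.card_singleton]; exact hs)

/-- The formal derivatives in orders `s` and `t` are taken along fields that, after truncation,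
differ only in the coordinates of order `s`. Inductively they act on a function `y^σ_I` with `|I| <
s`, which does not depend on those. -/
theorem yCoord_trunc (hs : 1 ≤ s) (hst : s ≤ t) (σ : Fin m) (I : List (Fin n)) (hI : I.length ≤ s)
    {y : Jet (Fin n ⊕ Fin m) n t} (hy : (xMat y).det ≠ 0) :
    yCoord σ I (y.trunc s) = yCoord σ I y := by
  induction I generalizing y with
  | nil => exact get_trunc y (Sum.inr σ) (Nat.zero_le _)
  | cons i I ih =>
    rw [List.length_cons] at hI
    simp only [yCoord]
    rw [xMat_trunc hs]
    refine Finset.sum_congr rfl fun j _ => ?_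
    congr 1
    rw [formalD_eq_fderiv, formalD_eq_fderiv]
    have hy' : (xMat (y.trunc s)).det ≠ 0 := by rwa [xMat_trunc hs]
    have hd : DifferentiableAt ℝ (yCoord σ I) (y.trunc s) :=
      (contDiffAt_yCoord hy' σ I).differentiableAt (by simp)
    have h1 : yCoord σ I =ᶠ[𝓝 y] fun y => yCoord σ I (y.trunc s) := by
      filter_upwards [eventually_det_ne_zero hy] with y' hy'
      exact (ih (by omega) hy').symm
    have h2 : fderiv ℝ (fun y : Jet (Fin n ⊕ Fin m) n t => yCoord σ I (y.trunc s)) y = _ :=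
      fderiv_comp y hd ((contDiff_trunc (k := 1)).differentiable (by simp) y)
    rw [h1.fderiv_eq, h2, ContinuousLinearMap.comp_apply, fderiv_trunc]
    rw [← sub_eq_zero, ← map_sub]
    refine fderiv_eq_zero_of_invariant fun c => hasOrder_yCoord σ I _ _ fun A J hJ => ?_
    have h3 : (j ::ₘ J.1).card ≤ s := by rw [Multiset.card_cons]; omega
    have h4 : (shift j y).get A J.1 = y.get A (j ::ₘ J.1) :=
      dif_pos (J.2.trans hst)
    rw [Pi.smul_apply, Pi.smul_apply, Pi.sub_apply, Pi.sub_apply, shift, get_trunc y A h3,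
      Jet.trunc, h4, sub_self, smul_zero]

theorem rho_trunc (hs : 1 ≤ s) (hst : s ≤ t) {y : Jet (Fin n ⊕ Fin m) n t}
    (hy : (xMat y).det ≠ 0) : rho (y.trunc s) = (rho y).trunc s := by
  refine Prod.ext ?_ ?_
  · funext i
    exact get_trunc (J := 0) y (Sum.inl i) (Nat.zero_le _)
  · funext σ I
    change yCoord σ _ (y.trunc s) = (rho y).2.get σ I.1
    rw [yCoord_trunc hs hst σ _ (by rw [Multiset.length_sort]; exact I.2) hy]
    exact (Jet.get_of_le (rho y).2 σ (I.2.trans hst)).symm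

variable {X : Type*} [TopologicalSpace X] [ChartedSpace (Model n m) X]
  {e : OpenPartialHomeomorph X (Model n m)}

theorem continuous_base {r : ℕ} :
    Continuous fun (x : Jet (Fin n ⊕ Fin m) n r) (A : Fin n ⊕ Fin m) => x.get A 0 :=
  continuous_pi fun A => (contDiff_get (k := 0) A 0).continuous

theorem isOpen_wSet (r : ℕ) : IsOpen (wSet r e) :=
  (e.open_target.preimage continuous_base).inter
    (isOpen_ne.preimage (contDiff_det_xMat (k := 0)).continuous)

theorem isOpen_grSet (r : ℕ) : IsOpen (grSet r e) := by
  refine e.open_target.preimage (continuous_pi fun A => ?_)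
  rcases A with i | σ
  · exact (continuous_apply i).comp continuous_fst
  · exact (contDiff_get (k := 0) σ 0).continuous.comp continuous_snd

theorem trunc_mem_wSet (hs : 1 ≤ s) {y : Jet (Fin n ⊕ Fin m) n t}
    (hy : y ∈ wSet t e) : y.trunc s ∈ wSet s e := by
  refine ⟨?_, by rw [xMat_trunc hs]; exact hy.2⟩
  have : (fun A => (y.trunc s).get A 0) = fun A => y.get A 0 :=
    funext fun A => get_trunc y A (Nat.zero_le _)
  rw [this]
  exact hy.1

theorem rho_mem_grSet {r : ℕ} {y : Jet (Fin n ⊕ Fin m) n r} (hy : y ∈ wSet r e) :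
    rho y ∈ grSet r e := by
  have : (Sum.elim (rho y).1 (fun σ => (rho y).2.get σ 0) : Model n m) = fun A => y.get A 0 := by
    funext A
    rcases A with i | σ
    · rfl
    · change (rho y).2.get σ 0 = _
      rw [Jet.get_of_le _ _ (Nat.zero_le _)]
      change yCoord σ ((0 : Multiset (Fin n)).sort (· ≤ ·)) y = _
      rw [Multiset.sort_zero]
      rfl
  change Sum.elim (rho y).1 (fun σ => (rho y).2.get σ 0) ∈ e.target
  rw [this]
  exact hy.1

theorem DiffEq.IsAssociated.isHomogeneousAt {𝓣 : DiffEq n m s X} {T : Fin m → Gr n m s → ℝ}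
    (h : 𝓣.IsAssociated e T) (hs : 1 ≤ s) (hst : 2 * s ≤ t) {x : Jet (Fin n ⊕ Fin m) n t}
    (hx : x ∈ wSet t e) : IsHomogeneousAt x (𝓣.form.expr e) T := by
  have hst' : s ≤ t := by omega
  have hmem : ∀ᶠ y in 𝓝 x, y ∈ wSet t e := (isOpen_wSet t).mem_nhds hx
  refine ⟨hs, hst, hx.2, fun σ => ?_, fun σ => ?_, fun i => ?_⟩
  · have h1 : (rho x).trunc s ∈ grSet s e := by
      rw [← rho_trunc hs hst' hx.2]
      exact rho_mem_grSet (trunc_mem_wSet hs hx)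
    exact ((h.smooth σ).contDiffAt ((isOpen_grSet s).mem_nhds h1)).comp (rho x)
      contDiff_grTrunc.contDiffAt
  · filter_upwards [hmem] with y hy
    rw [h.fibre σ _ (trunc_mem_wSet hs hy), xMat_trunc hs, rho_trunc hs hst' hy.2]
  · filter_upwards [hmem] with y hy
    rw [h.base i _ (trunc_mem_wSet hs hy), xMat_trunc hs, rho_trunc hs hst' hy.2,
      Finset.mul_sum]
    congr 1
    refine Finset.sum_congr rfl fun σ _ => ?_
    rw [yCoord_trunc hs hst' σ [i] (by simpa using hs) hy.2]
    ring

end Truncation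

/-! ### Normal form of a velocity under reparametrization -/

section NormalForm

variable {n m r : ℕ}

theorem fderiv_apply_eq_sum_pd {f : (Fin n → ℝ) → ℝ} (τ v : Fin n → ℝ) :
    fderiv ℝ f τ v = ∑ j, v j * pd j f τ := by
  conv_lhs => rw [pi_eq_sum_univ' v]
  rw [map_sum]
  refine Finset.sum_congr rfl fun j _ => ?_
  rw [map_smul, smul_eq_mul]
  rfl

theorem fderiv_pi_eq_sum_pd {κ : Type} [Fintype κ] {P : (Fin n → ℝ) → κ → ℝ} {τ : Fin n → ℝ}
    (hP : DifferentiableAt ℝ P τ) (v : Fin n → ℝ) (A : κ) :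
    fderiv ℝ P τ v A = ∑ j, v j * pd j (fun τ => P τ A) τ := by
  rw [← fderiv_apply_eq_sum_pd, fderiv_apply hP]
  rfl

theorem pd_comp_translate_comp {x : Jet (Fin n ⊕ Fin m) n r} {α : (Fin n → ℝ) → Fin n → ℝ}
    {f : Jet (Fin n ⊕ Fin m) n r → ℝ} {u : Fin n → ℝ} (hα : DifferentiableAt ℝ α u)
    (hf : DifferentiableAt ℝ f (translate x (α u))) (k : Fin n) :
    pd k (fun u => f (translate x (α u))) u =
      ∑ j, fderiv ℝ α u (Pi.single k 1) j * formalD j f (translate x (α u)) := by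
  have h1 : DifferentiableAt ℝ (fun τ => f (translate x τ)) (α u) :=
    hf.comp (α u) ((contDiff_translate (k := 1) x).contDiffAt.differentiableAt (by simp))
  have h2 : fderiv ℝ (fun u => f (translate x (α u))) u =
      (fderiv ℝ (fun τ => f (translate x τ)) (α u)).comp (fderiv ℝ α u) :=
    fderiv_comp (g := fun τ => f (translate x τ)) u h1 hα
  rw [pd, h2, ContinuousLinearMap.comp_apply, fderiv_apply_eq_sum_pd]
  simp only [pd_comp_translate hf]

/-- A change of parameters which brings the first components of the polynomial with the
coordinates `x` to the normal form `τ^i + const`. -/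
theorem exists_normalizing_parameter (x : Jet (Fin n ⊕ Fin m) n r) (hx : (xMat x).det ≠ 0) :
    ∃ α : (Fin n → ℝ) → Fin n → ℝ, ContDiffAt ℝ ω α 0 ∧ α 0 = 0 ∧
      ∀ᶠ u in 𝓝 0, ∀ i, (translate x (α u)).get (Sum.inl i) 0 = x.get (Sum.inl i) 0 + u i := by
  -- The first `n` components, shifted to vanish at `0`. The differential at `0` has the matrix
  -- `(x^i_j)`, and the parameter change is the local inverse.
  set φ : (Fin n → ℝ) → Fin n → ℝ := fun τ i =>
    (translate x τ).get (Sum.inl i) 0 - x.get (Sum.inl i) 0 with hφ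
  have hs : ContDiff ℝ ω φ := contDiff_pi.2 fun i =>
    (contDiff_translate_get x (Sum.inl i) 0).sub contDiff_const
  have hd : DifferentiableAt ℝ φ 0 := hs.contDiffAt.differentiableAt (by simp)
  have hm : LinearMap.toMatrix' (fderiv ℝ φ 0 : (Fin n → ℝ) →ₗ[ℝ] (Fin n → ℝ)) = xMat x := by
    ext i j
    rw [LinearMap.toMatrix'_apply]
    change fderiv ℝ φ 0 (Pi.single j 1) i = _
    rw [show fderiv ℝ φ 0 (Pi.single j 1) i = fderiv ℝ (fun τ => φ τ i) 0 (Pi.single j 1) by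
      rw [fderiv_apply hd]; rfl]
    simp only [hφ]
    rw [fderiv_sub_const]
    have := pd_translate_get x (Sum.inl i) 0 j 0
    rw [pd, translate_zero] at this
    exact this
  have hdet : (fderiv ℝ φ 0).det ≠ 0 := by
    rw [ContinuousLinearMap.det, ← LinearMap.det_toMatrix', hm]
    exact hx
  set φ' := (fderiv ℝ φ 0).toContinuousLinearEquivOfDetNeZero hdet with hφ'
  have hd' : HasFDerivAt φ (φ' : (Fin n → ℝ) →L[ℝ] (Fin n → ℝ)) 0 := by
    rw [hφ', ContinuousLinearMap.coe_toContinuousLinearEquivOfDetNeZero]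
    exact hd.hasFDerivAt
  have h0 : φ 0 = 0 := by
    funext i
    simp [hφ, translate_zero]
  have hω : (ω : WithTop ℕ∞) ≠ 0 := by simp
  refine ⟨(hs.contDiffAt (x := 0)).localInverse hd' hω, ?_, ?_, ?_⟩
  · have := (hs.contDiffAt (x := 0)).to_localInverse hd' hω
    rwa [h0] at this
  · have := (hs.contDiffAt (x := 0)).localInverse_apply_image hd' hω
    rwa [h0] at this
  · have := ((hs.contDiffAt (x := 0)).hasStrictFDerivAt' hd' hω).eventually_right_inverse
    rw [h0] at this
    filter_upwards [this] with u hu i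
    have h1 := congrFun hu i
    change (translate x _).get (Sum.inl i) 0 - x.get (Sum.inl i) 0 = u i at h1
    rw [← h1]
    simp only [ContDiffAt.localInverse]
    ring

section Normalization

variable {x : Jet (Fin n ⊕ Fin m) n r} {α : (Fin n → ℝ) → Fin n → ℝ} (hα : ContDiffAt ℝ ω α 0)
  (hα' : ∀ᶠ u in 𝓝 0, ∀ i,
    (translate x (α u)).get (Sum.inl i) 0 = x.get (Sum.inl i) 0 + u i)
include hα hα'

/-- Differentiating `x^i ∘ α = u^i + const` shows that the Jacobian matrix of `α` is the inverse of
`(x^i_j)` along the curve of jets, that is, `(z^i_j)`. -/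
theorem eventually_xMat_mul :
    ∀ᶠ u in 𝓝 0, xMat (translate x (α u)) *
      LinearMap.toMatrix' (fderiv ℝ α u : (Fin n → ℝ) →ₗ[ℝ] (Fin n → ℝ)) = 1 := by
  filter_upwards [hα'.eventually_nhds,
    ContDiffAt.eventually_differentiableAt (hα.of_le (m := ∞) le_top)] with u h1 h2
  ext i k
  have h3 := pd_comp_translate_comp (x := x) (f := fun y => y.get (Sum.inl i) 0) h2
    ((contDiff_get (k := 1) _ _).contDiffAt.differentiableAt (by simp)) k
  have h4 : (fun u => (translate x (α u)).get (Sum.inl i) 0) =ᶠ[𝓝 u]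
      fun u => x.get (Sum.inl i) 0 + u i := by
    filter_upwards [h1] with u hu
    exact hu i
  rw [(pd_congr h4 k).eq_of_nhds, pd, fderiv_const_add, (hasFDerivAt_apply (𝕜 := ℝ) i u).fderiv] at h3
  rw [Matrix.mul_apply, Matrix.one_apply]
  simp only [formalD_get] at h3
  simp only [LinearMap.toMatrix'_apply]
  rw [ContinuousLinearMap.proj_apply, Pi.single_apply] at h3
  rw [h3]
  exact Finset.sum_congr rfl fun j _ => mul_comm _ _

theorem det_fderiv_parameter (h0 : α 0 = 0) : (xMat x).det * (fderiv ℝ α 0).det = 1 := by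
  have h := (eventually_xMat_mul hα hα').self_of_nhds
  rw [h0, translate_zero] at h
  rw [ContinuousLinearMap.det, ← LinearMap.det_toMatrix', ← Matrix.det_mul, h, Matrix.det_one]

/-- In the new parameters `∂/∂u^i` acts on functions of the jet as `z^j_i d_j`, which is the
recursion that defines the `y^σ_I`. -/
theorem pds_normal_fibre (σ : Fin m) (I : List (Fin n)) :
    pds I (fun u => (translate x (α u)).get (Sum.inr σ) 0) =ᶠ[𝓝 0]
      fun u => yCoord σ I (translate x (α u)) := by
  induction I with
  | nil => rfl
  | cons i I ih =>
    filter_upwards [ih.eventually_nhds, eventually_xMat_mul hα hα',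
      ContDiffAt.eventually_differentiableAt (hα.of_le (m := ∞) le_top)] with u h1 h2 h3
    have hdet : (xMat (translate x (α u))).det ≠ 0 := by
      intro h
      have := congrArg Matrix.det h2
      rw [Matrix.det_mul, h, zero_mul, Matrix.det_one] at this
      exact zero_ne_one this
    change pd i (pds I _) u = _
    rw [(pd_congr h1 i).eq_of_nhds, pd_comp_translate_comp h3
      ((contDiffAt_yCoord hdet σ I).differentiableAt (by simp))]
    change _ = ∑ j, (xMat (translate x (α u)))⁻¹ j i * formalD j (yCoord σ I) (translate x (α u))
    rw [Matrix.inv_eq_right_inv h2]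
    rfl

theorem pds_normal_base (i : Fin n) (I : List (Fin n)) :
    pds I (fun u => (translate x (α u)).get (Sum.inl i) 0) 0 =
      if (I : Multiset (Fin n)) = 0 then x.get (Sum.inl i) 0 else
        if (I : Multiset (Fin n)) = {i} then 1 else 0 := by
  have h1 : ∀ I : List (Fin n), pds I (fun u => (translate x (α u)).get (Sum.inl i) 0) =ᶠ[𝓝 0]
      fun u => if (I : Multiset (Fin n)) = 0 then x.get (Sum.inl i) 0 + u i else
        if (I : Multiset (Fin n)) = {i} then 1 else 0 := by
    intro I
    induction I with
    | nil =>
      filter_upwards [hα'] with u hu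
      simp [pds, hu]
    | cons j I ih =>
      filter_upwards [ih.eventually_nhds] with u h1
      change pd j (pds I _) u = _
      rw [(pd_congr h1 j).eq_of_nhds]
      have h2 : ((j :: I : List (Fin n)) : Multiset (Fin n)) ≠ 0 := by simp
      rw [if_neg h2]
      by_cases hI : I = []
      · subst hI
        simp only [Multiset.coe_nil, if_true, Multiset.coe_singleton, Multiset.singleton_inj]
        rw [pd, fderiv_const_add, (hasFDerivAt_apply (𝕜 := ℝ) i u).fderiv,
          ContinuousLinearMap.proj_apply, Pi.single_apply]
        simp only [eq_comm]
      · have h3 : (I : Multiset (Fin n)) ≠ 0 := by simpa using hI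
        have h4 : ((j :: I : List (Fin n)) : Multiset (Fin n)) ≠ {i} := by
          intro h
          have := congrArg Multiset.card h
          simp only [Multiset.coe_card, List.length_cons, Multiset.card_singleton] at this
          exact hI (List.length_eq_zero_iff.1 (by omega))
        simp only [if_neg h3, if_neg h4]
        simp [pd]
  have h2 := (h1 I).self_of_nhds
  rw [h2]
  simp

end Normalization

/-- The coordinates of the velocity over `g` with `(x^i_j)` the unit matrix and vanishing `x^i_J`
for `|J| > 1`. -/
def normalSection (g : Gr n m r) : Jet (Fin n ⊕ Fin m) n r
  | Sum.inl i, J => if J.1 = 0 then g.1 i else if J.1 = {i} then 1 else 0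
  | Sum.inr σ, J => g.2 σ J

theorem contDiff_normalSection {k : WithTop ℕ∞} :
    ContDiff ℝ k (normalSection : Gr n m r → Jet (Fin n ⊕ Fin m) n r) := by
  refine contDiff_pi.2 fun A => contDiff_pi.2 fun J => ?_
  rcases A with i | σ
  · simp only [normalSection]
    split_ifs
    · exact (contDiff_apply ℝ ℝ i).comp contDiff_fst
    · exact contDiff_const
    · exact contDiff_const
  · simp only [normalSection]
    exact ((contDiff_apply ℝ ℝ J).comp (contDiff_apply ℝ (MIdx n r → ℝ) σ)).comp contDiff_snd

theorem normalSection_mem_immSet {X : Type*} [TopologicalSpace X] [ChartedSpace (Model n m) X]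
    {e : OpenPartialHomeomorph X (Model n m)} (hr : 1 ≤ r) {g : Gr n m r} (hg : g ∈ grSet r e) :
    normalSection g ∈ immSet r e := by
  constructor
  · have : (fun A => (normalSection g).get A 0) =
        (Sum.elim g.1 (fun σ => g.2.get σ 0) : Model n m) := by
      funext A
      rcases A with i | σ
      · rw [Jet.get_of_le _ _ (Nat.zero_le _)]
        simp [normalSection]
      · rfl
    change (fun A => (normalSection g).get A 0) ∈ e.target
    rw [this]
    exact hg
  · rw [Fintype.linearIndependent_iff]
    intro c hc i
    have h1 := congrFun hc (Sum.inl i)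
    rw [Finset.sum_apply] at h1
    have h2 : ∀ j : Fin n, (normalSection g).get (Sum.inl i) {j} = if j = i then 1 else 0 := by
      intro j
      rw [Jet.get_of_le _ _ (by rw [Multiset.card_singleton]; exact hr)]
      simp [normalSection]
    simpa [h2] using h1

end NormalForm

/-! ### Velocities and homogeneous equations in charts -/

section Charts

variable {n m r : ℕ} {X : Type*} [TopologicalSpace X] [ChartedSpace (Model n m) X]
  [IsManifold 𝓘(ℝ, Model n m) ∞ X] {e e' : OpenPartialHomeomorph X (Model n m)}

/-! ### Immersions in charts -/

theorem ImmGerm.contMDiffAt (γ : ImmGerm n m X) :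
    ContMDiffAt 𝓘(ℝ, Fin n → ℝ) 𝓘(ℝ, Model n m) ∞ γ.toFun 0 := by
  obtain ⟨U, hU, h0, hs, _⟩ := γ.immersion
  exact hs.contMDiffAt (hU.mem_nhds h0)

theorem ImmGerm.contDiffAt_chart (γ : ImmGerm n m X)
    (he : e ∈ IsManifold.maximalAtlas 𝓘(ℝ, Model n m) ∞ X) (h0 : γ.toFun 0 ∈ e.source) :
    ContDiffAt ℝ ∞ (fun τ => e (γ.toFun τ)) 0 :=
  ((contMDiffAt_of_mem_maximalAtlas he h0).comp (0 : Fin n → ℝ) γ.contMDiffAt).contDiffAt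

theorem ImmGerm.eventually_mem_source (γ : ImmGerm n m X) (h0 : γ.toFun 0 ∈ e.source) :
    ∀ᶠ τ in 𝓝 0, γ.toFun τ ∈ e.source :=
  γ.contMDiffAt.continuousAt.eventually (e.open_source.mem_nhds h0)

theorem ImmGerm.coord_eq (γ : ImmGerm n m X)
    (he : e ∈ IsManifold.maximalAtlas 𝓘(ℝ, Model n m) ∞ X) (h0 : γ.toFun 0 ∈ e.source)
    (A : Fin n ⊕ Fin m) (J : Multiset (Fin n)) :
    γ.coord e A J = evGerm (iter dGerm (J.sort (· ≤ ·)) (germ fun τ => e (γ.toFun τ) A)) :=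
  (evGerm_iter_dGerm (contDiffAt_pi.1 (γ.contDiffAt_chart he h0) A) _).symm

theorem ImmGerm.coord_zero (γ : ImmGerm n m X)
    (he : e ∈ IsManifold.maximalAtlas 𝓘(ℝ, Model n m) ∞ X) (h0 : γ.toFun 0 ∈ e.source)
    (A : Fin n ⊕ Fin m) : γ.coord e A 0 = e (γ.toFun 0) A := by
  rw [γ.coord_eq he h0, Multiset.sort_zero, iter_nil,
    evGerm_germ (contDiffAt_pi.1 (γ.contDiffAt_chart he h0) A)]

/-- Equal coordinates in one chart mean contact of order `r` there; composition with the transition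
map preserves it, so it holds in every chart at the point. -/
theorem sameJet_of_coord_eq {γ δ : ImmGerm n m X}
    (he : e ∈ IsManifold.maximalAtlas 𝓘(ℝ, Model n m) ∞ X) (hγ : γ.toFun 0 ∈ e.source)
    (hδ : δ.toFun 0 ∈ e.source)
    (h : ∀ A (J : Multiset (Fin n)), J.card ≤ r → γ.coord e A J = δ.coord e A J) :
    SameJet r γ δ := by
  have h0 : γ.toFun 0 = δ.toFun 0 := by
    refine e.injOn hγ hδ (funext fun A => ?_)
    rw [← γ.coord_zero he hγ, ← δ.coord_zero he hδ]
    exact h A 0 (by simp)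
  refine ⟨h0, fun e' he' hγ' A J hJ => ?_⟩
  have hδ' : δ.toFun 0 ∈ e'.source := h0 ▸ hγ'
  have hP := γ.contDiffAt_chart he hγ
  have hQ := δ.contDiffAt_chart he hδ
  have hflat : ∀ B, IsFlat r (germ (fun τ => e (γ.toFun τ) B) - germ fun τ => e (δ.toFun τ) B) := by
    intro B L hL
    have h1 := h B (L : Multiset (Fin n)) (by rwa [Multiset.coe_card])
    rw [γ.coord_eq he hγ, δ.coord_eq he hδ] at h1
    have hp : L.Perm ((L : Multiset (Fin n)).sort (· ≤ ·)) :=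
      (Multiset.coe_eq_coe.1 (Multiset.sort_eq _ _)).symm
    rw [iter_sub, map_sub, commuting_dGerm.iter_perm _ hp, commuting_dGerm.iter_perm _ hp, h1,
      sub_self]
  have hf : ContDiffAt ℝ ∞ (fun y => e' (e.symm y) A) (e (γ.toFun 0)) := by
    have h1 : ContMDiffAt 𝓘(ℝ, Model n m) 𝓘(ℝ, Model n m) ∞ e.symm (e (γ.toFun 0)) :=
      contMDiffAt_symm_of_mem_maximalAtlas he (e.map_source hγ)
    have h2 : ContMDiffAt 𝓘(ℝ, Model n m) 𝓘(ℝ, Model n m) ∞ e' (e.symm (e (γ.toFun 0))) := by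
      rw [e.left_inv hγ]
      exact contMDiffAt_of_mem_maximalAtlas he' hγ'
    exact contDiffAt_pi.1 (h2.comp (e (γ.toFun 0)) h1).contDiffAt A
  have hmain := isFlat_comp hP hQ hflat (congrArg e h0) hf
  have hcongr : ∀ ε : ImmGerm n m X, ε.toFun 0 ∈ e.source →
      germ (fun τ => e' (e.symm (e (ε.toFun τ))) A) = germ fun τ => e' (ε.toFun τ) A := by
    intro ε hε
    apply germ_congr
    filter_upwards [ε.eventually_mem_source hε] with τ hτ
    rw [e.left_inv hτ]
  rw [hcongr γ hγ, hcongr δ hδ] at hmain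
  have h3 := hmain (J.sort (· ≤ ·)) (by rwa [Multiset.length_sort])
  rw [iter_sub, map_sub, sub_eq_zero] at h3
  rw [γ.coord_eq he' hγ', δ.coord_eq he' hδ', h3]

theorem coords_jet (γ : ImmGerm n m X) (he : e ∈ IsManifold.maximalAtlas 𝓘(ℝ, Model n m) ∞ X)
    (hγ : γ.toFun 0 ∈ e.source) :
    (γ.jet r).coords e = fun A J => γ.coord e A J.1 := by
  funext A J
  have h : SameJet r (Quotient.out (s := jetSetoid n m r X) (γ.jet r)) γ :=
    Quotient.mk_out (s := jetSetoid n m r X) γ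
  exact h.2 e he (h.1.symm ▸ hγ) A J.1 J.2

/-- The components of a field are transported to coordinates by `Function.extend`; injectivity
guarantees that this returns the component at the intended velocity. -/
theorem coords_injective (he : e ∈ IsManifold.maximalAtlas 𝓘(ℝ, Model n m) ∞ X) :
    Function.Injective
      (fun v : {v : RegVel n m r X // v.target ∈ e.source} => v.1.coords e) := by
  rintro ⟨v, hv⟩ ⟨w, hw⟩ h
  induction v using Quotient.inductionOn with
  | h γ =>
    induction w using Quotient.inductionOn with
    | h δ =>
      have hγ : γ.toFun 0 ∈ e.source := hv
      have hδ : δ.toFun 0 ∈ e.source := hw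
      have h1 : (γ.jet r).coords e = (δ.jet r).coords e := h
      rw [coords_jet γ he hγ, coords_jet δ he hδ] at h1
      refine Subtype.ext (Quotient.sound (s := jetSetoid n m r X) ?_)
      exact sameJet_of_coord_eq he hγ hδ fun A J hJ => congrFun (congrFun h1 A) ⟨J, hJ⟩

theorem expr_coords (T : HorForm n m r X) (γ : ImmGerm n m X)
    (he : e ∈ IsManifold.maximalAtlas 𝓘(ℝ, Model n m) ∞ X) (hγ : γ.toFun 0 ∈ e.source)
    (A : Fin n ⊕ Fin m) :
    T.expr e A (fun B J => γ.coord e B J.1) = T.comp e A (γ.jet r) := by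
  rw [← coords_jet γ he hγ]
  exact (coords_injective he).extend_apply _ _ ⟨γ.jet r, hγ⟩

/-- The order `ω` is used because `ContDiffAt` of order `ω` at a point persists on a neighbourhood,
whereas order `∞` at a point gives only finite orders on neighbourhoods that may shrink. Injectivity
of the differential is an open condition. -/
theorem exists_immGerm (he : e ∈ IsManifold.maximalAtlas 𝓘(ℝ, Model n m) ∞ X)
    {p : (Fin n → ℝ) → Model n m} (hp : ContDiffAt ℝ ω p 0) (h0 : p 0 ∈ e.target)
    (hinj : Function.Injective (fderiv ℝ p 0)) :
    ∃ γ : ImmGerm n m X, γ.toFun = fun τ => e.symm (p τ) := by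
  have h1 : ∀ᶠ τ in 𝓝 0, ContDiffAt ℝ ω p τ ∧ p τ ∈ e.target ∧
      Function.Injective (fderiv ℝ p τ) := by
    have hc : ContinuousAt (fderiv ℝ p) 0 := (hp.fderiv_right (m := 0) le_top).continuousAt
    filter_upwards [hp.eventually (by simp), hp.continuousAt.eventually
      (e.open_target.mem_nhds h0), hc.eventually
      (ContinuousLinearMap.isOpen_injective.mem_nhds hinj)] with τ h1 h2 h3
    exact ⟨h1, h2, h3⟩
  obtain ⟨U, hU, hUo, h0U⟩ := eventually_nhds_iff.1 h1
  have hs : ∀ τ ∈ U, ContMDiffAt 𝓘(ℝ, Fin n → ℝ) 𝓘(ℝ, Model n m) ∞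
      (fun τ => e.symm (p τ)) τ := fun τ hτ =>
    (contMDiffAt_symm_of_mem_maximalAtlas he (hU τ hτ).2.1).comp τ
      ((hU τ hτ).1.of_le le_top).contMDiffAt
  refine ⟨⟨fun τ => e.symm (p τ), U, hUo, h0U, fun τ hτ => (hs τ hτ).contMDiffWithinAt,
    fun τ hτ => ?_⟩, rfl⟩
  have h2 : e.symm (p τ) ∈ e.source := e.map_target (hU τ hτ).2.1
  have h3 : MDifferentiableAt 𝓘(ℝ, Model n m) 𝓘(ℝ, Model n m) e (e.symm (p τ)) :=
    (contMDiffAt_of_mem_maximalAtlas he h2).mdifferentiableAt (by simp)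
  have h4 := mfderiv_comp τ h3 ((hs τ hτ).mdifferentiableAt (by simp))
  have h5 : (e ∘ fun τ => e.symm (p τ)) =ᶠ[𝓝 τ] p := by
    filter_upwards [hUo.mem_nhds hτ] with τ' hτ'
    exact e.right_inv (hU τ' hτ').2.1
  rw [h5.mfderiv_eq, mfderiv_eq_fderiv] at h4
  intro v w hvw
  apply (hU τ hτ).2.2
  have h6 := congrArg (mfderiv 𝓘(ℝ, Model n m) 𝓘(ℝ, Model n m) e (e.symm (p τ))) hvw
  rw [h4]
  exact h6

variable {T : DiffEq n m r X}

theorem DiffEq.IsHomogeneous.comp_eq (h : T.IsHomogeneous) {γ δ : ImmGerm n m X}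
    {α : DiffGerm n} (hα : δ.toFun =ᶠ[𝓝 0] γ.toFun ∘ α.toFun) (A : Fin n ⊕ Fin m) :
    T.form.comp e A (δ.jet r) = (fderiv ℝ α.toFun 0).det * T.form.comp e A (γ.jet r) := by
  have h0 : δ.toFun 0 = γ.toFun 0 := by
    have := hα.self_of_nhds
    rwa [Function.comp_apply, α.map_zero] at this
  -- The tangent spaces at `δ(0)` and `γ(0)` are equal only propositionally; the vectors are
  -- compared in the model space.
  have h1 : (mfderiv 𝓘(ℝ, Model n m) 𝓘(ℝ, Model n m) e.symm (e (δ.toFun 0))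
      (Pi.single A 1 : Model n m) : Model n m) =
    mfderiv 𝓘(ℝ, Model n m) 𝓘(ℝ, Model n m) e.symm (e (γ.toFun 0))
      (Pi.single A 1 : Model n m) :=
    congrArg (fun y => (mfderiv 𝓘(ℝ, Model n m) 𝓘(ℝ, Model n m) e.symm (e y)
      (Pi.single A 1 : Model n m) : Model n m)) h0
  have h2 := h.equivariant γ δ α hα (mfderiv 𝓘(ℝ, Model n m) 𝓘(ℝ, Model n m) e.symm
    (e (γ.toFun 0)) (Pi.single A 1 : Model n m))
  rw [← h1] at h2
  refine h2.trans ?_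
  congr 2

theorem DiffEq.IsHomogeneous.sum_comp_eq_zero (h : T.IsHomogeneous) (γ : ImmGerm n m X)
    (he : e ∈ IsManifold.maximalAtlas 𝓘(ℝ, Model n m) ∞ X) (hγ : γ.toFun 0 ∈ e.source)
    (j : Fin n) :
    ∑ A, fderiv ℝ (fun τ => e (γ.toFun τ)) 0 (Pi.single j 1) A * T.form.comp e A (γ.jet r) = 0 := by
  -- The covector read in the chart, so that the tangent vector of `γ` can be expanded in the
  -- coordinate basis.
  let L : Model n m →ₗ[ℝ] ℝ :=
    { toFun := fun ξ => T.form (γ.jet r)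
        (mfderiv 𝓘(ℝ, Model n m) 𝓘(ℝ, Model n m) e.symm (e (γ.toFun 0)) ξ)
      map_add' := fun a b => (congrArg (T.form (γ.jet r)) (map_add (mfderiv 𝓘(ℝ, Model n m)
        𝓘(ℝ, Model n m) e.symm (e (γ.toFun 0))) a b)).trans (map_add (T.form (γ.jet r)) _ _)
      map_smul' := fun c a => (congrArg (T.form (γ.jet r)) (map_smul (mfderiv 𝓘(ℝ, Model n m)
        𝓘(ℝ, Model n m) e.symm (e (γ.toFun 0))) c a)).trans (map_smul (T.form (γ.jet r)) _ _) }
  have h1 : γ.toFun =ᶠ[𝓝 0] e.symm ∘ fun τ => e (γ.toFun τ) := by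
    filter_upwards [γ.eventually_mem_source hγ] with τ hτ
    exact (e.left_inv hτ).symm
  have h2 : MDifferentiableAt 𝓘(ℝ, Model n m) 𝓘(ℝ, Model n m) e.symm (e (γ.toFun 0)) :=
    (contMDiffAt_symm_of_mem_maximalAtlas he (e.map_source hγ)).mdifferentiableAt (by simp)
  have h3 : MDifferentiableAt 𝓘(ℝ, Fin n → ℝ) 𝓘(ℝ, Model n m) (fun τ => e (γ.toFun τ)) 0 :=
    ((γ.contDiffAt_chart he hγ).differentiableAt (by simp)).mdifferentiableAt
  have h4 := mfderiv_comp (0 : Fin n → ℝ) h2 h3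
  have h5 := h.contraction γ j
  have h6 : (mfderiv 𝓘(ℝ, Fin n → ℝ) 𝓘(ℝ, Model n m) γ.toFun 0
      (Pi.single j 1 : Fin n → ℝ) : Model n m) =
      mfderiv 𝓘(ℝ, Model n m) 𝓘(ℝ, Model n m) e.symm (e (γ.toFun 0))
        (fderiv ℝ (fun τ => e (γ.toFun τ)) 0 (Pi.single j 1)) := by
    rw [h1.mfderiv_eq, h4, mfderiv_eq_fderiv]
    rfl
  have h7 : L (fderiv ℝ (fun τ => e (γ.toFun τ)) 0 (Pi.single j 1)) = 0 :=
    (congrArg (fun ξ : Model n m => T.form (γ.jet r) ξ) h6).symm.trans h5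
  rw [pi_eq_sum_univ' (fderiv ℝ (fun τ => e (γ.toFun τ)) 0 (Pi.single j 1)), map_sum] at h7
  rw [← h7]
  refine Finset.sum_congr rfl fun A _ => ?_
  rw [map_smul, smul_eq_mul]
  rfl

end Charts

/-! ### Existence of the associated non-homogeneous equation -/

section Associated

variable {n m r : ℕ} {X : Type*} [TopologicalSpace X] [ChartedSpace (Model n m) X]
  [IsManifold 𝓘(ℝ, Model n m) ∞ X] {e : OpenPartialHomeomorph X (Model n m)}

theorem pds_translate (x : Jet (Fin n ⊕ Fin m) n r) (A : Fin n ⊕ Fin m) (L : List (Fin n)) :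
    pds L (fun τ => (translate x τ).get A 0) =
      fun τ => (translate x τ).get A (L : Multiset (Fin n)) := by
  induction L with
  | nil => rfl
  | cons i L ih =>
    change pd i (pds L _) = _
    rw [ih]
    funext τ
    exact pd_translate_get x A _ i τ

theorem ImmGerm.coord_of_chart_eq {γ : ImmGerm n m X}
    (he : e ∈ IsManifold.maximalAtlas 𝓘(ℝ, Model n m) ∞ X) {p : (Fin n → ℝ) → Model n m}
    (hp : ContDiffAt ℝ ∞ p 0) (h0 : p 0 ∈ e.target) (hγ : γ.toFun = fun τ => e.symm (p τ))
    (A : Fin n ⊕ Fin m) (J : Multiset (Fin n)) :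
    γ.coord e A J = pds (J.sort (· ≤ ·)) (fun τ => p τ A) 0 := by
  have hsrc : γ.toFun 0 ∈ e.source := by
    rw [hγ]
    exact e.map_target h0
  have h1 : germ (fun τ => e (γ.toFun τ) A) = germ fun τ => p τ A := by
    apply germ_congr
    filter_upwards [hp.continuousAt.eventually (e.open_target.mem_nhds h0)] with τ hτ
    rw [hγ, e.right_inv hτ]
  have hA := contDiffAt_pi.1 hp A
  rw [γ.coord_eq he hsrc, h1, iter_dGerm_germ hA, evGerm_germ (contDiffAt_pds hA _)]

/-- The velocity with given coordinates. -/
theorem exists_immGerm_coord (he : e ∈ IsManifold.maximalAtlas 𝓘(ℝ, Model n m) ∞ X)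
    {x : Jet (Fin n ⊕ Fin m) n r} (hx : x ∈ wSet r e) :
    ∃ γ : ImmGerm n m X, (γ.toFun = fun τ => e.symm fun A => (translate x τ).get A 0) ∧
      γ.toFun 0 ∈ e.source ∧ (fun A (J : MIdx n r) => γ.coord e A J.1) = x ∧
      ∀ j A, fderiv ℝ (fun τ => e (γ.toFun τ)) 0 (Pi.single j 1) A = x.get A {j} := by
  set p : (Fin n → ℝ) → Model n m := fun τ A => (translate x τ).get A 0 with hp
  have hs : ContDiff ℝ ω p := contDiff_pi.2 fun A => contDiff_translate_get x A 0
  have hd : DifferentiableAt ℝ p 0 := hs.contDiffAt.differentiableAt (by simp)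
  have h0 : p 0 ∈ e.target := by
    simp only [hp, translate_zero]
    exact hx.1
  have hpd : ∀ j A, pd j (fun τ => p τ A) 0 = x.get A {j} := by
    intro j A
    have := pd_translate_get x A 0 j 0
    rw [translate_zero] at this
    exact this
  have hinj : Function.Injective (fderiv ℝ p 0) := by
    rw [injective_iff_map_eq_zero]
    intro v hv
    have h1 : (xMat x).mulVec v = 0 := by
      funext i
      have h2 := congrFun hv (Sum.inl i)
      rw [fderiv_pi_eq_sum_pd hd] at h2
      simp only [hpd] at h2
      exact (Finset.sum_congr rfl fun j _ => mul_comm (xMat x i j) (v j)).trans h2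
    exact Matrix.eq_zero_of_mulVec_eq_zero hx.2 h1
  obtain ⟨γ, hγ⟩ := exists_immGerm he hs.contDiffAt h0 hinj
  refine ⟨γ, hγ, by rw [hγ]; exact e.map_target h0, ?_, fun j A => ?_⟩
  · funext A J
    rw [ImmGerm.coord_of_chart_eq he (hs.contDiffAt.of_le le_top) h0 hγ]
    simp only [hp]
    rw [pds_translate]
    beta_reduce
    rw [translate_zero, Multiset.sort_eq, Jet.get_coe]
  · have h1 : (fun τ => e (γ.toFun τ)) =ᶠ[𝓝 0] p := by
      filter_upwards [hs.continuous.continuousAt.eventually (e.open_target.mem_nhds h0)] with τ hτ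
      rw [hγ, e.right_inv hτ]
    rw [h1.fderiv_eq, fderiv_pi_eq_sum_pd hd, Finset.sum_eq_single j]
    · rw [Pi.single_eq_same, one_mul, hpd]
    · intro k _ hk
      rw [Pi.single_eq_of_ne hk, zero_mul]
    · simp

variable {T : DiffEq n m r X}

/-- The velocity with coordinates `x` and its reparametrization `γ ∘ α` in normal form are related
by equivariance with the factor `det(α)`, and `det(𝐱) det(α) = 1`. The normal form depends only on
`ρ(x)`. -/
theorem DiffEq.IsHomogeneous.expr_eq (h : T.IsHomogeneous)
    (he : e ∈ IsManifold.maximalAtlas 𝓘(ℝ, Model n m) ∞ X)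
    {x : Jet (Fin n ⊕ Fin m) n r} (hx : x ∈ wSet r e) (A : Fin n ⊕ Fin m) :
    T.form.expr e A x = (xMat x).det * T.form.expr e A (normalSection (rho x)) := by
  obtain ⟨γ, hγ, hγ0, hγx, _⟩ := exists_immGerm_coord he hx
  obtain ⟨α, hα, hα0, hαx⟩ := exists_normalizing_parameter x hx.2
  have hdet := det_fderiv_parameter hα hαx hα0
  let a : DiffGerm n :=
    { toFun := α
      smooth := by
        obtain ⟨U, hU, hUo, h0U⟩ := eventually_nhds_iff.1 (hα.eventually (by simp))
        exact ⟨U, hUo, h0U, fun u hu => ((hU u hu).of_le le_top).contDiffWithinAt⟩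
      map_zero := hα0
      det_ne_zero := fun h0 => by rw [h0, mul_zero] at hdet; exact zero_ne_one hdet }
  set q : (Fin n → ℝ) → Model n m := fun u A => (translate x (α u)).get A 0 with hq
  have hs : ContDiffAt ℝ ω q 0 := contDiffAt_pi.2 fun A =>
    (contDiff_translate_get x A 0).contDiffAt.comp (0 : Fin n → ℝ) hα
  have hd : DifferentiableAt ℝ q 0 := hs.differentiableAt (by simp)
  have h0 : q 0 ∈ e.target := by
    simp only [hq, hα0, translate_zero]
    exact hx.1
  have hinj : Function.Injective (fderiv ℝ q 0) := by
    intro v w hvw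
    funext i
    have h1 : ∀ v : Fin n → ℝ, fderiv ℝ q 0 v (Sum.inl i) = v i := by
      intro v
      rw [fderiv_pi_eq_sum_pd hd, Finset.sum_eq_single i]
      · have h2 := pds_normal_base hα hαx i [i]
        change pd i (fun u => q u (Sum.inl i)) 0 = _ at h2
        rw [h2]
        simp
      · intro j _ hj
        have h2 := pds_normal_base hα hαx i [j]
        change pd j (fun u => q u (Sum.inl i)) 0 = _ at h2
        rw [h2]
        simp [hj]
      · simp
    rw [← h1 v, hvw, h1]
  obtain ⟨δ, hδ⟩ := exists_immGerm he hs h0 hinj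
  have hδ0 : δ.toFun 0 ∈ e.source := by
    rw [hδ]
    exact e.map_target h0
  have hδx : (fun A (J : MIdx n r) => δ.coord e A J.1) = normalSection (rho x) := by
    funext A J
    rw [ImmGerm.coord_of_chart_eq he (hs.of_le le_top) h0 hδ]
    rcases A with i | σ
    · exact (pds_normal_base hα hαx i _).trans (by rw [Multiset.sort_eq]; rfl)
    · refine (pds_normal_fibre hα hαx σ _).self_of_nhds.trans ?_
      beta_reduce
      rw [hα0, translate_zero]
      rfl
  have hcomp : δ.toFun =ᶠ[𝓝 0] γ.toFun ∘ a.toFun := by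
    rw [hδ, hγ]
    rfl
  have h1 := h.comp_eq (e := e) hcomp A
  rw [← expr_coords T.form δ he hδ0, ← expr_coords T.form γ he hγ0, hδx, hγx] at h1
  rw [h1, ← mul_assoc]
  change _ = (xMat x).det * (fderiv ℝ α 0).det * _
  rw [hdet, one_mul]

/-- The contraction property reads `x^k_j 𝓣_k = -x^σ_j 𝓣_σ`; multiply by the inverse matrix and use
`y^σ_i = z^j_i x^σ_j`. -/
theorem DiffEq.IsHomogeneous.expr_inl (h : T.IsHomogeneous)
    (he : e ∈ IsManifold.maximalAtlas 𝓘(ℝ, Model n m) ∞ X)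
    {x : Jet (Fin n ⊕ Fin m) n r} (hx : x ∈ wSet r e) (i : Fin n) :
    T.form.expr e (Sum.inl i) x = -∑ σ, yCoord σ [i] x * T.form.expr e (Sum.inr σ) x := by
  obtain ⟨γ, -, hγ0, hγx, hγd⟩ := exists_immGerm_coord he hx
  have h1 : ∀ j, ∑ k, T.form.expr e (Sum.inl k) x * xMat x k j =
      -∑ σ, x.get (Sum.inr σ) {j} * T.form.expr e (Sum.inr σ) x := by
    intro j
    have h2 := h.sum_comp_eq_zero γ he hγ0 j
    simp only [hγd, ← expr_coords T.form γ he hγ0, hγx] at h2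
    rw [Fintype.sum_sum_type] at h2
    rw [eq_neg_iff_add_eq_zero, ← h2]
    simp only [mul_comm, xMat]
  have h3 : ∑ j, (∑ k, T.form.expr e (Sum.inl k) x * xMat x k j) * (xMat x)⁻¹ j i =
      T.form.expr e (Sum.inl i) x := by
    have h4 := Matrix.vecMul_vecMul (fun k => T.form.expr e (Sum.inl k) x) (xMat x) (xMat x)⁻¹
    rw [Matrix.mul_nonsing_inv _ (Ne.isUnit hx.2), Matrix.vecMul_one] at h4
    exact congrFun h4 i
  rw [← h3]
  simp only [h1, neg_mul, Finset.sum_neg_distrib, Finset.sum_mul]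
  rw [Finset.sum_comm]
  congr 1
  refine Finset.sum_congr rfl fun σ _ => ?_
  simp only [yCoord, formalD_get, Finset.sum_mul]
  refine Finset.sum_congr rfl fun j _ => ?_
  rw [show (j ::ₘ (0 : Multiset (Fin n))) = {j} from rfl]
  ring

/-- The components of the associated non-homogeneous equation. -/
theorem DiffEq.IsHomogeneous.isAssociated (h : T.IsHomogeneous)
    (he : e ∈ IsManifold.maximalAtlas 𝓘(ℝ, Model n m) ∞ X) (hr : 1 ≤ r) :
    T.IsAssociated e fun σ g => T.form.expr e (Sum.inr σ) (normalSection g) where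
  smooth σ := (T.smooth e he (Sum.inr σ)).comp contDiff_normalSection.contDiffOn
    fun _ hg => normalSection_mem_immSet hr hg
  fibre σ _ hx := h.expr_eq he hx (Sum.inr σ)
  base i x hx := by
    rw [h.expr_inl he hx, Finset.mul_sum]
    congr 1
    refine Finset.sum_congr rfl fun σ _ => ?_
    rw [h.expr_eq he hx (Sum.inr σ)]
    ring

end Associated

end Velocity

end

/-- The existence of the `T_σ` and the relation `𝐳 · 𝐱 = e` belong to the conclusion, so that
neither the associated equation nor the meaning of `𝐳` is presupposed. The formulas are then local
at `x`: the relations between `𝓣` and `T` hold near `x` because `W^t` is open. -/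
theorem mainTheorem3 {n m s t : ℕ} (hn : 1 ≤ n) (hs : 1 ≤ s) (hst : 2 * s ≤ t)
    {X : Type*} [TopologicalSpace X] [ChartedSpace (Velocity.Model n m) X]
    [IsManifold 𝓘(ℝ, Velocity.Model n m) ∞ X]
    (𝓣 : Velocity.DiffEq n m s X) (h𝓣 : 𝓣.IsHomogeneous)
    (e : OpenPartialHomeomorph X (Velocity.Model n m))
    (he : e ∈ IsManifold.maximalAtlas 𝓘(ℝ, Velocity.Model n m) ∞ X) :
    (∃ T : Fin m → Velocity.Gr n m s → ℝ, 𝓣.IsAssociated e T) ∧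
    ∀ T : Fin m → Velocity.Gr n m s → ℝ, 𝓣.IsAssociated e T →
    ∀ x ∈ Velocity.wSet t e,
      let D : ℝ := (Velocity.xMat x).det
      let HH : Fin n ⊕ Fin m → Fin n ⊕ Fin m → List (Fin n) → ℝ :=
        fun A B J => Velocity.helmholtz s t (𝓣.form.expr e) A B J x
      let H : Fin m → Fin m → List (Fin n) → ℝ :=
        fun σ ν I => Velocity.grHelmholtz s t T σ ν I (Velocity.rho x)
      let y : Fin m → List (Fin n) → ℝ := fun σ I => Velocity.yCoord σ I x
      -- `𝐳 · 𝐱 = e` in the differential group, i.e. `𝐳` is the inverse of `𝐱`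
      (∀ (i : Fin n) (l : ℕ) (I : Fin l → Fin n), 1 ≤ l → l ≤ t →
        ∑ c : OrderedFinpartition l, ∑ j : Fin c.length → Fin n,
          (∏ a, x.get (Sum.inl (j a)) (List.ofFn (I ∘ c.emb a) : List (Fin n))) *
            Velocity.zCoord i (List.ofFn j) x
        = if List.ofFn I = [i] then 1 else 0) ∧
      (∀ σ ν, HH (Sum.inr σ) (Sum.inr ν) [] = D * H σ ν []) ∧
      (∀ σ ν, ∀ k : ℕ, 1 ≤ k → k ≤ s → ∀ j : Fin k → Fin n,
        HH (Sum.inr σ) (Sum.inr ν) (List.ofFn j) =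
          D * ∑ l ∈ Finset.Icc k s, ∑ I : Fin l → Fin n,
            Velocity.zSum j I x * H σ ν (List.ofFn I)) ∧
      (∀ σ p, HH (Sum.inr σ) (Sum.inl p) [] =
        -(D * ∑ l₀ ∈ Finset.range (s + 1), ∑ I₀ : Fin l₀ → Fin n, ∑ ν,
            y ν (p :: List.ofFn I₀) * H σ ν (List.ofFn I₀))) ∧
      (∀ σ p, ∀ k : ℕ, 1 ≤ k → k ≤ s → ∀ j : Fin k → Fin n,
        HH (Sum.inr σ) (Sum.inl p) (List.ofFn j) =
          -(D * ∑ l₀ ∈ Finset.range (s + 1), ∑ I₀ : Fin l₀ → Fin n,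
            ∑ l ∈ Finset.Icc k (s - l₀), ∑ I : Fin l → Fin n,
              ((l + l₀).choose l : ℝ) * Velocity.zSum j I x *
                ∑ ν, y ν (p :: List.ofFn I₀) * H σ ν (List.ofFn I ++ List.ofFn I₀))) ∧
      (∀ p ν, HH (Sum.inl p) (Sum.inr ν) [] = -(D * ∑ σ, y σ [p] * H σ ν [])) ∧
      (∀ p ν, ∀ k : ℕ, 1 ≤ k → k ≤ s → ∀ j : Fin k → Fin n,
        HH (Sum.inl p) (Sum.inr ν) (List.ofFn j) =
          -(D * ∑ σ, y σ [p] * ∑ l ∈ Finset.Icc k s, ∑ I : Fin l → Fin n,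
            Velocity.zSum j I x * H σ ν (List.ofFn I))) ∧
      (∀ p q, HH (Sum.inl p) (Sum.inl q) [] =
        D * ∑ σ, y σ [p] * ∑ l₀ ∈ Finset.range (s + 1), ∑ I₀ : Fin l₀ → Fin n, ∑ ν,
          y ν (q :: List.ofFn I₀) * H σ ν (List.ofFn I₀)) ∧
      (∀ p q, ∀ k : ℕ, 1 ≤ k → k ≤ s → ∀ j : Fin k → Fin n,
        HH (Sum.inl p) (Sum.inl q) (List.ofFn j) =
          D * ∑ σ, y σ [p] * ∑ l₀ ∈ Finset.range (s + 1), ∑ I₀ : Fin l₀ → Fin n,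
            ∑ l ∈ Finset.Icc k (s - l₀), ∑ I : Fin l → Fin n,
              ((l + l₀).choose l : ℝ) * Velocity.zSum j I x *
                ∑ ν, y ν (q :: List.ofFn I₀) * H σ ν (List.ofFn I ++ List.ofFn I₀)) := by
  refine ⟨⟨_, h𝓣.isAssociated he hs⟩, fun T hT x hx => ?_⟩
  exact ⟨fun i l I hl hlt => Velocity.zCoord_comp hx.2 i I hl hlt,
    (hT.isHomogeneousAt hs hst hx).helmholtz⟩
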